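/- **Setting.** Let $D\subset\mathbb R^2$ be the unit disk centred at the origin, $\bm\nu$ its outward unit normal, and let $\lambda,\mu,\tau,\delta>0$. For $k\in\mathbb C\setminus(-\infty,0]$ let $G^k(x)=-\frac{\mathrm i}{4}H^{(1)}_0(k|x|)$ (principal branch), let $S^k_{\partial D}[\varphi](x)=\int_{\partial D}G^k(x-y)\varphi(y)\,ds(y)$ and $K^{k,*}_{\partial D}[\varphi](x)=\mathrm{p.v.}\int_{\partial D}\nabla_xG^k(x-y)\cdot\bm\nu_x\,\varphi(y)\,ds(y)$. For $\omega=k\tau$, $k_s=\omega/\sqrt{\mu}$, $k_p=\omega/\sqrt{\lambda+2\mu}$ let $$\mathbf\Gamma^{\omega}=\frac1{\omega^2}(k_s^2\mathbf I+\nabla\nabla)G^{k_s}-\frac1{\omega^2}\nabla\nabla G^{k_p},$$ $\mathbf S^{\omega}_{\partial D}[\bm\varphi](x)=\int_{\partial D}\mathbf\Gamma^\omega(x-y)\bm\varphi(y)\,ds(y)$ and $\mathbf K^{\omega,*}_{\partial D}[\bm\varphi](x)=\mathrm{p.v.}\int_{\partial D}\frac{\partial\mathbf\Gamma^\omega}{\partial\bm\nu(x)}(x-y)\bm\varphi(y)\,ds(y)$,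 where $\partial_{\bm\nu}\mathbf w=\lambda(\nabla\cdot\mathbf w)\bm\nu+\mu(\nabla\mathbf w+\nabla\mathbf w^t)\bm\nu$. On $\mathcal H=L^2(\partial D)\times L^2(\partial D)^2$ put $$\mathcal A(k,\delta)=\begin{pmatrix}\frac1{k^2}\left(-\frac I2+K^{k,*}_{\partial D}\right)&-\bm\nu\cdot\mathbf S^{k\tau}_{\partial D}\\ \delta\tau^2\bm\nu S^k_{\partial D}&\frac I2+\mathbf K^{k\tau,*}_{\partial D}\end{pmatrix}.$$ Strong resonance occurs at $k$ if $\mathcal A(k,\delta)[\Phi]=0$ for some nonzero $\Phi\in\mathcal H$. Call $k$ a *radial resonant frequency* if such a $\Phi$ exists of the form $\Phi=(b_1,b_2\bm\nu)$ with $b_1,b_2\in\mathbb C$. Let $\gamma=2E_c-\mathrm i\pi-2\ln2$, with $E_c$ Euler's constant, and consider the equation $$(\gamma+2\ln k)\left(\frac{\mu+\delta\tau^2}{4(\lambda+2\mu)}+\frac{k^2\tau^2\lambda\left(\gamma+2\ln\left(k\tau/\sqrt{\lambda+2\mu}\right)\right)}{16(\lambda+2\mu)^2}\right)=0\qquad(*)$$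 (principal logarithm). **Theorem.** Let $0<\lambda_0\le\lambda_1$ and $0<\tau_0\le\tau_1$. There is $r>0$ such that for every $\eta>0$ there is $\varepsilon>0$ such that for all $\lambda\in[\lambda_0,\lambda_1]$, $\tau\in[\tau_0,\tau_1]$, $0<\mu<\varepsilon$, $0<\delta<\varepsilon$ the following hold, with $k,k_0\in\mathbb C\setminus(-\infty,0]$. 1. Strong resonance occurs: there is a radial resonant frequency $k$ with $|k|<\min(r,\eta)$. 2. For every radial resonant frequency $k$ with $|k|<r$ there is a root $k_0$ of $(*)$ with $|k-k_0|\le\eta|k_0|$. 3. For every root $k_0$ of $(*)$ with $|k_0|<r$ there is a radial resonant frequency $k$ with $|k-k_0|\le\eta|k_0|$. That is, the roots of $(*)$ are the leading-order terms of the radial resonant frequencies as $k,\delta,\mu\to0$. -/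

import Mathlib

open MeasureTheory Filter Topology

/-! ## Hankel function of order zero -/

namespace Minnaert

noncomputable section

/-- The Bessel function `J₀`, by its everywhere convergent power series. -/
def besselJ0 (z : ℂ) : ℂ :=
  ∑' m : ℕ, (-1 : ℂ) ^ m * (z / 2) ^ (2 * m) / ((m.factorial : ℂ) ^ 2)

/-- The Bessel function of the second kind `Y₀`, principal branch:
`Y₀(z) = (2/π) ((log (z/2) + E) J₀(z) + ∑_{m ≥ 1} (-1)^(m+1) h_m (z/2)^(2m) / (m!)²)`,
with `E` Euler's constant and `h_m = 1 + 1/2 + ⋯ + 1/m`. -/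
def besselY0 (z : ℂ) : ℂ :=
  (2 / (Real.pi : ℂ)) *
    ((Complex.log (z / 2) + (Real.eulerMascheroniConstant : ℂ)) * besselJ0 z +
      ∑' m : ℕ, (-1 : ℂ) ^ (m + 1) * ((harmonic m : ℚ) : ℂ) * (z / 2) ^ (2 * m) /
        ((m.factorial : ℂ) ^ 2))

/-- The Hankel function of the first kind `H₀⁽¹⁾ = J₀ + i Y₀`, principal branch. -/
def hankelH0 (z : ℂ) : ℂ := besselJ0 z + Complex.I * besselY0 z

/-! ## Fundamental solutions in the plane -/

/-- Points of the plane. -/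
abbrev Plane := EuclideanSpace ℝ (Fin 2)

/-- Complex vectors: values of elastic fields and densities. -/
abbrev CVec := EuclideanSpace ℂ (Fin 2)

/-- The partial derivative `∂ᵢ f` of a complex valued function on the plane. -/
def pderiv (i : Fin 2) (f : Plane → ℂ) (x : Plane) : ℂ :=
  fderiv ℝ f x (EuclideanSpace.single i (1 : ℝ))

/-- The outgoing fundamental solution of `Δ + k²` in the plane. -/
def helmholtzG (k : ℂ) (x : Plane) : ℂ :=
  -(Complex.I / 4) * hankelH0 (k * ((‖x‖ : ℝ) : ℂ))

/-- The pressure wave number of the operator `𝓛_{lam,mu} + ω²`. -/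
def waveNumberP (lam mu : ℝ) (ω : ℂ) : ℂ := ω / ((Real.sqrt (lam + 2 * mu) : ℝ) : ℂ)

/-- The shear wave number of the operator `𝓛_{lam,mu} + ω²`. -/
def waveNumberS (mu : ℝ) (ω : ℂ) : ℂ := ω / ((Real.sqrt mu : ℝ) : ℂ)

/-- The pressure part `-(1/ω²) ∇∇G^{k_p}` of the fundamental solution of `𝓛_{lam,mu} + ω²`. -/
def lameGammaP (lam mu : ℝ) (ω : ℂ) (x : Plane) : Matrix (Fin 2) (Fin 2) ℂ :=
  fun i j => -(1 / ω ^ 2) * pderiv i (pderiv j (helmholtzG (waveNumberP lam mu ω))) x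

/-- The shear part `(1/ω²) (k_s² I + ∇∇) G^{k_s}` of the fundamental solution of
`𝓛_{lam,mu} + ω²`. -/
def lameGammaS (mu : ℝ) (ω : ℂ) (x : Plane) : Matrix (Fin 2) (Fin 2) ℂ :=
  fun i j => (1 / ω ^ 2) *
    (waveNumberS mu ω ^ 2 * (1 : Matrix (Fin 2) (Fin 2) ℂ) i j * helmholtzG (waveNumberS mu ω) x +
      pderiv i (pderiv j (helmholtzG (waveNumberS mu ω))) x)

/-- The fundamental solution (Kupradze matrix) of the Lamé operator `𝓛_{lam,mu} + ω²`. -/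
def lameGamma (lam mu : ℝ) (ω : ℂ) (x : Plane) : Matrix (Fin 2) (Fin 2) ℂ :=
  lameGammaS mu ω x + lameGammaP lam mu ω x

/-- The conormal derivative (traction) `lam (∇·w) n + 2 mu (∇ˢ w) n` of a vector field `w`
at `x` in the direction `n`. -/
def traction (lam mu : ℝ) (n : Plane) (w : Plane → CVec) (x : Plane) : CVec :=
  WithLp.toLp 2 fun i =>
    (lam : ℂ) * (∑ j, pderiv j (fun z => w z j) x) * ((n i : ℝ) : ℂ) +
      2 * (mu : ℂ) * ∑ j, (1 / 2) *
        (pderiv j (fun z => w z i) x + pderiv i (fun z => w z j) x) * ((n j : ℝ) : ℂ)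

/-! ## Layer potentials on a boundary curve

The curve is given by its arc length measure `σ` and its outward unit normal field `ν`. -/

/-- `v` is the Cauchy principal value at `x` of the integral of `f` over the curve. -/
def HasPV {E : Type*} [NormedAddCommGroup E] [NormedSpace ℝ E]
    (σ : Measure Plane) (x : Plane) (f : Plane → E) (v : E) : Prop :=
  Tendsto (fun ε : ℝ => ∫ y in {y | ε < dist x y}, f y ∂σ) (𝓝[>] 0) (𝓝 v)

/-- The Helmholtz single layer potential `S^k[φ](x)`. -/
def helmholtzS (σ : Measure Plane) (k : ℂ) (φ : Plane → ℂ) (x : Plane) : ℂ :=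
  ∫ y, helmholtzG k (x - y) * φ y ∂σ

/-- The integrand `∇ₓ G^k(x - y) · ν(x) φ(y)` of the Helmholtz Neumann–Poincaré operator. -/
def helmholtzKstarIntegrand (ν : Plane → Plane) (k : ℂ) (φ : Plane → ℂ) (x y : Plane) : ℂ :=
  (∑ i, pderiv i (fun z => helmholtzG k (z - y)) x * ((ν x i : ℝ) : ℂ)) * φ y

/-- The vector `Γ^ω(x - y) φ(y)`. -/
def lameSIntegrand (lam mu : ℝ) (ω : ℂ) (φ : Plane → CVec) (x y : Plane) : CVec :=
  WithLp.toLp 2 fun i => ∑ j, lameGamma lam mu ω (x - y) i j * φ y j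

/-- The elastic single layer potential `𝐒^ω[φ](x)`. -/
def lameS (σ : Measure Plane) (lam mu : ℝ) (ω : ℂ) (φ : Plane → CVec) (x : Plane) : CVec :=
  ∫ y, lameSIntegrand lam mu ω φ x y ∂σ

/-- The integrand `∂Γ^ω/∂ν(x) (x - y) φ(y)` of the elastic Neumann–Poincaré operator. -/
def lameKstarIntegrand (ν : Plane → Plane) (lam mu : ℝ) (ω : ℂ) (φ : Plane → CVec)
    (x y : Plane) : CVec :=
  traction lam mu (ν x) (fun z => lameSIntegrand lam mu ω φ z y) x

/-! ## The boundary operator of the acoustic-elastic system and its resonances -/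

/-- `𝒜(k,δ)[φb, φe] = (f, g)` almost everywhere on the curve, where `𝒜(k,δ)` is the operator matrix
with first row `k⁻² (-1/2 + K^{k,*})`, `-ν · 𝐒^{kτ}` and second row
`δ τ² ν S^k`, `1/2 + 𝐊^{kτ,*}`.
The Neumann–Poincaré operators are principal values, which are required to exist. -/
def IsImage (σ : Measure Plane) (ν : Plane → Plane) (lam mu τ δ : ℝ) (k : ℂ)
    (φb : Plane → ℂ) (φe : Plane → CVec) (f : Plane → ℂ) (g : Plane → CVec) : Prop :=
  ∀ᵐ x ∂σ, ∃ (a : ℂ) (b : CVec),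
    HasPV σ x (helmholtzKstarIntegrand ν k φb x) a ∧
    HasPV σ x (lameKstarIntegrand ν lam mu (k * τ) φe x) b ∧
    f x = (1 / k ^ 2) * (-(1 / 2) * φb x + a) -
      ∑ i, ((ν x i : ℝ) : ℂ) * lameS σ lam mu (k * τ) φe x i ∧
    ∀ i, g x i = (δ : ℂ) * (τ : ℂ) ^ 2 * ((ν x i : ℝ) : ℂ) * helmholtzS σ k φb x +
      ((1 / 2) * φe x i + b i)

/-- `(φb, φe)` is a nonzero element of `L²(∂D) × L²(∂D)²` that `𝒜(k,δ)` maps to zero. -/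
def IsResonantDensity (σ : Measure Plane) (ν : Plane → Plane) (lam mu τ δ : ℝ) (k : ℂ)
    (φb : Plane → ℂ) (φe : Plane → CVec) : Prop :=
  MemLp φb 2 σ ∧ MemLp φe 2 σ ∧ ¬ (φb =ᵐ[σ] 0 ∧ φe =ᵐ[σ] 0) ∧
    IsImage σ ν lam mu τ δ k φb φe 0 0

/-- Strong resonance at the frequency `k`: `𝒜(k,δ)` has a nontrivial kernel. -/
def StrongResonanceAt (σ : Measure Plane) (ν : Plane → Plane) (lam mu τ δ : ℝ) (k : ℂ) : Prop :=
  ∃ (φb : Plane → ℂ) (φe : Plane → CVec), IsResonantDensity σ ν lam mu τ δ k φb φe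

/-! ## The unit disk -/

/-- Arc length on the unit circle: the image of Lebesgue measure on `(-π, π]` under the unit speed
parametrization by the angle. -/
def circleMeasure : Measure Plane :=
  Measure.map (fun θ : ℝ => (!₂[Real.cos θ, Real.sin θ] : Plane))
    (volume.restrict (Set.Ioc (-Real.pi) Real.pi))

/-- The outward unit normal of the unit disk at a point of the unit circle. -/
def circleNormal (x : Plane) : Plane := x

/-- The elastic density `b ν` on the unit circle. -/
def normalDensity (b : ℂ) (x : Plane) : CVec :=
  WithLp.toLp 2 fun i => b * ((circleNormal x i : ℝ) : ℂ)

/-- `k` is a resonant frequency of the unit disk with a density of the form `(b₁, b₂ ν)`. -/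
def RadialResonanceAt (lam mu τ δ : ℝ) (k : ℂ) : Prop :=
  ∃ b₁ b₂ : ℂ, IsResonantDensity circleMeasure circleNormal lam mu τ δ k
    (fun _ => b₁) (normalDensity b₂)

/-- The constant `γ = 2E - iπ - 2 ln 2`, with `E` Euler's constant. -/
def gammaConst : ℂ :=
  2 * (Real.eulerMascheroniConstant : ℂ) - Complex.I * (Real.pi : ℂ) - 2 * ((Real.log 2 : ℝ) : ℂ)

/-- The leading-order equation for the resonant frequencies. -/
def LeadingOrderEq (lam mu τ δ : ℝ) (k : ℂ) : Prop :=
  (gammaConst + 2 * Complex.log k) *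
    (((mu + δ * τ ^ 2 : ℝ) : ℂ) / (4 * ((lam + 2 * mu : ℝ) : ℂ)) +
      k ^ 2 * (τ : ℂ) ^ 2 * (lam : ℂ) *
        (gammaConst + 2 * Complex.log (k * (τ : ℂ) / ((Real.sqrt (lam + 2 * mu) : ℝ) : ℂ))) /
          (16 * ((lam + 2 * mu : ℝ) : ℂ) ^ 2)) = 0

end

end Minnaert

open MeasureTheory Filter Topology

namespace Minnaert

noncomputable section


/-! ## Entire functions given by factorially bounded coefficients -/

/-! A normal density `b ν` on the circle radiates a radial, hence curl-free, elastic field, so shear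
waves do not contribute. At the level of kernels, with `s = |x - y|²`, everything except the
pressure terms in the normal component is an exact derivative `d/dθ (T(s) sin θ)` with at most a
logarithmic singularity in `T`. It integrates to zero over the circle (`single_normal_component`,
`traction_normal_component`, `LogSmooth.integral_arcDeriv`), and the tangential component is odd in
the angle. Thus the operator maps `(b₁, b₂ ν)` to a density of the same form through a two by two
matrix of scalar circle integrals, and radial resonance means that a determinant vanishes
(`radialResonanceAt_iff_det`).

All entries are of the form `(γ + 2 log k) · entire + entire` in `k²`, and their lowest coefficients
are explicit moments of `s` and `log s`. In the pressure wave number `z = k / c`, `c = √(λ + 2μ) /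
τ`, the determinant is a factor without small zeros times an equation `z² (γ + 2 log z) (1 + E) =
-σ`, with `σ = 4 (μ + δτ²) / (λ + 2μ)` (`exists_normal_form`). The error satisfies `E · (γ + 2 log
z) → 0`, uniformly in `c` and in the share `t` of `μ` in `μ + δτ²`. Equation `(*)` has the same form
with `E = 0` and `σ₀ = 4 (μ + δτ²) / λ`, up to its first factor, which has no small roots either.
The ratio `σ / σ₀` tends to `1` with `μ`.

It remains to match roots of two such equations. A small root has `|z|² ≤ σ` (`norm_sq_le_of_root`),
so it tends to zero with the contrasts, and a phase argument puts it in the right half plane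
(`re_pos_of_root`), away from the branch cut. Rescaling by a root `z₁` as `z = z₁ t` turns the other
equation into a small perturbation of `t² = 1`, because the logarithm varies slowly; the maximum
principle gives a root near `t = 1` (`exists_root_near`). The same step in both directions gives the
two correspondences. Started from an approximate root on the positive axis
(`exists_real_approx_root`), it gives existence. -/

/-- Coefficients bounded by `K R ^ m / m!`. -/
def FactorialBound (c : ℕ → ℂ) : Prop :=
  ∃ K R : ℝ, 0 ≤ R ∧ ∀ m, ‖c m‖ ≤ K * (R ^ m / m.factorial)

/-- The power series with coefficients `c`. -/
def entireSum (c : ℕ → ℂ) (u : ℂ) : ℂ := ∑' m : ℕ, c m * u ^ m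

/-- The coefficients of the derivative. -/
def derivCoeff (c : ℕ → ℂ) (m : ℕ) : ℂ := (m + 1) * c (m + 1)

theorem FactorialBound.summable_norm {c : ℕ → ℂ} (hc : FactorialBound c) (ρ : ℝ) :
    Summable fun m => ‖c m‖ * |ρ| ^ m := by
  obtain ⟨K, R, hR, h⟩ := hc
  refine Summable.of_nonneg_of_le (fun m => by positivity) (fun m => ?_)
    ((Real.summable_pow_div_factorial (R * |ρ|)).mul_left K)
  calc ‖c m‖ * |ρ| ^ m ≤ K * (R ^ m / m.factorial) * |ρ| ^ m := by gcongr; exact h m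
    _ = K * ((R * |ρ|) ^ m / m.factorial) := by rw [mul_pow]; ring

theorem FactorialBound.summable {c : ℕ → ℂ} (hc : FactorialBound c) (u : ℂ) :
    Summable fun m => c m * u ^ m := by
  refine Summable.of_norm ?_
  simpa [norm_mul, norm_pow] using hc.summable_norm ‖u‖

theorem FactorialBound.nonneg_const {c : ℕ → ℂ} (hc : FactorialBound c) :
    ∃ K R : ℝ, 0 ≤ K ∧ 0 ≤ R ∧ ∀ m, ‖c m‖ ≤ K * (R ^ m / m.factorial) := by
  obtain ⟨K, R, hR, h⟩ := hc
  exact ⟨K, R, by simpa using (norm_nonneg _).trans (h 0), hR, h⟩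

theorem FactorialBound.derivCoeff {c : ℕ → ℂ} (hc : FactorialBound c) :
    FactorialBound (derivCoeff c) := by
  obtain ⟨K, R, hR, h⟩ := hc
  refine ⟨K * R, R, hR, fun m => ?_⟩
  have h1 := h (m + 1)
  have hn : ‖((m : ℂ) + 1)‖ = (m : ℝ) + 1 := by
    exact_mod_cast Complex.norm_natCast (m + 1)
  rw [Minnaert.derivCoeff, norm_mul, hn]
  calc ((m : ℝ) + 1) * ‖c (m + 1)‖ ≤ ((m : ℝ) + 1) * (K * (R ^ (m + 1) / (m + 1).factorial)) := by
        gcongr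
    _ = K * R * (R ^ m / m.factorial) := by
        rw [Nat.factorial_succ]; push_cast; field_simp; ring

theorem FactorialBound.shift {c : ℕ → ℂ} (hc : FactorialBound c) :
    FactorialBound fun m => c (m + 1) := by
  obtain ⟨K, R, hR, h⟩ := hc.derivCoeff
  refine ⟨K, R, hR, fun m => le_trans ?_ (h m)⟩
  have hn : ‖((m : ℂ) + 1)‖ = (m : ℝ) + 1 := by
    exact_mod_cast Complex.norm_natCast (m + 1)
  rw [Minnaert.derivCoeff, norm_mul, hn]
  nlinarith [norm_nonneg (c (m + 1)), (Nat.cast_nonneg m : (0 : ℝ) ≤ m)]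

theorem FactorialBound.mul_geom {c d : ℕ → ℂ} (hc : FactorialBound c) (C B : ℝ)
    (_ : 0 ≤ C) (hB : 0 ≤ B) (hd : ∀ m, ‖d m‖ ≤ C * B ^ m) : FactorialBound fun m => c m * d m := by
  obtain ⟨K, R, hK, hR, h⟩ := hc.nonneg_const
  refine ⟨K * C, R * B, by positivity, fun m => ?_⟩
  rw [norm_mul]
  calc ‖c m‖ * ‖d m‖ ≤ (K * (R ^ m / m.factorial)) * (C * B ^ m) := by
        gcongr
        · exact h m
        · exact hd m
    _ = _ := by rw [mul_pow]; ring

theorem FactorialBound.add {c d : ℕ → ℂ} (hc : FactorialBound c) (hd : FactorialBound d) :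
    FactorialBound fun m => c m + d m := by
  obtain ⟨K, R, hK, hR, h⟩ := hc.nonneg_const
  obtain ⟨K', R', hK', hR', h'⟩ := hd.nonneg_const
  refine ⟨K + K', max R R', le_max_of_le_left hR, fun m => (norm_add_le _ _).trans ?_⟩
  rw [add_mul]
  gcongr
  · refine (h m).trans ?_
    gcongr
    exact le_max_left _ _
  · refine (h' m).trans ?_
    gcongr
    exact le_max_right _ _

theorem FactorialBound.const_mul {c : ℕ → ℂ} (hc : FactorialBound c) (a : ℂ) :
    FactorialBound fun m => a * c m := by
  have := hc.mul_geom (d := fun _ => a) ‖a‖ 1 (norm_nonneg _) zero_le_one (by simp)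
  simpa [mul_comm] using this

theorem entireSum_add {c d : ℕ → ℂ} (hc : FactorialBound c) (hd : FactorialBound d) (u : ℂ) :
    entireSum (fun m => c m + d m) u = entireSum c u + entireSum d u := by
  simp only [entireSum, add_mul]
  exact (hc.summable u).tsum_add (hd.summable u)

theorem entireSum_const_mul (c : ℕ → ℂ) (a u : ℂ) :
    entireSum (fun m => a * c m) u = a * entireSum c u := by
  simp only [entireSum, mul_assoc]
  exact tsum_mul_left

theorem entireSum_eq_add_mul {c : ℕ → ℂ} (hc : FactorialBound c) (u : ℂ) :
    entireSum c u = c 0 + u * entireSum (fun m => c (m + 1)) u := by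
  rw [entireSum, (hc.summable u).tsum_eq_zero_add, entireSum, ← tsum_mul_left]
  simp only [pow_zero, mul_one, pow_succ]
  congr 1
  exact tsum_congr fun m => by ring

theorem hasDerivAt_entireSum {c : ℕ → ℂ} (hc : FactorialBound c) (u : ℂ) :
    HasDerivAt (entireSum c) (entireSum (derivCoeff c) u) u := by
  set ρ : ℝ := ‖u‖ + 1 with hρ
  have hρ0 : 0 < ρ := by positivity
  have hs : Summable fun m : ℕ => ‖c m‖ * (m * ρ ^ (m - 1)) := by
    rw [← summable_nat_add_iff 1]
    have := hc.derivCoeff.summable_norm ρ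
    refine this.congr fun m => ?_
    have hn : ‖((m : ℂ) + 1)‖ = (m : ℝ) + 1 := by
      exact_mod_cast Complex.norm_natCast (m + 1)
    rw [derivCoeff, norm_mul, hn, abs_of_pos hρ0]
    push_cast
    ring
  have key := hasDerivAt_tsum_of_isPreconnected (g := fun m z => c m * z ^ m)
    (g' := fun m z => c m * (m * z ^ (m - 1))) (t := Metric.ball 0 ρ) (y₀ := 0) (y := u) hs
    Metric.isOpen_ball (convex_ball _ _).isPreconnected
    (fun m z _ => (hasDerivAt_pow m z).const_mul (c m))
    (fun m z hz => by
      rw [norm_mul, norm_mul, norm_pow, Complex.norm_natCast]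
      have : ‖z‖ ≤ ρ := by simpa using (mem_ball_zero_iff.1 hz).le
      gcongr)
    (Metric.mem_ball_self hρ0) (hc.summable 0) (by simp [hρ])
  have hsum : Summable fun m : ℕ => c m * (m * u ^ (m - 1)) := by
    refine Summable.of_norm_bounded hs fun m => ?_
    rw [norm_mul, norm_mul, norm_pow, Complex.norm_natCast]
    have : ‖u‖ ≤ ρ := by simp [hρ]
    gcongr
  rw [hsum.tsum_eq_zero_add] at key
  simp only [Nat.cast_zero, zero_mul, mul_zero, zero_add, Nat.add_sub_cancel] at key
  have heq : entireSum (derivCoeff c) u = ∑' m : ℕ, c (m + 1) * (((m + 1 : ℕ) : ℂ) * u ^ m) :=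
    tsum_congr fun m => by rw [derivCoeff]; push_cast; ring
  rw [heq]
  exact key

theorem differentiable_entireSum {c : ℕ → ℂ} (hc : FactorialBound c) :
    Differentiable ℂ (entireSum c) := fun u => (hasDerivAt_entireSum hc u).differentiableAt

theorem continuous_entireSum {c : ℕ → ℂ} (hc : FactorialBound c) : Continuous (entireSum c) :=
  (differentiable_entireSum hc).continuous

/-- Integration of an entire series of `u s(θ)` against an integrable weight. -/
theorem integral_weight_mul_entireSum {c : ℕ → ℂ} (hc : FactorialBound c)
    {Ω : Type*} [MeasurableSpace Ω] {m : Measure Ω} {w : Ω → ℂ} (hw : Integrable w m)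
    {s : Ω → ℝ} (hs : Measurable s) {B : ℝ} (hB : ∀ t, |s t| ≤ B) (u : ℂ) :
    Integrable (fun t => w t * entireSum c (u * s t)) m ∧
    ∫ t, w t * entireSum c (u * s t) ∂m =
      entireSum (fun n => c n * ∫ t, w t * (s t : ℂ) ^ n ∂m) u := by
  have hsC : Measurable fun t => (s t : ℂ) := Complex.measurable_ofReal.comp hs
  have hint : ∀ n, Integrable (fun t => w t * (s t : ℂ) ^ n) m := fun n => by
    refine hw.mul_bdd (c := B ^ n) (hsC.pow_const n).aestronglyMeasurable (ae_of_all _ fun t => ?_)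
    simp only [norm_pow, Complex.norm_real, Real.norm_eq_abs]
    exact pow_le_pow_left₀ (abs_nonneg _) (hB t) n
  have hterm : ∀ n, ∀ t, w t * (c n * (u * s t) ^ n) = c n * u ^ n * (w t * (s t : ℂ) ^ n) :=
    fun n t => by rw [mul_pow]; ring
  have hB' : ∀ t, ‖u * s t‖ ≤ ‖u‖ * B := fun t => by
    rw [norm_mul, Complex.norm_real]
    exact mul_le_mul_of_nonneg_left (hB t) (norm_nonneg _)
  constructor
  · obtain ⟨C, hC⟩ := (isCompact_closedBall (0 : ℂ) (‖u‖ * B)).exists_bound_of_continuousOn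
      (continuous_entireSum hc).continuousOn
    refine hw.mul_bdd (c := C)
      ((continuous_entireSum hc).measurable.comp (hsC.const_mul u)).aestronglyMeasurable
      (ae_of_all _ fun t => hC _ ?_)
    simpa using hB' t
  · have h := hasSum_integral_of_summable_integral_norm
      (F := fun n t => w t * (c n * (u * s t) ^ n)) (μ := m)
      (fun n => by
        simp only [hterm]
        exact (hint n).const_mul _) ?_
    · have e1 : ∀ t, w t * entireSum c (u * s t) = ∑' n, w t * (c n * (u * s t) ^ n) := fun t => by
        rw [entireSum, tsum_mul_left]
      simp only [e1]
      rw [← h.tsum_eq, entireSum]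
      refine tsum_congr fun n => ?_
      simp only [hterm]
      rw [integral_const_mul]
      ring
    · refine Summable.of_nonneg_of_le (fun n => integral_nonneg fun t => norm_nonneg _) (fun n => ?_)
        ((hc.summable_norm (‖u‖ * B)).mul_right (∫ t, ‖w t‖ ∂m))
      rw [← integral_const_mul]
      refine integral_mono_of_nonneg (ae_of_all _ fun t => norm_nonneg _) (hw.norm.const_mul _)
        (ae_of_all _ fun t => ?_)
      simp only [norm_mul, norm_pow]
      have h2 : (‖u‖ * ‖(s t : ℂ)‖) ^ n ≤ |‖u‖ * B| ^ n := by
        have := hB' t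
        rw [norm_mul] at this
        exact pow_le_pow_left₀ (by positivity) (this.trans (le_abs_self _)) n
      calc ‖w t‖ * (‖c n‖ * (‖u‖ * ‖(s t : ℂ)‖) ^ n) ≤ ‖w t‖ * (‖c n‖ * |‖u‖ * B| ^ n) := by gcongr
        _ = _ := by ring

theorem norm_moment_le {Ω : Type*} [MeasurableSpace Ω] {m : Measure Ω} {w : Ω → ℂ}
    (hw : Integrable w m) {s : Ω → ℝ} {B : ℝ} (hB : ∀ t, |s t| ≤ B) (n : ℕ) :
    ‖∫ t, w t * (s t : ℂ) ^ n ∂m‖ ≤ (∫ t, ‖w t‖ ∂m) * B ^ n := by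
  refine (norm_integral_le_integral_norm _).trans ?_
  rw [← integral_mul_const]
  refine integral_mono_of_nonneg (ae_of_all _ fun t => norm_nonneg _) (hw.norm.mul_const _)
    (ae_of_all _ fun t => ?_)
  simp only [norm_mul, norm_pow, Complex.norm_real, Real.norm_eq_abs]
  gcongr
  exact hB t

theorem FactorialBound.mul_moment {c : ℕ → ℂ} (hc : FactorialBound c) {Ω : Type*}
    [MeasurableSpace Ω] {m : Measure Ω} {w : Ω → ℂ} (hw : Integrable w m) {s : Ω → ℝ} {B : ℝ}
    (hB0 : 0 ≤ B) (hB : ∀ t, |s t| ≤ B) :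
    FactorialBound fun n => c n * ∫ t, w t * (s t : ℂ) ^ n ∂m :=
  hc.mul_geom (∫ t, ‖w t‖ ∂m) B (integral_nonneg fun _ => norm_nonneg _) hB0
    fun n => norm_moment_le hw hB n


/-! ## Euler operator on coefficients -/

theorem FactorialBound.natCast_mul {c : ℕ → ℂ} (hc : FactorialBound c) :
    FactorialBound fun m => (m : ℂ) * c m := by
  have := hc.mul_geom (d := fun m => (m : ℂ)) 1 2 zero_le_one zero_le_two fun m => by
    rw [Complex.norm_natCast, one_mul]
    exact_mod_cast (Nat.lt_two_pow_self (n := m)).le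
  simpa [mul_comm] using this

/-- The Euler operator `u d/du` is diagonal on coefficients. For this reason `s F'(s)`, not `F'(s)`,
is the quantity expanded later. -/
theorem mul_entireSum_derivCoeff {c : ℕ → ℂ} (hc : FactorialBound c) (u : ℂ) :
    u * entireSum (derivCoeff c) u = entireSum (fun m => (m : ℂ) * c m) u := by
  rw [entireSum_eq_add_mul hc.natCast_mul]
  have e : (fun m : ℕ => ((m + 1 : ℕ) : ℂ) * c (m + 1)) = derivCoeff c :=
    funext fun m => by rw [derivCoeff]; push_cast; ring
  rw [e, Nat.cast_zero, zero_mul, zero_add]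

theorem FactorialBound.iterate {c : ℕ → ℂ} (hc : FactorialBound c) (n : ℕ) :
    FactorialBound (Minnaert.derivCoeff^[n] c) := by
  induction n with
  | zero => exact hc
  | succ n ih => rw [Function.iterate_succ_apply']; exact ih.derivCoeff

/-- The `n`-th derivative of `s ↦ entireSum c (κ s)`. -/
def scaledSum (c : ℕ → ℂ) (κ : ℂ) (n : ℕ) (s : ℝ) : ℂ :=
  κ ^ n * entireSum (derivCoeff^[n] c) (κ * s)

theorem hasDerivAt_scaledSum {c : ℕ → ℂ} (hc : FactorialBound c) (κ : ℂ) (n : ℕ) (s : ℝ) :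
    HasDerivAt (scaledSum c κ n) (scaledSum c κ (n + 1) s) s := by
  have h1 : HasDerivAt (fun z : ℂ => κ * z) κ (s : ℂ) := by
    simpa using (hasDerivAt_id (s : ℂ)).const_mul κ
  have h2 := ((hasDerivAt_entireSum (hc.iterate n) (κ * s)).comp (s : ℂ) h1).const_mul (κ ^ n)
  have h3 := h2.comp_ofReal
  rw [scaledSum, Function.iterate_succ_apply', pow_succ, mul_assoc, mul_comm κ]
  exact h3

theorem continuous_scaledSum {c : ℕ → ℂ} (hc : FactorialBound c) (κ : ℂ) (n : ℕ) :
    Continuous (scaledSum c κ n) :=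
  continuous_iff_continuousAt.2 fun s => (hasDerivAt_scaledSum hc κ n s).continuousAt

/-! ## The Bessel series in the squared variable -/

/-- Coefficients of `J₀(√u)`. -/
def coeffJ (m : ℕ) : ℂ := (-1 / 4) ^ m / (m.factorial : ℂ) ^ 2

/-- Coefficients of the regular part of `(π/2) Y₀(√u)`. -/
def coeffY (m : ℕ) : ℂ := -((harmonic m : ℚ) : ℂ) * coeffJ m

theorem coeffJ_succ (m : ℕ) : 4 * ((m : ℂ) + 1) ^ 2 * coeffJ (m + 1) = -coeffJ m := by
  have h1 : (m.factorial : ℂ) ≠ 0 := by exact_mod_cast m.factorial_ne_zero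
  have h2 : (m : ℂ) + 1 ≠ 0 := by exact_mod_cast m.succ_ne_zero
  rw [coeffJ, coeffJ, Nat.factorial_succ, pow_succ]
  push_cast
  field_simp
  ring

/-- The increment `1 / (m + 1)` of the harmonic number produces the right-hand side. It is the
source term that compensates the derivative of the logarithm in `radialG_ode`. -/
theorem coeffY_succ (m : ℕ) :
    4 * ((m : ℂ) + 1) ^ 2 * coeffY (m + 1) + coeffY m = -(4 * ((m : ℂ) + 1)) * coeffJ (m + 1) := by
  have h2 : (m : ℂ) + 1 ≠ 0 := by exact_mod_cast m.succ_ne_zero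
  have hh : ((harmonic (m + 1) : ℚ) : ℂ) = ((harmonic m : ℚ) : ℂ) + ((m : ℂ) + 1)⁻¹ := by
    rw [harmonic_succ]; push_cast; ring
  have h3 := coeffJ_succ m
  have h4 : ((m : ℂ) + 1) ^ 2 * ((m : ℂ) + 1)⁻¹ = (m : ℂ) + 1 := by field_simp
  rw [coeffY, coeffY, hh]
  linear_combination (-((harmonic m : ℚ) : ℂ)) * h3 - 4 * coeffJ (m + 1) * h4

theorem factorialBound_coeffJ : FactorialBound coeffJ := by
  refine ⟨1, 1, zero_le_one, fun m => ?_⟩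
  have h0 : (1 : ℝ) ≤ m.factorial := by exact_mod_cast m.factorial_pos
  rw [coeffJ, norm_div, norm_pow, norm_pow, Complex.norm_natCast, one_pow, one_mul]
  have h1 : ‖(-1 / 4 : ℂ)‖ ^ m ≤ 1 := by
    apply pow_le_one₀ (norm_nonneg _)
    rw [norm_div, norm_neg]; norm_num
  gcongr
  nlinarith

theorem harmonic_le_two_pow (m : ℕ) : (harmonic m : ℚ) ≤ 2 ^ m := by
  induction m with
  | zero => simp
  | succ n ih =>
    have h1 : ((n : ℚ) + 1)⁻¹ ≤ 1 := by
      apply inv_le_one_of_one_le₀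
      have : (0 : ℚ) ≤ n := Nat.cast_nonneg n
      linarith
    have h2 : (1 : ℚ) ≤ 2 ^ n := one_le_pow₀ (by norm_num)
    rw [harmonic_succ, pow_succ]
    push_cast
    linarith

theorem factorialBound_coeffY : FactorialBound coeffY := by
  have := factorialBound_coeffJ.mul_geom (d := fun m => -((harmonic m : ℚ) : ℂ)) 1 2 zero_le_one
    zero_le_two fun m => by
      have h0 : (0 : ℚ) ≤ harmonic m := Finset.sum_nonneg fun i _ => by positivity
      have h1 : ((harmonic m : ℚ) : ℂ) = (((harmonic m : ℚ) : ℝ) : ℂ) := by push_cast; rfl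
      rw [norm_neg, h1, Complex.norm_real, Real.norm_of_nonneg (by exact_mod_cast h0), one_mul]
      exact_mod_cast harmonic_le_two_pow m
  refine (funext fun m => ?_ : coeffY = _) ▸ this
  rw [coeffY, mul_comm]

/-- Bessel's equation of order zero after the substitution `u = z²`. -/
theorem coeffJ_ode (u : ℂ) :
    u * entireSum (derivCoeff^[2] coeffJ) u + entireSum (derivCoeff^[1] coeffJ) u +
      entireSum coeffJ u / 4 = 0 := by
  have hJ := factorialBound_coeffJ
  have h := mul_entireSum_derivCoeff hJ.derivCoeff u
  have e : (fun m : ℕ => (m : ℂ) * derivCoeff coeffJ m) =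
      fun m => (-1 : ℂ) * (derivCoeff coeffJ m + (1 / 4) * coeffJ m) := funext fun m => by
    rw [derivCoeff]
    linear_combination (1 / 4) * coeffJ_succ m
  rw [e, entireSum_const_mul, entireSum_add hJ.derivCoeff (hJ.const_mul _), entireSum_const_mul] at h
  simp only [Function.iterate_succ, Function.iterate_zero, Function.comp, id]
  rw [h]; ring

theorem coeffY_ode (u : ℂ) :
    u * entireSum (derivCoeff^[2] coeffY) u + entireSum (derivCoeff^[1] coeffY) u +
      entireSum coeffY u / 4 = -entireSum (derivCoeff^[1] coeffJ) u := by
  have hJ := factorialBound_coeffJ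
  have hY := factorialBound_coeffY
  have h := mul_entireSum_derivCoeff hY.derivCoeff u
  have e : (fun m : ℕ => (m : ℂ) * derivCoeff coeffY m) =
      fun m => (-1 : ℂ) * ((derivCoeff coeffY m + (1 / 4) * coeffY m) + derivCoeff coeffJ m) :=
    funext fun m => by
      rw [derivCoeff, derivCoeff]
      linear_combination (1 / 4) * coeffY_succ m
  rw [e, entireSum_const_mul,
    entireSum_add (hY.derivCoeff.add (hY.const_mul _)) hJ.derivCoeff,
    entireSum_add hY.derivCoeff (hY.const_mul _), entireSum_const_mul] at h
  simp only [Function.iterate_succ, Function.iterate_zero, Function.comp, id]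
  rw [h]; ring

/-! ## The radial profile of the fundamental solution -/

/-- `γ + 2 log k`. -/
def logTerm (k : ℂ) : ℂ := gammaConst + 2 * Complex.log k

/-- The function `F` with `G^k(x) = F(|x|²)`. -/
def radialG (k : ℂ) (s : ℝ) : ℂ :=
  1 / (4 * (Real.pi : ℂ)) * ((logTerm k + (Real.log s : ℝ)) * scaledSum coeffJ (k ^ 2) 0 s +
    2 * scaledSum coeffY (k ^ 2) 0 s)

/-- The first derivative of `radialG`. -/
def radialG₁ (k : ℂ) (s : ℝ) : ℂ :=
  1 / (4 * (Real.pi : ℂ)) * ((logTerm k + (Real.log s : ℝ)) * scaledSum coeffJ (k ^ 2) 1 s +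
    scaledSum coeffJ (k ^ 2) 0 s / s + 2 * scaledSum coeffY (k ^ 2) 1 s)

/-- The second derivative of `radialG`. -/
def radialG₂ (k : ℂ) (s : ℝ) : ℂ :=
  1 / (4 * (Real.pi : ℂ)) * ((logTerm k + (Real.log s : ℝ)) * scaledSum coeffJ (k ^ 2) 2 s +
    2 * scaledSum coeffJ (k ^ 2) 1 s / s - scaledSum coeffJ (k ^ 2) 0 s / s ^ 2 +
    2 * scaledSum coeffY (k ^ 2) 2 s)

/-- The third derivative of `radialG`. -/
def radialG₃ (k : ℂ) (s : ℝ) : ℂ :=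
  1 / (4 * (Real.pi : ℂ)) * ((logTerm k + (Real.log s : ℝ)) * scaledSum coeffJ (k ^ 2) 3 s +
    3 * scaledSum coeffJ (k ^ 2) 2 s / s - 3 * scaledSum coeffJ (k ^ 2) 1 s / s ^ 2 +
    2 * scaledSum coeffJ (k ^ 2) 0 s / s ^ 3 + 2 * scaledSum coeffY (k ^ 2) 3 s)

theorem hasDerivAt_ofReal_log {s : ℝ} (hs : s ≠ 0) :
    HasDerivAt (fun t : ℝ => ((Real.log t : ℝ) : ℂ)) (1 / (s : ℂ)) s := by
  have := (Real.hasDerivAt_log hs).ofReal_comp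
  simpa using this

theorem hasDerivAt_ofReal_pow_inv {s : ℝ} (hs : s ≠ 0) (n : ℕ) :
    HasDerivAt (fun t : ℝ => 1 / (t : ℂ) ^ n) (-n / (s : ℂ) ^ (n + 1)) s := by
  have hs' : (s : ℂ) ≠ 0 := by exact_mod_cast hs
  have h := ((hasDerivAt_pow n (s : ℂ)).inv (pow_ne_zero n hs')).comp_ofReal
  simp only [Pi.inv_apply] at h
  convert h using 1
  · ext t; simp
  · rcases n with _ | n
    · simp
    · simp only [Nat.add_sub_cancel]
      field_simp
      ring

theorem hasDerivAt_radialG (k : ℂ) {s : ℝ} (hs : s ≠ 0) :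
    HasDerivAt (radialG k) (radialG₁ k s) s := by
  have hJ := hasDerivAt_scaledSum factorialBound_coeffJ (k ^ 2)
  have hY := hasDerivAt_scaledSum factorialBound_coeffY (k ^ 2)
  have hl := (hasDerivAt_ofReal_log hs).const_add (logTerm k)
  have h := ((hl.mul (hJ 0 s)).add ((hY 0 s).const_mul 2)).const_mul (1 / (4 * (Real.pi : ℂ)))
  refine h.congr_deriv ?_
  rw [radialG₁]; ring

theorem hasDerivAt_radialG₁ (k : ℂ) {s : ℝ} (hs : s ≠ 0) :
    HasDerivAt (radialG₁ k) (radialG₂ k s) s := by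
  have hJ := hasDerivAt_scaledSum factorialBound_coeffJ (k ^ 2)
  have hY := hasDerivAt_scaledSum factorialBound_coeffY (k ^ 2)
  have hl := (hasDerivAt_ofReal_log hs).const_add (logTerm k)
  have h := (((hl.mul (hJ 1 s)).add ((hJ 0 s).mul (hasDerivAt_ofReal_pow_inv hs 1))).add
    ((hY 1 s).const_mul 2)).const_mul (1 / (4 * (Real.pi : ℂ)))
  refine (h.congr_deriv ?_).congr_of_eventuallyEq (Eventually.of_forall fun t => ?_)
  · rw [radialG₂]; push_cast; ring
  · simp only [radialG₁, Pi.add_apply, Pi.mul_apply, pow_one]; ring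

theorem hasDerivAt_radialG₂ (k : ℂ) {s : ℝ} (hs : s ≠ 0) :
    HasDerivAt (radialG₂ k) (radialG₃ k s) s := by
  have hJ := hasDerivAt_scaledSum factorialBound_coeffJ (k ^ 2)
  have hY := hasDerivAt_scaledSum factorialBound_coeffY (k ^ 2)
  have hl := (hasDerivAt_ofReal_log hs).const_add (logTerm k)
  have h := ((((hl.mul (hJ 2 s)).add
    (((hJ 1 s).mul (hasDerivAt_ofReal_pow_inv hs 1)).const_mul 2)).sub
    ((hJ 0 s).mul (hasDerivAt_ofReal_pow_inv hs 2))).add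
    ((hY 2 s).const_mul 2)).const_mul (1 / (4 * (Real.pi : ℂ)))
  refine (h.congr_deriv ?_).congr_of_eventuallyEq (Eventually.of_forall fun t => ?_)
  · rw [radialG₃]; push_cast; ring
  · simp only [radialG₂, Pi.add_apply, Pi.mul_apply, Pi.sub_apply, pow_one]; ring

/-- The Helmholtz equation in the squared radius. -/
theorem radialG_ode (k : ℂ) {s : ℝ} (hs : s ≠ 0) :
    4 * s * radialG₂ k s + 4 * radialG₁ k s + k ^ 2 * radialG k s = 0 := by
  have hs' : (s : ℂ) ≠ 0 := by exact_mod_cast hs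
  have hJ := coeffJ_ode (k ^ 2 * s)
  have hY := coeffY_ode (k ^ 2 * s)
  simp only [radialG, radialG₁, radialG₂, scaledSum, Function.iterate_zero, id]
  set J0 := entireSum coeffJ (k ^ 2 * s)
  set J1 := entireSum (derivCoeff^[1] coeffJ) (k ^ 2 * s)
  set J2 := entireSum (derivCoeff^[2] coeffJ) (k ^ 2 * s)
  set Y0 := entireSum coeffY (k ^ 2 * s)
  set Y1 := entireSum (derivCoeff^[1] coeffY) (k ^ 2 * s)
  set Y2 := entireSum (derivCoeff^[2] coeffY) (k ^ 2 * s)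
  have hp : (Real.pi : ℂ) ≠ 0 := by exact_mod_cast Real.pi_ne_zero
  field_simp
  -- Differentiating the logarithm leaves `8 k² J1`, since the terms in `J0 / s` cancel; this is
  -- offset by the source term of `coeffY_ode`.
  linear_combination (4 * k ^ 2 * (s : ℂ) * (logTerm k + (Real.log s : ℝ))) * hJ +
    8 * k ^ 2 * (s : ℂ) * hY

/-- Obtained by differentiating the identically vanishing left side of `radialG_ode`. The traction
involves third derivatives of the profile, and this relation eliminates them. -/
theorem radialG_ode_deriv (k : ℂ) {s : ℝ} (hs : s ≠ 0) :
    4 * s * radialG₃ k s + 8 * radialG₂ k s + k ^ 2 * radialG₁ k s = 0 := by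
  have hid : HasDerivAt (fun t : ℝ => (t : ℂ)) 1 s := by
    simpa using (hasDerivAt_id s).ofReal_comp
  have h := (((hid.const_mul 4).mul (hasDerivAt_radialG₂ k hs)).add
    ((hasDerivAt_radialG₁ k hs).const_mul 4)).add ((hasDerivAt_radialG k hs).const_mul (k ^ 2))
  have h0 : HasDerivAt (fun _ : ℝ => (0 : ℂ)) 0 s := hasDerivAt_const s 0
  have h1 := h.congr_of_eventuallyEq (f₁ := fun _ => (0 : ℂ)) (by
    filter_upwards [eventually_ne_nhds hs] with t ht
    exact (radialG_ode k ht).symm)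
  have := h1.unique h0
  linear_combination this

theorem besselJ0_eq (z : ℂ) : besselJ0 z = entireSum coeffJ (z ^ 2) := by
  refine tsum_congr fun m => ?_
  have : (z / 2) ^ (2 * m) = (1 / 4) ^ m * (z ^ 2) ^ m := by
    rw [pow_mul, ← mul_pow]; congr 1; ring
  have h2 : ((-1 / 4 : ℂ)) ^ m = (-1) ^ m * (1 / 4) ^ m := by rw [← mul_pow]; congr 1; ring
  rw [this, coeffJ, h2]; ring

theorem besselY0_series_eq (z : ℂ) :
    ∑' m : ℕ, (-1 : ℂ) ^ (m + 1) * ((harmonic m : ℚ) : ℂ) * (z / 2) ^ (2 * m) /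
        ((m.factorial : ℂ) ^ 2) = entireSum coeffY (z ^ 2) := by
  refine tsum_congr fun m => ?_
  have : (z / 2) ^ (2 * m) = (1 / 4) ^ m * (z ^ 2) ^ m := by
    rw [pow_mul, ← mul_pow]; congr 1; ring
  have h2 : ((-1 / 4 : ℂ)) ^ m = (-1) ^ m * (1 / 4) ^ m := by rw [← mul_pow]; congr 1; ring
  rw [this, coeffY, coeffJ, h2, pow_succ]; ring

theorem log_mul_ofReal {k : ℂ} (hk : k ≠ 0) {r : ℝ} (hr : 0 < r) :
    Complex.log (k * r) = Complex.log k + (Real.log r : ℝ) := by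
  rw [mul_comm, Complex.log_ofReal_mul hr hk, add_comm]

/-- With `s = |x|²` one has `2 log |x| = log s`, and the term `-(i/4) J₀` becomes the summand `-iπ`
of `γ` once `1 / (4π)` is factored out. -/
theorem helmholtzG_eq {k : ℂ} (hk : k ≠ 0) {x : Plane} (hx : x ≠ 0) :
    helmholtzG k x = radialG k (‖x‖ ^ 2) := by
  have hn : 0 < ‖x‖ := norm_pos_iff.2 hx
  have hlog : Complex.log (k * (‖x‖ : ℝ) / 2) =
      Complex.log k + (Real.log ‖x‖ : ℝ) - (Real.log 2 : ℝ) := by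
    have : k * (‖x‖ : ℝ) / 2 = k * ((‖x‖ / 2 : ℝ) : ℂ) := by push_cast; ring
    rw [this, log_mul_ofReal hk (by positivity), Real.log_div hn.ne' two_ne_zero]
    push_cast; ring
  have hp : (Real.pi : ℂ) ≠ 0 := by exact_mod_cast Real.pi_ne_zero
  rw [helmholtzG, hankelH0, besselY0, besselY0_series_eq, besselJ0_eq, hlog, radialG, scaledSum,
    scaledSum, logTerm, gammaConst, Real.log_pow]
  simp only [Function.iterate_zero, id, pow_zero, one_mul, mul_pow]
  push_cast
  set J := entireSum coeffJ (k ^ 2 * (‖x‖ : ℂ) ^ 2)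
  set Y := entireSum coeffY (k ^ 2 * (‖x‖ : ℂ) ^ 2)
  field_simp
  ring_nf
  simp only [Complex.I_sq]
  ring


/-! ## Gradients of complex valued functions on the plane -/

/-- `f` is differentiable at `x` with partial derivatives `g`. -/
def HasGrad (f : Plane → ℂ) (g : Fin 2 → ℂ) (x : Plane) : Prop :=
  DifferentiableAt ℝ f x ∧ ∀ i, pderiv i f x = g i

theorem HasGrad.congr {f f₁ : Plane → ℂ} {g : Fin 2 → ℂ} {x : Plane} (h : HasGrad f g x)
    (he : f₁ =ᶠ[𝓝 x] f) : HasGrad f₁ g x :=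
  ⟨h.1.congr_of_eventuallyEq he, fun i => by rw [pderiv, he.fderiv_eq]; exact h.2 i⟩

theorem HasGrad.of_eq {f : Plane → ℂ} {g g' : Fin 2 → ℂ} {x : Plane} (h : HasGrad f g x)
    (he : ∀ i, g i = g' i) : HasGrad f g' x := ⟨h.1, fun i => (h.2 i).trans (he i)⟩

theorem HasGrad.const (c : ℂ) (x : Plane) : HasGrad (fun _ => c) (fun _ => 0) x :=
  ⟨differentiableAt_const c, fun i => by simp [pderiv]⟩

theorem HasGrad.add {f f' : Plane → ℂ} {g g' : Fin 2 → ℂ} {x : Plane} (h : HasGrad f g x)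
    (h' : HasGrad f' g' x) : HasGrad (fun z => f z + f' z) (fun i => g i + g' i) x :=
  ⟨h.1.add h'.1, fun i => by
    beta_reduce
    rw [pderiv, fderiv_fun_add h.1 h'.1, ← h.2 i, ← h'.2 i]; rfl⟩

theorem HasGrad.mul {f f' : Plane → ℂ} {g g' : Fin 2 → ℂ} {x : Plane} (h : HasGrad f g x)
    (h' : HasGrad f' g' x) :
    HasGrad (fun z => f z * f' z) (fun i => f x * g' i + f' x * g i) x :=
  ⟨h.1.mul h'.1, fun i => by
    beta_reduce
    rw [pderiv, fderiv_fun_mul h.1 h'.1, ← h.2 i, ← h'.2 i]; rfl⟩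

theorem HasGrad.const_mul {f : Plane → ℂ} {g : Fin 2 → ℂ} {x : Plane} (h : HasGrad f g x)
    (c : ℂ) : HasGrad (fun z => c * f z) (fun i => c * g i) x :=
  ((HasGrad.const c x).mul h).of_eq fun i => by ring

theorem HasGrad.coord (y x : Plane) (j : Fin 2) :
    HasGrad (fun z => ((z j - y j : ℝ) : ℂ)) (fun i => if i = j then 1 else 0) x := by
  have h1 : HasFDerivAt (fun z : Plane => z j - y j) (EuclideanSpace.proj j : Plane →L[ℝ] ℝ) x :=
    (EuclideanSpace.proj j : Plane →L[ℝ] ℝ).hasFDerivAt.sub_const (y j)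
  have h2 : HasFDerivAt (fun z : Plane => ((z j - y j : ℝ) : ℂ))
      (Complex.ofRealCLM.comp (EuclideanSpace.proj j : Plane →L[ℝ] ℝ)) x :=
    Complex.ofRealCLM.hasFDerivAt.comp x h1
  refine ⟨h2.differentiableAt, fun i => ?_⟩
  rw [pderiv, h2.fderiv]
  rcases (by omega : i = 0 ∨ i = 1) with rfl | rfl <;>
    rcases (by omega : j = 0 ∨ j = 1) with rfl | rfl <;> simp

theorem normSq_plane (x : Plane) : ‖x‖ ^ 2 = x 0 ^ 2 + x 1 ^ 2 := by
  rw [EuclideanSpace.real_norm_sq_eq, Fin.sum_univ_two]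

theorem HasGrad.radial {f : ℝ → ℂ} {f' : ℂ} {x y : Plane} (h : HasDerivAt f f' (‖x - y‖ ^ 2)) :
    HasGrad (fun z => f (‖z - y‖ ^ 2)) (fun i => 2 * ((x i - y i : ℝ) : ℂ) * f') x := by
  have h0 : ∀ j, HasFDerivAt (fun z : Plane => z j - y j) (EuclideanSpace.proj j : Plane →L[ℝ] ℝ) x :=
    fun j => (EuclideanSpace.proj j : Plane →L[ℝ] ℝ).hasFDerivAt.sub_const (y j)
  have h1 : HasFDerivAt (fun z : Plane => ‖z - y‖ ^ 2) _ x :=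
    (((h0 0).pow 2).add ((h0 1).pow 2)).congr_of_eventuallyEq
      (Eventually.of_forall fun z => by simp [normSq_plane])
  have h2 := h.hasFDerivAt.comp x h1
  refine ⟨h2.differentiableAt, fun i => ?_⟩
  rw [pderiv]
  have h3 := h2.fderiv
  simp only [Function.comp_def] at h3
  rw [h3]
  rcases (by omega : i = 0 ∨ i = 1) with rfl | rfl <;> simp

/-! ## The Kupradze matrix off the diagonal -/

theorem hasGrad_helmholtzG {k : ℂ} (hk : k ≠ 0) {x y : Plane} (hxy : x ≠ y) :
    HasGrad (fun z => helmholtzG k (z - y))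
      (fun i => 2 * ((x i - y i : ℝ) : ℂ) * radialG₁ k (‖x - y‖ ^ 2)) x := by
  have hs : ‖x - y‖ ^ 2 ≠ 0 := by simpa [sub_eq_zero] using hxy
  refine (HasGrad.radial (hasDerivAt_radialG k hs)).congr ?_
  filter_upwards [eventually_ne_nhds hxy] with z hz
  exact helmholtzG_eq hk (sub_ne_zero.2 hz)

theorem pderiv_helmholtzG {k : ℂ} (hk : k ≠ 0) {x : Plane} (hx : x ≠ 0) (j : Fin 2) :
    pderiv j (helmholtzG k) x = 2 * ((x j - (0 : Plane) j : ℝ) : ℂ) * radialG₁ k (‖x - 0‖ ^ 2) := by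
  have := (hasGrad_helmholtzG hk hx).2 j
  simpa using this

theorem pderiv_pderiv_helmholtzG {k : ℂ} (hk : k ≠ 0) {x : Plane} (hx : x ≠ 0) (i j : Fin 2) :
    pderiv i (pderiv j (helmholtzG k)) x =
      2 * (1 : Matrix (Fin 2) (Fin 2) ℂ) i j * radialG₁ k (‖x‖ ^ 2) +
        4 * (x i : ℂ) * (x j : ℂ) * radialG₂ k (‖x‖ ^ 2) := by
  have hs : ‖x - 0‖ ^ 2 ≠ 0 := by simpa using hx
  have h := ((HasGrad.coord 0 x j).const_mul 2).mul (HasGrad.radial (hasDerivAt_radialG₁ k hs))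
  have h2 := (h.congr (f₁ := pderiv j (helmholtzG k)) (by
    filter_upwards [eventually_ne_nhds hx] with z hz
    exact pderiv_helmholtzG hk hz j)).2 i
  rw [h2, Matrix.one_apply]
  simp only [sub_zero, PiLp.zero_apply]
  ring

/-- Coefficient of `I` in `ω² Γ`, as a function of the squared distance. -/
def gammaDiag (lam mu : ℝ) (ω : ℂ) (s : ℝ) : ℂ :=
  waveNumberS mu ω ^ 2 * radialG (waveNumberS mu ω) s +
    2 * (radialG₁ (waveNumberS mu ω) s - radialG₁ (waveNumberP lam mu ω) s)

/-- Coefficient of `x xᵗ` in `ω² Γ`, as a function of the squared distance. -/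
def gammaRank (lam mu : ℝ) (ω : ℂ) (s : ℝ) : ℂ :=
  4 * (radialG₂ (waveNumberS mu ω) s - radialG₂ (waveNumberP lam mu ω) s)

/-- The derivative of `gammaDiag`. -/
def gammaDiag' (lam mu : ℝ) (ω : ℂ) (s : ℝ) : ℂ :=
  waveNumberS mu ω ^ 2 * radialG₁ (waveNumberS mu ω) s +
    2 * (radialG₂ (waveNumberS mu ω) s - radialG₂ (waveNumberP lam mu ω) s)

/-- The derivative of `gammaRank`. -/
def gammaRank' (lam mu : ℝ) (ω : ℂ) (s : ℝ) : ℂ :=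
  4 * (radialG₃ (waveNumberS mu ω) s - radialG₃ (waveNumberP lam mu ω) s)

theorem hasDerivAt_gammaDiag (lam mu : ℝ) (ω : ℂ) {s : ℝ} (hs : s ≠ 0) :
    HasDerivAt (gammaDiag lam mu ω) (gammaDiag' lam mu ω s) s :=
  ((hasDerivAt_radialG _ hs).const_mul _).add
    (((hasDerivAt_radialG₁ _ hs).sub (hasDerivAt_radialG₁ _ hs)).const_mul 2)

theorem hasDerivAt_gammaRank (lam mu : ℝ) (ω : ℂ) {s : ℝ} (hs : s ≠ 0) :
    HasDerivAt (gammaRank lam mu ω) (gammaRank' lam mu ω s) s :=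
  ((hasDerivAt_radialG₂ _ hs).sub (hasDerivAt_radialG₂ _ hs)).const_mul 4

theorem waveNumberS_ne_zero {mu : ℝ} (hmu : 0 < mu) {ω : ℂ} (hω : ω ≠ 0) :
    waveNumberS mu ω ≠ 0 := by
  have : Real.sqrt mu ≠ 0 := (Real.sqrt_pos.2 hmu).ne'
  exact div_ne_zero hω (by exact_mod_cast this)

theorem waveNumberP_ne_zero {lam mu : ℝ} (h : 0 < lam + 2 * mu) {ω : ℂ} (hω : ω ≠ 0) :
    waveNumberP lam mu ω ≠ 0 := by
  have : Real.sqrt (lam + 2 * mu) ≠ 0 := (Real.sqrt_pos.2 h).ne'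
  exact div_ne_zero hω (by exact_mod_cast this)

theorem waveNumberP_sq {lam mu : ℝ} (h : 0 < lam + 2 * mu) (ω : ℂ) :
    waveNumberP lam mu ω ^ 2 = ω ^ 2 / ((lam + 2 * mu : ℝ) : ℂ) := by
  rw [waveNumberP, div_pow, ← Complex.ofReal_pow, Real.sq_sqrt h.le]

theorem lameGamma_eq {lam mu : ℝ} (hmu : 0 < mu) (hM : 0 < lam + 2 * mu) {ω : ℂ} (hω : ω ≠ 0)
    {x : Plane} (hx : x ≠ 0) (i j : Fin 2) :
    lameGamma lam mu ω x i j = 1 / ω ^ 2 *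
      ((1 : Matrix (Fin 2) (Fin 2) ℂ) i j * gammaDiag lam mu ω (‖x‖ ^ 2) +
        (x i : ℂ) * (x j : ℂ) * gammaRank lam mu ω (‖x‖ ^ 2)) := by
  rw [lameGamma, Matrix.add_apply, lameGammaS, lameGammaP,
    pderiv_pderiv_helmholtzG (waveNumberS_ne_zero hmu hω) hx,
    pderiv_pderiv_helmholtzG (waveNumberP_ne_zero hM hω) hx,
    helmholtzG_eq (waveNumberS_ne_zero hmu hω) hx, gammaDiag, gammaRank]
  ring

theorem lameSIntegrand_normal {lam mu : ℝ} (hmu : 0 < mu) (hM : 0 < lam + 2 * mu) {ω : ℂ}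
    (hω : ω ≠ 0) (b : ℂ) {x y : Plane} (hxy : x ≠ y) (i : Fin 2) :
    lameSIntegrand lam mu ω (normalDensity b) x y i = b / ω ^ 2 *
      (gammaDiag lam mu ω (‖x - y‖ ^ 2) * (y i : ℂ) +
        gammaRank lam mu ω (‖x - y‖ ^ 2) * (((x i - y i : ℝ) : ℂ) *
          (((x 0 - y 0 : ℝ) : ℂ) * (y 0 : ℂ) + ((x 1 - y 1 : ℝ) : ℂ) * (y 1 : ℂ)))) := by
  simp only [lameSIntegrand, normalDensity, circleNormal, Fin.sum_univ_two,
    lameGamma_eq hmu hM hω (sub_ne_zero.2 hxy), PiLp.sub_apply]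
  rcases (by omega : i = 0 ∨ i = 1) with rfl | rfl <;> simp <;> ring

/-- The gradient is taken before `x` is placed on the circle, since relations such as `|x| = 1` do
not survive differentiation in `x`. The scalar `ρ` is `(x - y) · y`. -/
theorem hasGrad_lameSIntegrand_normal {lam mu : ℝ} (hmu : 0 < mu) (hM : 0 < lam + 2 * mu) {ω : ℂ}
    (hω : ω ≠ 0) (b : ℂ) {x y : Plane} (hxy : x ≠ y) (i : Fin 2) {s : ℝ} (hs : s = ‖x - y‖ ^ 2)
    {ρ : ℂ} (hρ : ρ = ((x 0 - y 0 : ℝ) : ℂ) * (y 0 : ℂ) + ((x 1 - y 1 : ℝ) : ℂ) * (y 1 : ℂ)) :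
    HasGrad (fun z => lameSIntegrand lam mu ω (normalDensity b) z y i)
      (fun l => b / ω ^ 2 * (2 * ((x l - y l : ℝ) : ℂ) * gammaDiag' lam mu ω s * (y i : ℂ) +
        2 * ((x l - y l : ℝ) : ℂ) * gammaRank' lam mu ω s * (((x i - y i : ℝ) : ℂ) * ρ) +
        gammaRank lam mu ω s * ((if l = i then ρ else 0) + ((x i - y i : ℝ) : ℂ) * (y l : ℂ)))) x := by
  have hs0 : ‖x - y‖ ^ 2 ≠ 0 := by simpa [sub_eq_zero] using hxy
  have hD := (HasGrad.radial (hasDerivAt_gammaDiag lam mu ω hs0)).mul (HasGrad.const (y i : ℂ) x)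
  have hl := ((HasGrad.coord y x 0).mul (HasGrad.const (y 0 : ℂ) x)).add
    ((HasGrad.coord y x 1).mul (HasGrad.const (y 1 : ℂ) x))
  have hR := (HasGrad.radial (hasDerivAt_gammaRank lam mu ω hs0)).mul
    ((HasGrad.coord y x i).mul hl)
  refine (((hD.add hR).const_mul (b / ω ^ 2)).congr ?_).of_eq fun l => ?_
  · filter_upwards [eventually_ne_nhds hxy] with z hz
    exact lameSIntegrand_normal hmu hM hω b hz i
  · rw [← hs, ← hρ]
    rcases (by omega : l = 0 ∨ l = 1) with rfl | rfl <;>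
      rcases (by omega : i = 0 ∨ i = 1) with rfl | rfl <;>
      simp only [if_true, zero_ne_one, one_ne_zero, if_false] <;> ring

/-! ## Kernels on the unit circle -/

/-- Coefficient of `x` in `Γ(x - y) y`, for `|x| = |y| = 1`. -/
def singleCoeffX (lam mu : ℝ) (ω : ℂ) (s : ℝ) : ℂ :=
  1 / ω ^ 2 * (-(s / 2) * gammaRank lam mu ω s)

/-- Coefficient of `y` in `Γ(x - y) y`, for `|x| = |y| = 1`. -/
def singleCoeffY (lam mu : ℝ) (ω : ℂ) (s : ℝ) : ℂ :=
  1 / ω ^ 2 * (gammaDiag lam mu ω s + s / 2 * gammaRank lam mu ω s)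

/-- Coefficient of `x` in the traction of `Γ(x - y) y`, for `|x| = |y| = 1`. -/
def tractionCoeffX (lam mu : ℝ) (ω : ℂ) (s : ℝ) : ℂ :=
  1 / ω ^ 2 * (lam * (-s * gammaDiag' lam mu ω s - s ^ 2 * gammaRank' lam mu ω s -
      3 / 2 * s * gammaRank lam mu ω s) +
    mu * (-s ^ 2 * gammaRank' lam mu ω s + (1 - 3 / 2 * s) * gammaRank lam mu ω s +
      2 * (1 - s / 2) * gammaDiag' lam mu ω s))

/-- Coefficient of `y` in the traction of `Γ(x - y) y`, for `|x| = |y| = 1`. -/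
def tractionCoeffY (lam mu : ℝ) (ω : ℂ) (s : ℝ) : ℂ :=
  mu / ω ^ 2 * ((2 * s - 2) * gammaDiag' lam mu ω s + s ^ 2 * gammaRank' lam mu ω s -
    (1 - s) * gammaRank lam mu ω s)

/-- Scalar products on the unit circle in terms of the squared distance. -/
theorem circle_relations {x y : Plane} (hx : ‖x‖ = 1) (hy : ‖y‖ = 1) {s : ℝ}
    (hs : s = ‖x - y‖ ^ 2) :
    (x 0 : ℂ) ^ 2 + (x 1 : ℂ) ^ 2 = 1 ∧ (y 0 : ℂ) ^ 2 + (y 1 : ℂ) ^ 2 = 1 ∧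
      (x 0 : ℂ) * y 0 + (x 1 : ℂ) * y 1 = 1 - s / 2 := by
  have h1 := normSq_plane x
  have h2 := normSq_plane y
  have h3 := normSq_plane (x - y)
  rw [hx] at h1
  rw [hy] at h2
  simp only [PiLp.sub_apply] at h3
  have h1' := congrArg (fun r : ℝ => (r : ℂ)) h1
  have h2' := congrArg (fun r : ℝ => (r : ℂ)) h2
  have h3' := congrArg (fun r : ℝ => (r : ℂ)) (hs.trans h3)
  push_cast at h1' h2' h3'
  refine ⟨by linear_combination -h1', by linear_combination -h2', ?_⟩
  linear_combination -(1 / 2) * h1' - (1 / 2) * h2' + (1 / 2) * h3'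

theorem lameSIntegrand_circle {lam mu : ℝ} (hmu : 0 < mu) (hM : 0 < lam + 2 * mu) {ω : ℂ}
    (hω : ω ≠ 0) (b : ℂ) {x y : Plane} (hx : ‖x‖ = 1) (hy : ‖y‖ = 1) (hxy : x ≠ y) (i : Fin 2) :
    lameSIntegrand lam mu ω (normalDensity b) x y i =
      b * (singleCoeffX lam mu ω (‖x - y‖ ^ 2) * (x i : ℂ) +
        singleCoeffY lam mu ω (‖x - y‖ ^ 2) * (y i : ℂ)) := by
  obtain ⟨h1, h2, h3⟩ := circle_relations hx hy rfl
  rw [lameSIntegrand_normal hmu hM hω b hxy, singleCoeffX, singleCoeffY]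
  push_cast at h3 ⊢
  linear_combination (b / ω ^ 2 * gammaRank lam mu ω (‖x - y‖ ^ 2) * ((x i : ℂ) - y i)) * (h3 - h2)

theorem lameKstarIntegrand_circle {lam mu : ℝ} (hmu : 0 < mu) (hM : 0 < lam + 2 * mu) {ω : ℂ}
    (hω : ω ≠ 0) (b : ℂ) {x y : Plane} (hx : ‖x‖ = 1) (hy : ‖y‖ = 1) (hxy : x ≠ y) (i : Fin 2) :
    lameKstarIntegrand circleNormal lam mu ω (normalDensity b) x y i =
      b * (tractionCoeffX lam mu ω (‖x - y‖ ^ 2) * (x i : ℂ) +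
        tractionCoeffY lam mu ω (‖x - y‖ ^ 2) * (y i : ℂ)) := by
  obtain ⟨h1, h2, h3⟩ := circle_relations hx hy rfl
  obtain ⟨s, hs⟩ : ∃ s : ℝ, s = ‖x - y‖ ^ 2 := ⟨_, rfl⟩
  obtain ⟨ρ, hρ⟩ : ∃ ρ : ℂ, ρ =
    ((x 0 - y 0 : ℝ) : ℂ) * (y 0 : ℂ) + ((x 1 - y 1 : ℝ) : ℂ) * (y 1 : ℂ) := ⟨_, rfl⟩
  have hg := fun i l => (hasGrad_lameSIntegrand_normal hmu hM hω b hxy i hs hρ).2 l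
  rw [← hs] at h3 ⊢
  simp only [lameKstarIntegrand, traction, hg, circleNormal, Fin.sum_univ_two, tractionCoeffX,
    tractionCoeffY]
  have hρ' : ρ = -(s / 2) := by rw [hρ]; push_cast; linear_combination h3 - h2
  subst hρ'
  generalize gammaDiag' lam mu ω s = D'
  generalize gammaRank' lam mu ω s = R'
  generalize gammaRank lam mu ω s = R
  have hrr : ((x 0 : ℂ) - y 0) ^ 2 + ((x 1 : ℂ) - y 1) ^ 2 = s := by
    linear_combination h1 + h2 - 2 * h3
  have hrx : ((x 0 : ℂ) - y 0) * x 0 + ((x 1 : ℂ) - y 1) * x 1 = s / 2 := by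
    linear_combination h1 - h3
  have hry : ((x 0 : ℂ) - y 0) * y 0 + ((x 1 : ℂ) - y 1) * y 1 = -(s / 2) := by
    linear_combination h3 - h2
  rcases (by omega : i = 0 ∨ i = 1) with rfl | rfl <;>
    simp only [if_true, zero_ne_one, one_ne_zero, if_false] <;> push_cast
  · linear_combination (b / ω ^ 2) * ((lam * (x 0 : ℂ) * (2 * D' + R)) * hry +
      (lam * (x 0 : ℂ) * (- s * R')) * hrr +
      mu * (2 * D' * y 0 - s * R' * (x 0 - y 0)) * hrx +
      mu * (R * (x 0 - y 0)) * h3 +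
      mu * (2 * D' * (x 0 - y 0)) * h3 - mu * s * R' * (x 0 - y 0) * hrx + mu * R * y 0 * hrx)
  · linear_combination (b / ω ^ 2) * ((lam * (x 1 : ℂ) * (2 * D' + R)) * hry +
      (lam * (x 1 : ℂ) * (- s * R')) * hrr +
      mu * (2 * D' * y 1 - s * R' * (x 1 - y 1)) * hrx +
      mu * (R * (x 1 - y 1)) * h3 +
      mu * (2 * D' * (x 1 - y 1)) * h3 - mu * s * R' * (x 1 - y 1) * hrx + mu * R * y 1 * hrx)

/-- `d/dθ (T(s) sin θ)` for `s = 2 - 2 cos θ`. -/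
def arcDeriv (T T' : ℂ) (s : ℝ) : ℂ := 2 * s * (1 - s / 4) * T' + (1 - s / 2) * T

/-- The Helmholtz equation replaces `k_s² F_s` by `-4 s F_s'' - 4 F_s'`. Then `F_s` and `F_p` enter
through the difference of their derivatives, as an exact angular derivative. The equation for `F_p`
leaves one true remainder, with factor `k_p² / ω² = 1 / (λ + 2μ)`. -/
theorem single_normal_component {lam mu : ℝ} (hM : 0 < lam + 2 * mu) {ω : ℂ}
    (hω : ω ≠ 0) {s : ℝ} (hs : s ≠ 0) :
    singleCoeffX lam mu ω s + singleCoeffY lam mu ω s * (1 - s / 2) =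
      1 / ω ^ 2 * arcDeriv (-2 * (radialG₁ (waveNumberS mu ω) s - radialG₁ (waveNumberP lam mu ω) s))
        (-2 * (radialG₂ (waveNumberS mu ω) s - radialG₂ (waveNumberP lam mu ω) s)) s +
      1 / ((lam + 2 * mu : ℝ) : ℂ) * ((1 - s / 2) * radialG (waveNumberP lam mu ω) s) := by
  have h1 := radialG_ode (waveNumberS mu ω) hs
  have h2 := radialG_ode (waveNumberP lam mu ω) hs
  have h3 : 1 / ω ^ 2 * waveNumberP lam mu ω ^ 2 = 1 / ((lam + 2 * mu : ℝ) : ℂ) := by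
    rw [waveNumberP_sq hM]; field_simp
  rw [← h3, singleCoeffX, singleCoeffY, gammaDiag, gammaRank, arcDeriv]
  linear_combination (1 / ω ^ 2 * (1 - s / 2)) * (h1 - h2)

/-- The same mechanism one derivative higher: the differentiated Helmholtz equation removes `k_s²
F_s'`, and only pressure terms survive outside the exact derivative. -/
theorem traction_normal_component {lam mu : ℝ} (hM : 0 < lam + 2 * mu) {ω : ℂ}
    (hω : ω ≠ 0) {s : ℝ} (hs : s ≠ 0) :
    tractionCoeffX lam mu ω s + tractionCoeffY lam mu ω s * (1 - s / 2) =
      2 * mu / ω ^ 2 * arcDeriv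
        (-2 * s * (radialG₂ (waveNumberS mu ω) s - radialG₂ (waveNumberP lam mu ω) s))
        (-2 * (radialG₂ (waveNumberS mu ω) s - radialG₂ (waveNumberP lam mu ω) s) -
          2 * s * (radialG₃ (waveNumberS mu ω) s - radialG₃ (waveNumberP lam mu ω) s)) s +
      1 / ((lam + 2 * mu : ℝ) : ℂ) *
        (2 * mu * (s * (1 - s / 2) * radialG₁ (waveNumberP lam mu ω) s) -
          lam * (s * radialG₁ (waveNumberP lam mu ω) s)) := by
  have h1 := radialG_ode_deriv (waveNumberS mu ω) hs
  have h2 := radialG_ode_deriv (waveNumberP lam mu ω) hs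
  have h3 : 1 / ω ^ 2 * waveNumberP lam mu ω ^ 2 = 1 / ((lam + 2 * mu : ℝ) : ℂ) := by
    rw [waveNumberP_sq hM]; field_simp
  rw [← h3, tractionCoeffX, tractionCoeffY, gammaDiag', gammaRank, gammaRank', arcDeriv]
  linear_combination (1 / ω ^ 2 * (-lam * s + 2 * mu * s * (1 - s / 2))) * (h1 - h2)


/-! ## Integration over the angle -/

/-- Lebesgue measure on the angles `(-π, π]`. -/
def angleMeasure : Measure ℝ := volume.restrict (Set.Ioc (-Real.pi) Real.pi)

instance : IsFiniteMeasure angleMeasure := by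
  unfold angleMeasure; infer_instance

/-- The squared chord `|e^{iα} - e^{i(α+θ)}|²`. -/
def chordSq (θ : ℝ) : ℝ := 2 - 2 * Real.cos θ

theorem continuous_chordSq : Continuous chordSq := by unfold chordSq; fun_prop

theorem chordSq_nonneg (θ : ℝ) : 0 ≤ chordSq θ := by
  have := Real.cos_le_one θ
  unfold chordSq; linarith

theorem chordSq_le (θ : ℝ) : chordSq θ ≤ 4 := by
  have := Real.neg_one_le_cos θ
  unfold chordSq; linarith

theorem abs_chordSq_le (θ : ℝ) : |chordSq θ| ≤ 4 := by
  rw [abs_of_nonneg (chordSq_nonneg θ)]; exact chordSq_le θ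

theorem chordSq_neg (θ : ℝ) : chordSq (-θ) = chordSq θ := by simp [chordSq]

theorem chordSq_eq_zero_iff {θ : ℝ} (h : θ ∈ Set.Ioc (-Real.pi) Real.pi) :
    chordSq θ = 0 ↔ θ = 0 := by
  have hp := Real.pi_pos
  have hc := Real.cos_eq_one_iff_of_lt_of_lt (x := θ) (by linarith [h.1]) (by linarith [h.2])
  rw [← hc, chordSq]
  constructor <;> intro h <;> linarith

theorem chordSq_pos_of_ne_zero {θ : ℝ} (h : θ ∈ Set.Ioc (-Real.pi) Real.pi) (h0 : θ ≠ 0) :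
    0 < chordSq θ :=
  lt_of_le_of_ne (chordSq_nonneg θ) fun h' => h0 ((chordSq_eq_zero_iff h).1 h'.symm)

theorem ae_chordSq_pos : ∀ᵐ θ ∂angleMeasure, 0 < chordSq θ := by
  have h1 : ∀ᵐ θ ∂angleMeasure, θ ∈ Set.Ioc (-Real.pi) Real.pi :=
    ae_restrict_mem measurableSet_Ioc
  have h2 : ∀ᵐ θ ∂angleMeasure, θ ≠ 0 := by
    refine ae_restrict_of_ae ?_
    simp [ae_iff]
  filter_upwards [h1, h2] with θ h h0 using chordSq_pos_of_ne_zero h h0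

theorem integral_angleMeasure {E : Type*} [NormedAddCommGroup E] [NormedSpace ℝ E] (f : ℝ → E) :
    ∫ θ, f θ ∂angleMeasure = ∫ θ in (-Real.pi)..Real.pi, f θ := by
  rw [intervalIntegral.integral_of_le (by linarith [Real.pi_pos]), angleMeasure]

theorem integrable_angleMeasure_iff {E : Type*} [NormedAddCommGroup E] (f : ℝ → E) :
    Integrable f angleMeasure ↔ IntervalIntegrable f volume (-Real.pi) Real.pi := by
  rw [intervalIntegrable_iff_integrableOn_Ioc_of_le (by linarith [Real.pi_pos]), angleMeasure,
    IntegrableOn]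

theorem integrable_of_continuous {E : Type*} [NormedAddCommGroup E] {f : ℝ → E}
    (hf : Continuous f) : Integrable f angleMeasure :=
  (integrable_angleMeasure_iff f).2 (hf.intervalIntegrable _ _)

theorem integral_odd_eq_zero {f : ℝ → ℂ} (hf : ∀ θ, f (-θ) = -f θ) :
    ∫ θ, f θ ∂angleMeasure = 0 := by
  have h := intervalIntegral.integral_comp_neg (a := -Real.pi) (b := Real.pi) f
  simp only [hf, intervalIntegral.integral_neg, neg_neg] at h
  rw [integral_angleMeasure]
  have h2 : (2 : ℂ) * ∫ θ in (-Real.pi)..Real.pi, f θ = 0 := by linear_combination -h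
  simpa using h2

theorem integrable_log_chordSq :
    Integrable (fun θ => ((Real.log (chordSq θ) : ℝ) : ℂ)) angleMeasure := by
  have h : IntervalIntegrable (fun θ => Real.log ‖chordSq θ‖) volume (-Real.pi) Real.pi := by
    apply MeromorphicOn.intervalIntegrable_log_norm
    intro θ _
    have : AnalyticAt ℝ chordSq θ := by unfold chordSq; fun_prop
    exact this.meromorphicAt
  have h2 := (integrable_angleMeasure_iff _).2 h
  refine (h2.ofReal (𝕜 := ℂ)).congr (ae_of_all _ fun θ => ?_)
  simp [Real.log_abs]

/-- This is the mean value of `log |z - 1|` over the unit circle, which vanishes (Jensen's formula),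
since `chordSq θ = |e^{iθ} - 1|²`. -/
theorem integral_log_chordSq :
    ∫ θ, ((Real.log (chordSq θ) : ℝ) : ℂ) ∂angleMeasure = 0 := by
  have h := circleAverage_log_norm_sub_const₁ (a := 1) (by simp)
  have hk : ∀ θ, Real.log ‖circleMap 0 1 θ - 1‖ = 1 / 2 * Real.log (chordSq θ) := fun θ => by
    have h1 : ‖circleMap 0 1 θ - 1‖ ^ 2 = chordSq θ := by
      rw [← Complex.normSq_eq_norm_sq, Complex.normSq_apply, chordSq]
      simp only [circleMap, Complex.ofReal_one, one_mul, zero_add, Complex.sub_re, Complex.sub_im,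
        Complex.exp_ofReal_mul_I_re, Complex.exp_ofReal_mul_I_im, Complex.one_re, Complex.one_im]
      nlinarith [Real.sin_sq_add_cos_sq θ]
    rw [← h1, Real.log_pow]; push_cast; ring
  rw [Real.circleAverage] at h
  simp only [hk, intervalIntegral.integral_const_mul, smul_eq_mul] at h
  have hp := Real.pi_pos
  have h2 : ∫ θ in (0 : ℝ)..2 * Real.pi, Real.log (chordSq θ) = 0 := by
    rcases mul_eq_zero.1 h with h | h
    · exact absurd h (by positivity)
    · linarith
  have hper : Function.Periodic (fun θ => Real.log (chordSq θ)) (2 * Real.pi) := fun θ => by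
    simp [chordSq]
  have h3 := hper.intervalIntegral_add_eq (-Real.pi) 0
  rw [zero_add, h2, show -Real.pi + 2 * Real.pi = Real.pi by ring] at h3
  rw [integral_complex_ofReal, integral_angleMeasure, h3, Complex.ofReal_zero]

theorem integrable_log_mul {v : ℝ → ℂ} (hv : Continuous v) :
    Integrable (fun θ => ((Real.log (chordSq θ) : ℝ) : ℂ) * v (chordSq θ)) angleMeasure := by
  obtain ⟨C, hC⟩ := (isCompact_Icc (a := (0 : ℝ)) (b := 4)).exists_bound_of_continuousOn
    hv.continuousOn
  exact integrable_log_chordSq.mul_bdd (c := C)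
    (hv.comp continuous_chordSq).aestronglyMeasurable
    (ae_of_all _ fun θ => hC _ ⟨chordSq_nonneg θ, chordSq_le θ⟩)

theorem integrable_add_log_mul {f : ℝ → ℂ} {u v : ℝ → ℂ} (hu : Continuous u) (hv : Continuous v)
    (hf : ∀ s, 0 < s → f s = u s + (Real.log s : ℝ) * v s) :
    Integrable (fun θ => f (chordSq θ)) angleMeasure := by
  refine ((integrable_of_continuous (hu.comp continuous_chordSq)).add (integrable_log_mul hv)).congr
    ?_
  filter_upwards [ae_chordSq_pos] with θ hθ
  simp [hf _ hθ]

theorem chordSq_eq_sin (θ : ℝ) : chordSq θ = (2 * Real.sin (θ / 2)) ^ 2 := by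
  have : Real.cos θ = 1 - 2 * Real.sin (θ / 2) ^ 2 := by
    have h := Real.cos_two_mul (θ / 2)
    rw [show 2 * (θ / 2) = θ by ring] at h
    nlinarith [Real.sin_sq_add_cos_sq (θ / 2)]
  rw [chordSq, this]; ring

/-- By the half-angle formulas this is `x log x` at `x = 2 sin (θ/2)`, times a continuous factor. -/
theorem continuous_log_chordSq_mul_sin :
    Continuous fun θ => Real.log (chordSq θ) * Real.sin θ := by
  have h : (fun θ => Real.log (chordSq θ) * Real.sin θ) = fun θ =>
      2 * ((2 * Real.sin (θ / 2)) * Real.log (2 * Real.sin (θ / 2))) * Real.cos (θ / 2) := by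
    funext θ
    have hs : Real.sin θ = 2 * Real.sin (θ / 2) * Real.cos (θ / 2) := by
      rw [← Real.sin_two_mul]; congr 1; ring
    rw [chordSq_eq_sin, Real.log_pow, hs]; push_cast; ring
  rw [h]
  have := Real.continuous_mul_log.comp (show Continuous fun θ : ℝ => 2 * Real.sin (θ / 2) by fun_prop)
  simp only [Function.comp_def] at this
  fun_prop

theorem hasDerivAt_chordSq (θ : ℝ) : HasDerivAt chordSq (2 * Real.sin θ) θ := by
  have := ((Real.hasDerivAt_cos θ).const_mul 2).const_sub 2
  exact this.congr_deriv (by ring)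

theorem sin_sq_eq_chordSq (θ : ℝ) : Real.sin θ ^ 2 = chordSq θ * (1 - chordSq θ / 4) := by
  have := Real.sin_sq_add_cos_sq θ
  unfold chordSq; nlinarith

theorem ofReal_cos_eq (θ : ℝ) : ((Real.cos θ : ℝ) : ℂ) = 1 - (chordSq θ : ℂ) / 2 := by
  have : Real.cos θ = 1 - chordSq θ / 2 := by unfold chordSq; ring
  rw [this]; push_cast; ring

/-- A tangential derivative with a logarithmic singularity integrates to zero. -/
theorem integral_arcDeriv {T T' p q p' q' : ℝ → ℂ} (hp : ∀ s, HasDerivAt p (p' s) s)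
    (hq : ∀ s, HasDerivAt q (q' s) s) (hp' : Continuous p') (hq' : Continuous q')
    (hT : ∀ s, 0 < s → T s = p s + (Real.log s : ℝ) * q s)
    (hT' : ∀ s, 0 < s → HasDerivAt T (T' s) s) :
    Integrable (fun θ => arcDeriv (T (chordSq θ)) (T' (chordSq θ)) (chordSq θ)) angleMeasure ∧
      ∫ θ, arcDeriv (T (chordSq θ)) (T' (chordSq θ)) (chordSq θ) ∂angleMeasure = 0 := by
  have hpc : Continuous p := continuous_iff_continuousAt.2 fun s => (hp s).continuousAt
  have hqc : Continuous q := continuous_iff_continuousAt.2 fun s => (hq s).continuousAt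
  have hT'' : ∀ s, 0 < s → T' s = p' s + (q s / s + (Real.log s : ℝ) * q' s) := fun s hs => by
    have h := (hp s).add ((hasDerivAt_ofReal_log hs.ne').mul (hq s))
    refine (hT' s hs).unique ((h.congr_deriv (by ring)).congr_of_eventuallyEq ?_)
    filter_upwards [lt_mem_nhds hs] with t ht using hT t ht
  have hint : Integrable (fun θ => arcDeriv (T (chordSq θ)) (T' (chordSq θ)) (chordSq θ))
      angleMeasure := by
    refine integrable_add_log_mul (f := fun s => arcDeriv (T s) (T' s) s)
      (u := fun s => 2 * s * (1 - s / 4) * p' s + 2 * (1 - s / 4) * q s + (1 - s / 2) * p s)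
      (v := fun s => 2 * s * (1 - s / 4) * q' s + (1 - s / 2) * q s) (by fun_prop) (by fun_prop)
      fun s hs => ?_
    have hs' : (s : ℂ) ≠ 0 := by exact_mod_cast hs.ne'
    simp only [arcDeriv, hT s hs, hT'' s hs]
    field_simp
    ring
  refine ⟨hint, ?_⟩
  set Φ : ℝ → ℂ := fun θ => p (chordSq θ) * (Real.sin θ : ℝ) +
    ((Real.log (chordSq θ) * Real.sin θ : ℝ) : ℂ) * q (chordSq θ) with hΦ
  have hΦc : Continuous Φ := by
    have h1 := hpc.comp continuous_chordSq
    have h2 := hqc.comp continuous_chordSq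
    have h3 := Complex.continuous_ofReal.comp continuous_log_chordSq_mul_sin
    have h4 := Complex.continuous_ofReal.comp Real.continuous_sin
    exact (h1.mul h4).add (h3.mul h2)
  -- The primitive `Φ` is continuous through `θ = 0` and differentiable elsewhere, which suffices
  -- for the fundamental theorem of calculus. It vanishes at both endpoints because `sin (±π) = 0`.
  have hd : ∀ θ ∈ Set.Ioo (min (-Real.pi) Real.pi) (max (-Real.pi) Real.pi) \ {0},
      HasDerivAt Φ (arcDeriv (T (chordSq θ)) (T' (chordSq θ)) (chordSq θ)) θ := by
    rintro θ ⟨hθ, h0⟩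
    have hpi := Real.pi_pos
    rw [min_eq_left (by linarith), max_eq_right (by linarith)] at hθ
    have hpos : 0 < chordSq θ := chordSq_pos_of_ne_zero ⟨hθ.1, hθ.2.le⟩ h0
    have h1 : HasDerivAt (fun t => T (chordSq t) * ((Real.sin t : ℝ) : ℂ)) _ θ :=
      ((hT' _ hpos).scomp θ (hasDerivAt_chordSq θ)).mul (Real.hasDerivAt_sin θ).ofReal_comp
    refine (h1.congr_deriv ?_).congr_of_eventuallyEq ?_
    · have h2 : ((Real.sin θ : ℝ) : ℂ) ^ 2 = chordSq θ * (1 - chordSq θ / 4) := by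
        rw [← Complex.ofReal_pow, sin_sq_eq_chordSq]; push_cast; ring
      rw [ofReal_cos_eq, arcDeriv, Complex.real_smul]
      push_cast
      simp only [Function.comp]
      push_cast at h2
      linear_combination 2 * T' (chordSq θ) * h2
    · filter_upwards [continuous_chordSq.continuousAt.eventually (lt_mem_nhds hpos)] with t ht
      rw [hΦ, hT _ ht]
      push_cast; ring
  rw [integral_angleMeasure, MeasureTheory.integral_eq_of_hasDerivAt_off_countable Φ _
    (Set.countable_singleton 0) hΦc.continuousOn hd ((integrable_angleMeasure_iff _).1 hint)]
  simp [hΦ]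

theorem integral_one_angle : ∫ _, (1 : ℂ) ∂angleMeasure = 2 * Real.pi := by
  rw [integral_angleMeasure]
  simp
  ring

theorem integral_chordSq : ∫ θ, (chordSq θ : ℂ) ∂angleMeasure = 4 * Real.pi := by
  rw [integral_complex_ofReal, integral_angleMeasure]
  simp only [chordSq]
  rw [intervalIntegral.integral_sub (by simp)
    ((by fun_prop : Continuous fun θ : ℝ => 2 * Real.cos θ).intervalIntegrable _ _),
    intervalIntegral.integral_const_mul,
    integral_cos]
  simp
  ring

/-- Taking `T = log` in `integral_arcDeriv` gives a linear relation between the integrals of `1`,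
`s`, `log s` and `s log s`, of which the first three are known. -/
theorem integral_chordSq_mul_log :
    ∫ θ, (chordSq θ : ℂ) * (Real.log (chordSq θ) : ℝ) ∂angleMeasure = 4 * Real.pi := by
  have h := (integral_arcDeriv (T := fun s => ((Real.log s : ℝ) : ℂ)) (T' := fun s => 1 / (s : ℂ))
    (p := fun _ => 0) (q := fun _ => 1) (p' := fun _ => 0) (q' := fun _ => 0)
    (fun s => hasDerivAt_const s _) (fun s => hasDerivAt_const s _) continuous_const
    continuous_const (fun s _ => by simp) (fun s hs => hasDerivAt_ofReal_log hs.ne')).2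
  have hs : Integrable (fun θ => (chordSq θ : ℂ)) angleMeasure :=
    integrable_of_continuous (Complex.continuous_ofReal.comp continuous_chordSq)
  have h1 : Integrable (fun _ : ℝ => (1 : ℂ)) angleMeasure := integrable_const _
  have hl := integrable_log_chordSq
  have hsl : Integrable (fun θ => (chordSq θ : ℂ) * (Real.log (chordSq θ) : ℝ)) angleMeasure := by
    simpa [mul_comm] using integrable_log_mul (v := fun s => (s : ℂ)) (by fun_prop)
  have h2 : ∀ᵐ θ ∂angleMeasure, arcDeriv (Real.log (chordSq θ) : ℝ) (1 / (chordSq θ : ℂ)) (chordSq θ) =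
      2 * 1 - 1 / 2 * (chordSq θ : ℂ) + (Real.log (chordSq θ) : ℝ) -
        1 / 2 * ((chordSq θ : ℂ) * (Real.log (chordSq θ) : ℝ)) := by
    filter_upwards [ae_chordSq_pos] with θ hθ
    have hs' : (chordSq θ : ℂ) ≠ 0 := by exact_mod_cast hθ.ne'
    rw [arcDeriv]
    field_simp
    ring
  have i1 : Integrable (fun θ => 2 * 1 - 1 / 2 * (chordSq θ : ℂ)) angleMeasure :=
    (h1.const_mul 2).sub (hs.const_mul _)
  have i2 : Integrable (fun θ => 2 * 1 - 1 / 2 * (chordSq θ : ℂ) + (Real.log (chordSq θ) : ℝ))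
      angleMeasure := i1.add hl
  rw [integral_congr_ae h2, integral_sub i2 (hsl.const_mul _), integral_add i1 hl,
    integral_sub (h1.const_mul 2) (hs.const_mul _), integral_const_mul, integral_const_mul,
    integral_const_mul, integral_one_angle, integral_chordSq, integral_log_chordSq] at h
  linear_combination -2 * h


/-! ## The unit circle with its arc length -/

/-- The point of the unit circle at angle `θ`. -/
def circlePoint (θ : ℝ) : Plane := !₂[Real.cos θ, Real.sin θ]

theorem continuous_circlePoint : Continuous circlePoint := by
  unfold circlePoint
  refine (PiLp.continuous_toLp 2 _).comp (continuous_pi fun i => ?_)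
  fin_cases i
  · exact Real.continuous_cos
  · exact Real.continuous_sin

@[simp] theorem circlePoint_zero (θ : ℝ) : circlePoint θ 0 = Real.cos θ := rfl

@[simp] theorem circlePoint_one (θ : ℝ) : circlePoint θ 1 = Real.sin θ := rfl

theorem norm_circlePoint (θ : ℝ) : ‖circlePoint θ‖ = 1 := by
  have h := normSq_plane (circlePoint θ)
  rw [circlePoint_zero, circlePoint_one, Real.cos_sq_add_sin_sq] at h
  exact (pow_eq_one_iff_of_nonneg (norm_nonneg _) two_ne_zero).1 h

theorem normSq_circlePoint_sub (α θ : ℝ) :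
    ‖circlePoint α - circlePoint (α + θ)‖ ^ 2 = chordSq θ := by
  rw [normSq_plane, chordSq]
  simp only [PiLp.sub_apply, circlePoint_zero, circlePoint_one, Real.cos_add, Real.sin_add]
  nlinarith [Real.sin_sq_add_cos_sq α, Real.sin_sq_add_cos_sq θ]

/-- Rotation invariance: `(-π, π]` and its translate by `α` are both fundamental domains for the
period `2π`. It allows any boundary point to be taken as the origin of the angle. -/
theorem circleMeasure_eq (α : ℝ) :
    circleMeasure = Measure.map (fun θ => circlePoint (α + θ)) angleMeasure := by
  have hm : Measurable circlePoint := continuous_circlePoint.measurable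
  have hm' : Measurable fun θ => circlePoint (α + θ) := hm.comp (measurable_const_add α)
  have hp := Real.pi_pos
  ext B hB
  rw [Measure.map_apply hm' hB, angleMeasure, Measure.restrict_apply (hm' hB)]
  change Measure.map circlePoint _ B = _
  rw [Measure.map_apply hm hB, Measure.restrict_apply (hm hB)]
  have h1 := isAddFundamentalDomain_Ioc (T := 2 * Real.pi) (by positivity) (-Real.pi) volume
  have h2 := isAddFundamentalDomain_Ioc (T := 2 * Real.pi) (by positivity) (α - Real.pi) volume
  have h3 := h1.measure_set_eq h2 (A := circlePoint ⁻¹' B) (hm hB) fun g => by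
    obtain ⟨_, n, rfl⟩ := g
    ext θ
    simp only [Set.mem_preimage]
    have : circlePoint ((⟨(fun x : ℤ => x • (2 * Real.pi)) n, n, rfl⟩ :
        AddSubgroup.zmultiples (2 * Real.pi)) +ᵥ θ) = circlePoint θ := by
      have e : ((⟨(fun x : ℤ => x • (2 * Real.pi)) n, n, rfl⟩ :
        AddSubgroup.zmultiples (2 * Real.pi)) +ᵥ θ) = θ + n * (2 * Real.pi) := by
        rw [AddSubgroup.vadd_def]; simp [add_comm]
      rw [e]
      simp [circlePoint]
    rw [this]
  rw [show -Real.pi + 2 * Real.pi = Real.pi by ring] at h3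
  rw [h3, show (fun θ => circlePoint (α + θ)) ⁻¹' B ∩ Set.Ioc (-Real.pi) Real.pi =
    (fun θ => α + θ) ⁻¹' (circlePoint ⁻¹' B ∩ Set.Ioc (α - Real.pi) (α - Real.pi + 2 * Real.pi)) by
      ext θ
      simp only [Set.mem_inter_iff, Set.mem_preimage, Set.mem_Ioc]
      constructor
      · rintro ⟨h, h1, h2⟩; exact ⟨h, by linarith, by linarith⟩
      · rintro ⟨h, h1, h2⟩; exact ⟨h, by linarith, by linarith⟩]
  exact (measure_preimage_add volume α _).symm

instance : IsFiniteMeasure circleMeasure := by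
  rw [circleMeasure_eq 0]; infer_instance

theorem circleMeasure_ne_zero : circleMeasure ≠ 0 := by
  intro h
  have h1 : circleMeasure Set.univ = 0 := by rw [h]; rfl
  have hm : Measurable fun θ => circlePoint (0 + θ) :=
    continuous_circlePoint.measurable.comp (measurable_const_add 0)
  rw [circleMeasure_eq 0, Measure.map_apply hm MeasurableSet.univ,
    angleMeasure, Set.preimage_univ, Measure.restrict_apply_univ, Real.volume_Ioc] at h1
  have := Real.pi_pos
  simp only [ENNReal.ofReal_eq_zero] at h1
  linarith

theorem ae_circleMeasure {p : Plane → Prop} (α : ℝ)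
    (h : ∀ θ, 0 < chordSq θ → p (circlePoint (α + θ))) : ∀ᵐ y ∂circleMeasure, p y := by
  rw [circleMeasure_eq α]
  have hm : AEMeasurable (fun θ => circlePoint (α + θ)) angleMeasure :=
    (continuous_circlePoint.measurable.comp (measurable_const_add α)).aemeasurable
  -- The predicate `p` need not be measurable, so it is replaced by the measurable set of the circle
  -- minus one point, on which it holds.
  obtain ⟨S, hS, hS1, hS2⟩ : ∃ S : Set Plane, MeasurableSet S ∧ S ⊆ {y | p y} ∧
      ∀ θ, 0 < chordSq θ → circlePoint (α + θ) ∈ S := by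
    refine ⟨{y | ‖y‖ = 1} \ {circlePoint α},
      (measurableSet_eq_fun measurable_norm measurable_const).diff
      (measurableSet_singleton _), ?_, fun θ hθ => ⟨norm_circlePoint _, fun hy => ?_⟩⟩
    · rintro y ⟨hy, hne⟩
      have hz : ∃ β, circlePoint β = y := by
        have h2 := normSq_plane y
        rw [Set.mem_ofPred_eq] at hy
        rw [hy] at h2
        have hn : ‖(⟨y 0, y 1⟩ : ℂ)‖ = 1 := by
          rw [← pow_eq_one_iff_of_nonneg (norm_nonneg _) two_ne_zero, ← Complex.normSq_eq_norm_sq,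
            Complex.normSq_mk]
          linarith
        have hn0 : (⟨y 0, y 1⟩ : ℂ) ≠ 0 := norm_ne_zero_iff.1 (by rw [hn]; exact one_ne_zero)
        refine ⟨Complex.arg ⟨y 0, y 1⟩, ?_⟩
        ext i
        rcases (by omega : i = 0 ∨ i = 1) with rfl | rfl
        · rw [circlePoint_zero, Complex.cos_arg hn0, hn, div_one]
        · rw [circlePoint_one, Complex.sin_arg, hn, div_one]
      obtain ⟨β, rfl⟩ := hz
      have hb : circlePoint (α + (β - α)) = circlePoint β := by congr 1; ring
      have hpos : 0 < chordSq (β - α) := by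
        rw [← normSq_circlePoint_sub α, hb]
        have : circlePoint α - circlePoint β ≠ 0 := sub_ne_zero.2 fun h => hne h.symm
        positivity
      have := h _ hpos
      rwa [hb] at this
    · rw [← normSq_circlePoint_sub α, Set.mem_singleton_iff.1 hy] at hθ
      simp at hθ
  refine (ae_map_iff hm hS).2 ?_ |>.mono fun y hy => hS1 hy
  filter_upwards [ae_chordSq_pos] with θ hθ using hS2 θ hθ

/-- Set integrals over the circle of functions continuous off a point, in the angle. -/
theorem circle_setIntegral {E : Type*} [NormedAddCommGroup E] [NormedSpace ℝ E] (α : ℝ)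
    {f F : Plane → E} {g : ℝ → E} {A : Set Plane} (hA : MeasurableSet A)
    (hF : ContinuousOn F {circlePoint α}ᶜ)
    (hfF : ∀ y, ‖y‖ = 1 → y ≠ circlePoint α → f y = F y)
    (hg : ∀ θ, 0 < chordSq θ → F (circlePoint (α + θ)) = g θ) :
    (IntegrableOn f A circleMeasure ↔
      IntegrableOn g ((fun θ => circlePoint (α + θ)) ⁻¹' A) angleMeasure) ∧
    ∫ y in A, f y ∂circleMeasure =
      ∫ θ in (fun θ => circlePoint (α + θ)) ⁻¹' A, g θ ∂angleMeasure := by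
  have hm : Measurable fun θ => circlePoint (α + θ) :=
    continuous_circlePoint.measurable.comp (measurable_const_add α)
  have hne : ∀ θ, 0 < chordSq θ → circlePoint (α + θ) ≠ circlePoint α := fun θ hθ h => by
    rw [← normSq_circlePoint_sub α, h] at hθ
    simp at hθ
  have hae : f =ᵐ[circleMeasure] F := ae_circleMeasure α fun θ hθ =>
    hfF _ (norm_circlePoint _) (hne θ hθ)
  have hFm : AEStronglyMeasurable F circleMeasure := by
    have h1 := hF.aestronglyMeasurable (μ := circleMeasure) (measurableSet_singleton _).compl
    have h2 : circleMeasure.restrict {circlePoint α}ᶜ = circleMeasure := by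
      exact Measure.restrict_eq_self_of_ae_mem (ae_circleMeasure α fun θ hθ => hne θ hθ)
    rwa [h2] at h1
  have hgae : (fun θ => F (circlePoint (α + θ))) =ᵐ[angleMeasure] g := by
    filter_upwards [ae_chordSq_pos] with θ hθ using hg θ hθ
  have hr : circleMeasure.restrict A =
      Measure.map (fun θ => circlePoint (α + θ))
        (angleMeasure.restrict ((fun θ => circlePoint (α + θ)) ⁻¹' A)) := by
    rw [circleMeasure_eq α, Measure.restrict_map hm hA]
  have hFA : AEStronglyMeasurable F (circleMeasure.restrict A) := hFm.restrict
  constructor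
  · rw [IntegrableOn, integrable_congr (ae_restrict_of_ae hae), hr,
      integrable_map_measure (hr ▸ hFA) hm.aemeasurable, IntegrableOn,
      ← integrable_congr (ae_restrict_of_ae hgae)]
    rfl
  · rw [integral_congr_ae (ae_restrict_of_ae hae), hr,
      integral_map hm.aemeasurable (hr ▸ hFA),
      ← integral_congr_ae (ae_restrict_of_ae hgae)]

/-- The angles of the points at distance more than `ε`. -/
theorem preimage_dist (α : ℝ) {ε : ℝ} (hε : 0 < ε) :
    (fun θ => circlePoint (α + θ)) ⁻¹' {y | ε < dist (circlePoint α) y} =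
      {θ | ε ^ 2 < chordSq θ} := by
  ext θ
  simp only [Set.mem_preimage, Set.mem_ofPred_eq]
  rw [← normSq_circlePoint_sub α, dist_eq_norm]
  exact (sq_lt_sq₀ hε.le (norm_nonneg _)).symm

theorem tendsto_truncated {E : Type*} [NormedAddCommGroup E] [NormedSpace ℝ E] {g : ℝ → E}
    (hg : Integrable g angleMeasure) :
    Tendsto (fun ε : ℝ => ∫ θ in {θ | ε ^ 2 < chordSq θ}, g θ ∂angleMeasure) (𝓝[>] 0)
      (𝓝 (∫ θ, g θ ∂angleMeasure)) := by
  have hA : ∀ ε : ℝ, MeasurableSet {θ | ε ^ 2 < chordSq θ} := fun ε =>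
    measurableSet_lt measurable_const continuous_chordSq.measurable
  simp only [← integral_indicator (hA _)]
  refine tendsto_integral_filter_of_dominated_convergence (fun θ => ‖g θ‖)
    (Eventually.of_forall fun ε => hg.aestronglyMeasurable.indicator (hA ε))
    (Eventually.of_forall fun ε => ae_of_all _ fun θ => norm_indicator_le_norm_self _ _) hg.norm ?_
  filter_upwards [ae_chordSq_pos] with θ hθ
  have h1 : Tendsto (fun ε : ℝ => ε ^ 2) (𝓝[>] 0) (𝓝 0) := by
    have : Tendsto (fun ε : ℝ => ε ^ 2) (𝓝 0) (𝓝 (0 ^ 2)) := (continuous_pow 2).tendsto 0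
    rw [zero_pow two_ne_zero] at this
    exact this.mono_left nhdsWithin_le_nhds
  refine tendsto_const_nhds.congr' ?_
  filter_upwards [h1.eventually (gt_mem_nhds hθ)] with ε hε
  rw [Set.indicator_of_mem]
  exact hε

theorem continuousOn_comp_normSq {a : ℝ → ℂ} (ha : ContinuousOn a (Set.Ioi 0)) (x : Plane) :
    ContinuousOn (fun y => a (‖x - y‖ ^ 2)) {x}ᶜ := by
  refine ha.comp (by fun_prop) fun y hy => ?_
  have : x - y ≠ 0 := sub_ne_zero.2 fun h => hy h.symm
  exact Set.mem_Ioi.2 (by positivity)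

theorem continuous_ofReal_coord (i : Fin 2) : Continuous fun y : Plane => ((y i : ℝ) : ℂ) := by
  fun_prop

/-- Scalar kernels depending only on the distance, with an integrable profile. -/
theorem circle_integral_radial (α : ℝ) {f : Plane → ℂ} {a : ℝ → ℂ}
    (ha : ContinuousOn a (Set.Ioi 0))
    (hf : ∀ y, ‖y‖ = 1 → y ≠ circlePoint α → f y = a (‖circlePoint α - y‖ ^ 2)) :
    ∫ y, f y ∂circleMeasure = ∫ θ, a (chordSq θ) ∂angleMeasure := by
  have := (circle_setIntegral α (g := fun θ => a (chordSq θ)) MeasurableSet.univ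
    (continuousOn_comp_normSq ha _) hf fun θ _ => by rw [normSq_circlePoint_sub]).2
  simpa using this

theorem hasPV_radial (α : ℝ) {f : Plane → ℂ} {a : ℝ → ℂ} (ha : ContinuousOn a (Set.Ioi 0))
    (hf : ∀ y, ‖y‖ = 1 → y ≠ circlePoint α → f y = a (‖circlePoint α - y‖ ^ 2))
    (hi : Integrable (fun θ => a (chordSq θ)) angleMeasure) :
    HasPV circleMeasure (circlePoint α) f (∫ θ, a (chordSq θ) ∂angleMeasure) := by
  refine (tendsto_truncated hi).congr' ?_
  filter_upwards [self_mem_nhdsWithin] with ε hε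
  have hε' : 0 < ε := hε
  rw [← preimage_dist α hε']
  exact ((circle_setIntegral α (g := fun θ => a (chordSq θ))
    (measurableSet_lt measurable_const (by fun_prop))
    (continuousOn_comp_normSq ha _) hf fun θ _ => by rw [normSq_circlePoint_sub]).2).symm

/-- The tangent vector at angle `α`. -/
def circleTangent (α : ℝ) (i : Fin 2) : ℝ := if i = 0 then -Real.sin α else Real.cos α

theorem circlePoint_add (α θ : ℝ) (i : Fin 2) :
    circlePoint (α + θ) i =
      Real.cos θ * circlePoint α i + Real.sin θ * circleTangent α i := by
  rcases (by omega : i = 0 ∨ i = 1) with rfl | rfl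
  · rw [circlePoint_zero, circlePoint_zero, Real.cos_add, circleTangent, if_pos rfl]; ring
  · rw [circlePoint_one, circlePoint_one, Real.sin_add, circleTangent, if_neg one_ne_zero]; ring

/-- Integrals of an isotropic vector kernel over a symmetric part of the circle. -/
theorem circle_setIntegral_isotropic (α : ℝ) {f : Plane → CVec} {a c : ℝ → ℂ}
    (ha : ContinuousOn a (Set.Ioi 0)) (hc : ContinuousOn c (Set.Ioi 0))
    (hf : ∀ y, ‖y‖ = 1 → y ≠ circlePoint α → ∀ i, f y i =
      a (‖circlePoint α - y‖ ^ 2) * (circlePoint α i : ℂ) + c (‖circlePoint α - y‖ ^ 2) * (y i : ℂ))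
    {A : Set Plane} {S : Set ℝ} (hA : MeasurableSet A) (hS : MeasurableSet S)
    (hAS : (fun θ => circlePoint (α + θ)) ⁻¹' A = chordSq ⁻¹' S)
    (hN : IntegrableOn (fun θ => a (chordSq θ) + c (chordSq θ) * (1 - chordSq θ / 2))
      (chordSq ⁻¹' S) angleMeasure)
    (hci : IntegrableOn (fun θ => c (chordSq θ)) (chordSq ⁻¹' S) angleMeasure) (i : Fin 2) :
    (∫ y in A, f y ∂circleMeasure) i =
      (∫ θ in chordSq ⁻¹' S, (a (chordSq θ) + c (chordSq θ) * (1 - chordSq θ / 2))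
        ∂angleMeasure) * (circlePoint α i : ℂ) := by
  have hSm : MeasurableSet (chordSq ⁻¹' S) := continuous_chordSq.measurable hS
  have hci' : IntegrableOn (fun θ => c (chordSq θ) * ((Real.sin θ : ℝ) : ℂ)) (chordSq ⁻¹' S)
      angleMeasure := by
    refine Integrable.mul_bdd (c := 1) hci
      (by fun_prop : Continuous fun θ : ℝ => ((Real.sin θ : ℝ) : ℂ)).aestronglyMeasurable
      (ae_of_all _ fun θ => ?_)
    rw [Complex.norm_real]
    exact Real.abs_sin_le_one θ
  have key := fun i => circle_setIntegral α (f := fun y => f y i)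
    (F := fun y => a (‖circlePoint α - y‖ ^ 2) * (circlePoint α i : ℂ) +
      c (‖circlePoint α - y‖ ^ 2) * (y i : ℂ))
    (g := fun θ => (a (chordSq θ) + c (chordSq θ) * (1 - chordSq θ / 2)) * (circlePoint α i : ℂ) +
      c (chordSq θ) * ((Real.sin θ : ℝ) : ℂ) * (circleTangent α i : ℂ)) hA
    (((continuousOn_comp_normSq ha _).mul continuousOn_const).add
      ((continuousOn_comp_normSq hc _).mul (continuous_ofReal_coord i).continuousOn))
    (fun y h1 h2 => hf y h1 h2 i) (fun θ _ => by
      rw [normSq_circlePoint_sub, circlePoint_add α θ i]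
      push_cast [← ofReal_cos_eq]
      ring)
  rw [hAS] at key
  have hint : ∀ i, IntegrableOn (fun θ => (a (chordSq θ) + c (chordSq θ) * (1 - chordSq θ / 2)) *
      (circlePoint α i : ℂ) + c (chordSq θ) * ((Real.sin θ : ℝ) : ℂ) * (circleTangent α i : ℂ))
      (chordSq ⁻¹' S) angleMeasure := fun i => (hN.mul_const _).add (hci'.mul_const _)
  rw [eval_integral_piLp (fun i => (key i).1.2 (hint i)), (key i).2,
    integral_add (hN.mul_const _) (hci'.mul_const _), integral_mul_const, integral_mul_const]
  -- The tangential part of `y` contributes an odd function of `θ` on a set symmetric in `θ`, so it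
  -- vanishes however singular `c` is at `s = 0`, provided it is integrable on that set.
  have hodd : ∫ θ in chordSq ⁻¹' S, c (chordSq θ) * ((Real.sin θ : ℝ) : ℂ) ∂angleMeasure = 0 := by
    rw [← integral_indicator hSm]
    refine integral_odd_eq_zero fun θ => ?_
    by_cases h : θ ∈ chordSq ⁻¹' S
    · have h' : -θ ∈ chordSq ⁻¹' S := by rwa [Set.mem_preimage, chordSq_neg]
      rw [Set.indicator_of_mem h, Set.indicator_of_mem h', chordSq_neg, Real.sin_neg]
      push_cast; ring
    · have h' : -θ ∉ chordSq ⁻¹' S := by rwa [Set.mem_preimage, chordSq_neg]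
      rw [Set.indicator_of_notMem h, Set.indicator_of_notMem h', neg_zero]
  rw [hodd, zero_mul, add_zero]

/-- Only the normal combination has to be integrable. The coefficient `c` alone may be too singular
at `s = 0`; it is bounded on each symmetric truncation, where its tangential contribution cancels.
This is why the elastic operator exists as a principal value. -/
theorem hasPV_isotropic (α : ℝ) {f : Plane → CVec} {a c : ℝ → ℂ}
    (ha : ContinuousOn a (Set.Ioi 0)) (hc : ContinuousOn c (Set.Ioi 0))
    (hf : ∀ y, ‖y‖ = 1 → y ≠ circlePoint α → ∀ i, f y i =
      a (‖circlePoint α - y‖ ^ 2) * (circlePoint α i : ℂ) + c (‖circlePoint α - y‖ ^ 2) * (y i : ℂ))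
    (hN : Integrable (fun θ => a (chordSq θ) + c (chordSq θ) * (1 - chordSq θ / 2)) angleMeasure) :
    HasPV circleMeasure (circlePoint α) f (WithLp.toLp 2 fun i =>
      (∫ θ, (a (chordSq θ) + c (chordSq θ) * (1 - chordSq θ / 2)) ∂angleMeasure) *
        (circlePoint α i : ℂ)) := by
  have h1 : Tendsto (fun ε : ℝ => (WithLp.toLp 2 fun i =>
      (∫ θ in {θ | ε ^ 2 < chordSq θ}, (a (chordSq θ) + c (chordSq θ) * (1 - chordSq θ / 2))
        ∂angleMeasure) * (circlePoint α i : ℂ) : CVec)) (𝓝[>] 0) (𝓝 (WithLp.toLp 2 fun i =>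
      (∫ θ, (a (chordSq θ) + c (chordSq θ) * (1 - chordSq θ / 2)) ∂angleMeasure) *
        (circlePoint α i : ℂ))) :=
    ((PiLp.continuous_toLp 2 _).tendsto _).comp
      (tendsto_pi_nhds.2 fun i => (tendsto_truncated hN).mul_const _)
  refine h1.congr' ?_
  filter_upwards [self_mem_nhdsWithin] with ε hε
  have hε' : 0 < ε := hε
  ext i
  refine (circle_setIntegral_isotropic α ha hc hf (S := Set.Ioi (ε ^ 2))
    (measurableSet_lt measurable_const (by fun_prop)) measurableSet_Ioi (preimage_dist α hε')
    hN.integrableOn ?_ i).symm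
  obtain ⟨C, hC⟩ := (isCompact_Icc (a := ε ^ 2) (b := 4)).exists_bound_of_continuousOn
    (hc.mono fun s hs => lt_of_lt_of_le (by positivity : 0 < ε ^ 2) hs.1)
  have hSm : MeasurableSet (chordSq ⁻¹' Set.Ioi (ε ^ 2)) :=
    continuous_chordSq.measurable measurableSet_Ioi
  refine IntegrableOn.of_bound (C := C) (measure_lt_top _ _) ?_ ?_
  · refine ContinuousOn.aestronglyMeasurable (hc.comp continuous_chordSq.continuousOn ?_) hSm
    intro θ hθ
    exact lt_trans (by positivity : 0 < ε ^ 2) hθ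
  · filter_upwards [ae_restrict_mem hSm] with θ hθ
    exact hC _ ⟨le_of_lt hθ, chordSq_le θ⟩


/-! ## Profiles with a logarithmic singularity -/

/-- Functions of the form `p + log q` on the half line with `p`, `q` continuously differentiable. -/
def LogSmooth (f : ℝ → ℂ) : Prop :=
  ∃ p q : ℝ → ℂ, ContDiff ℝ 1 p ∧ ContDiff ℝ 1 q ∧
    ∀ s, 0 < s → f s = p s + (Real.log s : ℝ) * q s

theorem LogSmooth.of_contDiff {p : ℝ → ℂ} (hp : ContDiff ℝ 1 p) : LogSmooth p :=
  ⟨p, fun _ => 0, hp, contDiff_const, fun s _ => by simp⟩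

theorem LogSmooth.congr {f g : ℝ → ℂ} (hf : LogSmooth f) (h : ∀ s, 0 < s → g s = f s) :
    LogSmooth g := by
  obtain ⟨p, q, hp, hq, e⟩ := hf
  exact ⟨p, q, hp, hq, fun s hs => (h s hs).trans (e s hs)⟩

theorem LogSmooth.add {f g : ℝ → ℂ} (hf : LogSmooth f) (hg : LogSmooth g) :
    LogSmooth fun s => f s + g s := by
  obtain ⟨p, q, hp, hq, e⟩ := hf
  obtain ⟨p', q', hp', hq', e'⟩ := hg
  exact ⟨_, _, hp.add hp', hq.add hq', fun s hs => by
    beta_reduce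
    rw [e s hs, e' s hs]; ring⟩

theorem LogSmooth.mul_left {f g : ℝ → ℂ} (hf : LogSmooth f) (hg : ContDiff ℝ 1 g) :
    LogSmooth fun s => g s * f s := by
  obtain ⟨p, q, hp, hq, e⟩ := hf
  exact ⟨_, _, hg.mul hp, hg.mul hq, fun s hs => by
    beta_reduce
    rw [e s hs]; ring⟩

theorem LogSmooth.const_mul {f : ℝ → ℂ} (hf : LogSmooth f) (c : ℂ) :
    LogSmooth fun s => c * f s := hf.mul_left contDiff_const

theorem LogSmooth.log_mul {g : ℝ → ℂ} (hg : ContDiff ℝ 1 g) :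
    LogSmooth fun s => (Real.log s : ℝ) * g s :=
  ⟨fun _ => 0, g, contDiff_const, hg, fun s _ => by simp⟩

theorem LogSmooth.integrable {f : ℝ → ℂ} (hf : LogSmooth f) :
    Integrable (fun θ => f (chordSq θ)) angleMeasure := by
  obtain ⟨p, q, hp, hq, e⟩ := hf
  exact integrable_add_log_mul hp.continuous hq.continuous e

theorem LogSmooth.integral_arcDeriv {T T' : ℝ → ℂ} (hT : LogSmooth T)
    (hT' : ∀ s, 0 < s → HasDerivAt T (T' s) s) :
    Integrable (fun θ => arcDeriv (T (chordSq θ)) (T' (chordSq θ)) (chordSq θ)) angleMeasure ∧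
      ∫ θ, arcDeriv (T (chordSq θ)) (T' (chordSq θ)) (chordSq θ) ∂angleMeasure = 0 := by
  obtain ⟨p, q, hp, hq, e⟩ := hT
  exact Minnaert.integral_arcDeriv
    (fun s => ((hp.differentiable one_ne_zero) s).hasDerivAt)
    (fun s => ((hq.differentiable one_ne_zero) s).hasDerivAt)
    (hp.continuous_deriv le_rfl) (hq.continuous_deriv le_rfl) e hT'

theorem contDiff_ofReal_one : ContDiff ℝ 1 fun s : ℝ => (s : ℂ) := Complex.ofRealCLM.contDiff

theorem contDiff_scaledSum {c : ℕ → ℂ} (hc : FactorialBound c) (κ : ℂ) (n : ℕ) :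
    ContDiff ℝ 1 (scaledSum c κ n) := by
  rw [contDiff_one_iff_deriv]
  refine ⟨fun s => (hasDerivAt_scaledSum hc κ n s).differentiableAt, ?_⟩
  rw [funext fun s => (hasDerivAt_scaledSum hc κ n s).deriv]
  exact continuous_scaledSum hc κ (n + 1)

theorem logSmooth_log_add_mul {g : ℝ → ℂ} (hg : ContDiff ℝ 1 g) (c : ℂ) :
    LogSmooth fun s => (c + (Real.log s : ℝ)) * g s :=
  ((LogSmooth.of_contDiff (contDiff_const.mul hg)).add (LogSmooth.log_mul hg)).congr
    (g := fun s => (c + (Real.log s : ℝ)) * g s) fun s _ => by ring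

theorem contDiff_scaledJ (k : ℂ) (n : ℕ) : ContDiff ℝ 1 (scaledSum coeffJ (k ^ 2) n) :=
  contDiff_scaledSum factorialBound_coeffJ _ n

theorem contDiff_scaledY (k : ℂ) (n : ℕ) : ContDiff ℝ 1 (scaledSum coeffY (k ^ 2) n) :=
  contDiff_scaledSum factorialBound_coeffY _ n

theorem logSmooth_radialG (k : ℂ) : LogSmooth (radialG k) :=
  ((logSmooth_log_add_mul (contDiff_scaledJ k 0) (logTerm k)).add
    (LogSmooth.of_contDiff (contDiff_const.mul (contDiff_scaledY k 0)))).const_mul _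

theorem logSmooth_mul_radialG₁ (k : ℂ) : LogSmooth fun s => s * radialG₁ k s :=
  ((((logSmooth_log_add_mul (contDiff_scaledJ k 1) (logTerm k)).mul_left contDiff_ofReal_one).add
    (LogSmooth.of_contDiff ((contDiff_scaledJ k 0).add ((contDiff_const (c := (2 : ℂ))).mul
      (contDiff_ofReal_one.mul (contDiff_scaledY k 1)))))).const_mul
      (1 / (4 * (Real.pi : ℂ)))).congr fun s hs => by
    have hs' : (s : ℂ) ≠ 0 := by exact_mod_cast hs.ne'
    simp only [radialG₁]
    field_simp
    ring

/-- The difference quotient of `J` at the origin. -/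
def quotJ (k : ℂ) (s : ℝ) : ℂ := k ^ 2 * scaledSum (fun m => coeffJ (m + 1)) (k ^ 2) 0 s

theorem contDiff_quotJ (k : ℂ) : ContDiff ℝ 1 (quotJ k) :=
  contDiff_const.mul (contDiff_scaledSum factorialBound_coeffJ.shift _ 0)

theorem scaledJ_eq (k : ℂ) (s : ℝ) : scaledSum coeffJ (k ^ 2) 0 s = 1 + s * quotJ k s := by
  rw [quotJ, scaledSum, scaledSum]
  simp only [Function.iterate_zero, id, pow_zero, one_mul]
  rw [entireSum_eq_add_mul factorialBound_coeffJ]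
  simp only [coeffJ, pow_zero, Nat.factorial_zero, Nat.cast_one, one_pow, div_one]
  ring

/-- The pole `1 / s` of `F'` has a coefficient independent of the wave number, because `J₀(0) = 1`,
so it cancels in the difference and only a logarithm remains. -/
theorem logSmooth_radialG₁_sub (k l : ℂ) : LogSmooth fun s => radialG₁ k s - radialG₁ l s := by
  have h := fun k => ((logSmooth_log_add_mul (contDiff_scaledJ k 1) (logTerm k)).add
    (LogSmooth.of_contDiff ((contDiff_quotJ k).add
      (contDiff_const.mul (contDiff_scaledY k 1) (f := fun _ => (2 : ℂ)))))).const_mul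
      (1 / (4 * (Real.pi : ℂ)))
  refine ((h k).add ((h l).const_mul (-1))).congr fun s hs => ?_
  have hs' : (s : ℂ) ≠ 0 := by exact_mod_cast hs.ne'
  simp only [radialG₁, scaledJ_eq]
  field_simp
  ring

theorem logSmooth_mul_radialG₂_sub (k l : ℂ) :
    LogSmooth fun s => s * (radialG₂ k s - radialG₂ l s) := by
  have h := fun k =>
    (((logSmooth_log_add_mul (contDiff_scaledJ k 2) (logTerm k)).mul_left contDiff_ofReal_one).add
    (LogSmooth.of_contDiff ((((contDiff_const (c := (2 : ℂ))).mul (contDiff_scaledJ k 1)).sub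
      (contDiff_quotJ k)).add ((contDiff_const (c := (2 : ℂ))).mul
      (contDiff_ofReal_one.mul (contDiff_scaledY k 2)))))).const_mul
      (1 / (4 * (Real.pi : ℂ)))
  refine ((h k).add ((h l).const_mul (-1))).congr fun s hs => ?_
  have hs' : (s : ℂ) ≠ 0 := by exact_mod_cast hs.ne'
  simp only [radialG₂, scaledJ_eq]
  field_simp
  ring

theorem continuousOn_radialG (k : ℂ) : ContinuousOn (radialG k) (Set.Ioi 0) := fun _ hs =>
  (hasDerivAt_radialG k (ne_of_gt hs)).continuousAt.continuousWithinAt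

theorem continuousOn_radialG₁ (k : ℂ) : ContinuousOn (radialG₁ k) (Set.Ioi 0) := fun _ hs =>
  (hasDerivAt_radialG₁ k (ne_of_gt hs)).continuousAt.continuousWithinAt

theorem continuousOn_radialG₂ (k : ℂ) : ContinuousOn (radialG₂ k) (Set.Ioi 0) := fun _ hs =>
  (hasDerivAt_radialG₂ k (ne_of_gt hs)).continuousAt.continuousWithinAt

/-- The differentiated Helmholtz equation expresses the third derivative through lower ones, so no
fourth derivative is needed. -/
theorem continuousOn_radialG₃ (k : ℂ) : ContinuousOn (radialG₃ k) (Set.Ioi 0) := by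
  have h : ∀ s ∈ Set.Ioi (0 : ℝ), radialG₃ k s =
      -(8 * radialG₂ k s + k ^ 2 * radialG₁ k s) / (4 * s) := fun s hs => by
    have hs0 : s ≠ 0 := ne_of_gt hs
    have hs' : (s : ℂ) ≠ 0 := by exact_mod_cast hs0
    rw [eq_div_iff (by simpa using hs')]
    linear_combination radialG_ode_deriv k hs0
  refine ContinuousOn.congr ?_ h
  have h1 := continuousOn_radialG₁ k
  have h2 := continuousOn_radialG₂ k
  refine ContinuousOn.div (by fun_prop) (by fun_prop) fun s hs => ?_
  have hs' : (s : ℂ) ≠ 0 := by exact_mod_cast (ne_of_gt hs)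
  simpa using hs'

/-! ## The boundary integrals on the circle -/

/-- `S^k[1]` on the unit circle. -/
def singleValue (k : ℂ) : ℂ := ∫ θ, radialG k (chordSq θ) ∂angleMeasure

/-- `K^{k,*}[1]` on the unit circle. -/
def npValue (k : ℂ) : ℂ := ∫ θ, (chordSq θ : ℂ) * radialG₁ k (chordSq θ) ∂angleMeasure

/-- `ν · S^k[ν]` on the unit circle. -/
def singleNormalValue (k : ℂ) : ℂ :=
  ∫ θ, (1 - (chordSq θ : ℂ) / 2) * radialG k (chordSq θ) ∂angleMeasure

/-- The mean of `s (1 - s / 2) F'(s)` over the unit circle. -/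
def npNormalValue (k : ℂ) : ℂ :=
  ∫ θ, (chordSq θ : ℂ) * (1 - (chordSq θ : ℂ) / 2) * radialG₁ k (chordSq θ) ∂angleMeasure

theorem helmholtzS_circle {k : ℂ} (hk : k ≠ 0) (b : ℂ) (α : ℝ) :
    helmholtzS circleMeasure k (fun _ => b) (circlePoint α) = singleValue k * b := by
  rw [helmholtzS, integral_mul_const, singleValue]
  congr 1
  exact circle_integral_radial α (continuousOn_radialG k) fun y _ hy =>
    helmholtzG_eq hk (sub_ne_zero.2 hy.symm)

theorem hasPV_helmholtzKstar {k : ℂ} (hk : k ≠ 0) (b : ℂ) (α : ℝ) :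
    HasPV circleMeasure (circlePoint α)
      (helmholtzKstarIntegrand circleNormal k (fun _ => b) (circlePoint α)) (npValue k * b) := by
  rw [npValue, ← integral_mul_const]
  refine hasPV_radial α (a := fun s => s * radialG₁ k s * b) ?_ ?_
    ((logSmooth_mul_radialG₁ k).integrable.mul_const b)
  · have := continuousOn_radialG₁ k
    fun_prop
  · intro y hy hne
    have hg := (hasGrad_helmholtzG hk hne.symm).2
    obtain ⟨h1, h2, h3⟩ := circle_relations (norm_circlePoint α) hy rfl
    simp only [helmholtzKstarIntegrand, hg, Fin.sum_univ_two, circleNormal]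
    push_cast at h1 h2 h3 ⊢
    linear_combination (2 * radialG₁ k (‖circlePoint α - y‖ ^ 2) * b) * (h1 - h3)

theorem continuousOn_gammaDiag (lam mu : ℝ) (ω : ℂ) :
    ContinuousOn (gammaDiag lam mu ω) (Set.Ioi 0) := fun _ hs =>
  (hasDerivAt_gammaDiag lam mu ω (ne_of_gt hs)).continuousAt.continuousWithinAt

theorem continuousOn_gammaRank (lam mu : ℝ) (ω : ℂ) :
    ContinuousOn (gammaRank lam mu ω) (Set.Ioi 0) := fun _ hs =>
  (hasDerivAt_gammaRank lam mu ω (ne_of_gt hs)).continuousAt.continuousWithinAt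

theorem continuousOn_gammaDiag' (lam mu : ℝ) (ω : ℂ) :
    ContinuousOn (gammaDiag' lam mu ω) (Set.Ioi 0) :=
  ((continuousOn_radialG₁ _).const_mul _).add
    (((continuousOn_radialG₂ _).sub (continuousOn_radialG₂ _)).const_mul 2)

theorem continuousOn_gammaRank' (lam mu : ℝ) (ω : ℂ) :
    ContinuousOn (gammaRank' lam mu ω) (Set.Ioi 0) :=
  ((continuousOn_radialG₃ _).sub (continuousOn_radialG₃ _)).const_mul 4

theorem contDiff_one_sub_half : ContDiff ℝ 1 fun s : ℝ => (1 - (s : ℂ) / 2) :=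
  contDiff_const.sub (contDiff_ofReal_one.div_const 2)

theorem single_normal_integral {lam mu : ℝ} (hM : 0 < lam + 2 * mu) {ω : ℂ} (hω : ω ≠ 0) :
    Integrable (fun θ => singleCoeffX lam mu ω (chordSq θ) +
      singleCoeffY lam mu ω (chordSq θ) * (1 - chordSq θ / 2)) angleMeasure ∧
    ∫ θ, (singleCoeffX lam mu ω (chordSq θ) +
      singleCoeffY lam mu ω (chordSq θ) * (1 - chordSq θ / 2)) ∂angleMeasure =
      1 / ((lam + 2 * mu : ℝ) : ℂ) * singleNormalValue (waveNumberP lam mu ω) := by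
  have hae := ae_chordSq_pos.mono fun θ hθ =>
    single_normal_component (lam := lam) (mu := mu) hM hω hθ.ne'
  obtain ⟨ks, hks⟩ : ∃ ks, ks = waveNumberS mu ω := ⟨_, rfl⟩
  obtain ⟨kp, hkp⟩ : ∃ kp, kp = waveNumberP lam mu ω := ⟨_, rfl⟩
  rw [← hks, ← hkp] at hae
  rw [← hkp]
  obtain ⟨hi, h0⟩ := ((logSmooth_radialG₁_sub ks kp).const_mul (-2)).integral_arcDeriv
    (T' := fun s => -2 * (radialG₂ ks s - radialG₂ kp s)) fun s hs =>
      ((hasDerivAt_radialG₁ ks hs.ne').sub (hasDerivAt_radialG₁ kp hs.ne')).const_mul (-2)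
  have hP : Integrable (fun θ => (1 - (chordSq θ : ℂ) / 2) * radialG kp (chordSq θ)) angleMeasure :=
    ((logSmooth_radialG kp).mul_left contDiff_one_sub_half).integrable
  refine ⟨(integrable_congr hae).2 ((hi.const_mul _).add (hP.const_mul _)), ?_⟩
  rw [integral_congr_ae hae, integral_add (hi.const_mul _) (hP.const_mul _), integral_const_mul,
    integral_const_mul, h0, mul_zero, zero_add, singleNormalValue]

theorem traction_normal_integral {lam mu : ℝ} (hM : 0 < lam + 2 * mu) {ω : ℂ} (hω : ω ≠ 0) :
    Integrable (fun θ => tractionCoeffX lam mu ω (chordSq θ) +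
      tractionCoeffY lam mu ω (chordSq θ) * (1 - chordSq θ / 2)) angleMeasure ∧
    ∫ θ, (tractionCoeffX lam mu ω (chordSq θ) +
      tractionCoeffY lam mu ω (chordSq θ) * (1 - chordSq θ / 2)) ∂angleMeasure =
      1 / ((lam + 2 * mu : ℝ) : ℂ) * (2 * mu * npNormalValue (waveNumberP lam mu ω) -
        lam * npValue (waveNumberP lam mu ω)) := by
  have hae := ae_chordSq_pos.mono fun θ hθ =>
    traction_normal_component (lam := lam) (mu := mu) hM hω hθ.ne'
  obtain ⟨ks, hks⟩ : ∃ ks, ks = waveNumberS mu ω := ⟨_, rfl⟩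
  obtain ⟨kp, hkp⟩ : ∃ kp, kp = waveNumberP lam mu ω := ⟨_, rfl⟩
  rw [← hks, ← hkp] at hae
  rw [← hkp]
  have hid : ∀ s : ℝ, HasDerivAt (fun t : ℝ => (t : ℂ)) 1 s := fun s => by
    simpa using (hasDerivAt_id s).ofReal_comp
  obtain ⟨hi, h0⟩ := ((logSmooth_mul_radialG₂_sub ks kp).const_mul (-2)).congr
    (g := fun s => -2 * s * (radialG₂ ks s - radialG₂ kp s)) (fun s _ => by ring) |>.integral_arcDeriv
    (T' := fun s => -2 * (radialG₂ ks s - radialG₂ kp s) -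
      2 * s * (radialG₃ ks s - radialG₃ kp s)) fun s hs =>
      ((((hid s).const_mul (-2)).mul ((hasDerivAt_radialG₂ ks hs.ne').sub
        (hasDerivAt_radialG₂ kp hs.ne')))).congr_deriv (by simp only [Pi.sub_apply]; ring)
  have hX : Integrable (fun θ => (chordSq θ : ℂ) * radialG₁ kp (chordSq θ)) angleMeasure :=
    (logSmooth_mul_radialG₁ kp).integrable
  have hY : Integrable (fun θ => (chordSq θ : ℂ) * (1 - (chordSq θ : ℂ) / 2) *
      radialG₁ kp (chordSq θ)) angleMeasure :=
    ((logSmooth_mul_radialG₁ kp).mul_left contDiff_one_sub_half).congr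
      (g := fun s => (s : ℂ) * (1 - (s : ℂ) / 2) * radialG₁ kp s) (fun s _ => by ring) |>.integrable
  have hXY := (hY.const_mul (2 * mu : ℂ)).sub (hX.const_mul (lam : ℂ))
  refine ⟨(integrable_congr hae).2 ((hi.const_mul _).add (hXY.const_mul _)), ?_⟩
  rw [integral_congr_ae hae]
  refine (integral_add (hi.const_mul _) (hXY.const_mul _)).trans ?_
  rw [integral_const_mul, integral_const_mul, h0, mul_zero, zero_add]
  congr 1
  refine (integral_sub (hY.const_mul _) (hX.const_mul _)).trans ?_
  rw [integral_const_mul, integral_const_mul, npNormalValue, npValue]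

theorem integrable_singleCoeffY {lam mu : ℝ} {ω : ℂ} :
    Integrable (fun θ => singleCoeffY lam mu ω (chordSq θ)) angleMeasure := by
  set ks := waveNumberS mu ω with hks
  set kp := waveNumberP lam mu ω with hkp
  refine LogSmooth.integrable (f := fun s => singleCoeffY lam mu ω s) ?_
  refine (((((logSmooth_radialG ks).const_mul (ks ^ 2)).add
    ((logSmooth_radialG₁_sub ks kp).const_mul 2)).add
    ((logSmooth_mul_radialG₂_sub ks kp).const_mul 2)).const_mul (1 / ω ^ 2)).congr fun s _ => ?_
  rw [singleCoeffY, gammaDiag, gammaRank]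
  ring

theorem lameS_circle {lam mu : ℝ} (hmu : 0 < mu) (hM : 0 < lam + 2 * mu) {ω : ℂ} (hω : ω ≠ 0)
    (b : ℂ) (α : ℝ) (i : Fin 2) :
    lameS circleMeasure lam mu ω (normalDensity b) (circlePoint α) i =
      b * (1 / ((lam + 2 * mu : ℝ) : ℂ) * singleNormalValue (waveNumberP lam mu ω)) *
        (circlePoint α i : ℂ) := by
  have hD := continuousOn_gammaDiag lam mu ω
  have hR := continuousOn_gammaRank lam mu ω
  obtain ⟨hi, hv⟩ := single_normal_integral (lam := lam) (mu := mu) hM hω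
  have h := circle_setIntegral_isotropic α
    (f := lameSIntegrand lam mu ω (normalDensity b) (circlePoint α))
    (a := fun s => b * singleCoeffX lam mu ω s) (c := fun s => b * singleCoeffY lam mu ω s)
    (by unfold singleCoeffX; fun_prop) (by unfold singleCoeffY; fun_prop)
    (fun y hy hne i => by
      rw [lameSIntegrand_circle hmu hM hω b (norm_circlePoint α) hy hne.symm]; ring)
    MeasurableSet.univ MeasurableSet.univ (by simp)
    ((hi.const_mul b).congr (ae_of_all _ fun θ => by ring)).integrableOn
    (integrable_singleCoeffY.const_mul b).integrableOn i
  rw [Set.preimage_univ, setIntegral_univ, setIntegral_univ] at h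
  rw [lameS, h, ← hv, ← integral_const_mul]
  congr 2
  funext θ
  ring

theorem hasPV_lameKstar {lam mu : ℝ} (hmu : 0 < mu) (hM : 0 < lam + 2 * mu) {ω : ℂ} (hω : ω ≠ 0)
    (b : ℂ) (α : ℝ) :
    HasPV circleMeasure (circlePoint α)
      (lameKstarIntegrand circleNormal lam mu ω (normalDensity b) (circlePoint α))
      (WithLp.toLp 2 fun i => b * (1 / ((lam + 2 * mu : ℝ) : ℂ) *
        (2 * mu * npNormalValue (waveNumberP lam mu ω) - lam * npValue (waveNumberP lam mu ω))) *
        (circlePoint α i : ℂ)) := by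
  have hD := continuousOn_gammaDiag' lam mu ω
  have hR := continuousOn_gammaRank lam mu ω
  have hR' := continuousOn_gammaRank' lam mu ω
  obtain ⟨hi, hv⟩ := traction_normal_integral (lam := lam) (mu := mu) hM hω
  have h := hasPV_isotropic α
    (f := lameKstarIntegrand circleNormal lam mu ω (normalDensity b) (circlePoint α))
    (a := fun s => b * tractionCoeffX lam mu ω s) (c := fun s => b * tractionCoeffY lam mu ω s)
    (by unfold tractionCoeffX; fun_prop) (by unfold tractionCoeffY; fun_prop)
    (fun y hy hne i => by
      rw [lameKstarIntegrand_circle hmu hM hω b (norm_circlePoint α) hy hne.symm]; ring)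
    ((hi.const_mul b).congr (ae_of_all _ fun θ => by ring))
  have hI : ∫ θ, (b * tractionCoeffX lam mu ω (chordSq θ) +
      b * tractionCoeffY lam mu ω (chordSq θ) * (1 - chordSq θ / 2)) ∂angleMeasure =
      b * (1 / ((lam + 2 * mu : ℝ) : ℂ) * (2 * mu * npNormalValue (waveNumberP lam mu ω) -
        lam * npValue (waveNumberP lam mu ω))) := by
    rw [← hv, ← integral_const_mul]
    congr 1
    funext θ
    ring
  rw [hI] at h
  exact h

/-! ### Reduction of radial resonance to a two by two determinant -/

theorem hasPV_unique {E : Type*} [NormedAddCommGroup E] [NormedSpace ℝ E] {σ : Measure Plane}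
    {x : Plane} {f : Plane → E} {v w : E} (hv : HasPV σ x f v) (hw : HasPV σ x f w) : v = w :=
  tendsto_nhds_unique hv hw

theorem exists_circlePoint_of_ae {p : Plane → Prop} (h : ∀ᵐ x ∂circleMeasure, p x) :
    ∃ α, p (circlePoint α) := by
  rw [circleMeasure_eq 0] at h
  have h1 := ae_of_ae_map
    (continuous_circlePoint.measurable.comp (measurable_const_add 0)).aemeasurable h
  have : NeBot (ae angleMeasure) := by
    rw [ae_neBot]
    intro h0
    apply circleMeasure_ne_zero
    rw [circleMeasure_eq 0, h0, Measure.map_zero]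
  obtain ⟨θ, hθ⟩ := h1.exists
  exact ⟨_, hθ⟩

theorem exists_circlePoint_coord_ne_zero (α : ℝ) : ∃ i, (circlePoint α i : ℂ) ≠ 0 := by
  by_contra! h
  have h0 := h 0
  have h1 := h 1
  have := (circle_relations (norm_circlePoint α) (norm_circlePoint α) rfl).1
  rw [h0, h1] at this
  simp at this

theorem continuous_normalDensity (b : ℂ) : Continuous (normalDensity b) := by
  unfold normalDensity circleNormal
  refine (PiLp.continuous_toLp 2 _).comp (continuous_pi fun i => ?_)
  exact continuous_const.mul (continuous_ofReal_coord i)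

theorem memLp_normalDensity (b : ℂ) : MemLp (normalDensity b) 2 circleMeasure := by
  refine MemLp.of_bound (continuous_normalDensity b).aestronglyMeasurable ‖b‖ ?_
  refine ae_circleMeasure 0 fun θ _ => ?_
  have h : ‖normalDensity b (circlePoint (0 + θ))‖ ^ 2 = ‖b‖ ^ 2 := by
    rw [EuclideanSpace.norm_sq_eq, Fin.sum_univ_two]
    have h2 := normSq_plane (circlePoint (0 + θ))
    rw [norm_circlePoint] at h2
    simp only [normalDensity, circleNormal, norm_mul, Complex.norm_real, mul_pow,
      Real.norm_eq_abs, sq_abs]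
    rw [← mul_add, ← h2]; ring
  exact ((sq_eq_sq₀ (norm_nonneg _) (norm_nonneg _)).1 h).le

/-- Radial resonance is the singularity of a two by two matrix. -/
theorem radialResonanceAt_iff {lam mu τ δ : ℝ} (hmu : 0 < mu) (hM : 0 < lam + 2 * mu) (hτ : 0 < τ)
    {k : ℂ} (hk : k ≠ 0) :
    RadialResonanceAt lam mu τ δ k ↔ ∃ b₁ b₂ : ℂ, ¬ (b₁ = 0 ∧ b₂ = 0) ∧
      1 / k ^ 2 * (-(1 / 2) + npValue k) * b₁ - 1 / ((lam + 2 * mu : ℝ) : ℂ) *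
        singleNormalValue (waveNumberP lam mu (k * τ)) * b₂ = 0 ∧
      (δ : ℂ) * (τ : ℂ) ^ 2 * singleValue k * b₁ + (1 / 2 + 1 / ((lam + 2 * mu : ℝ) : ℂ) *
        (2 * mu * npNormalValue (waveNumberP lam mu (k * τ)) -
          lam * npValue (waveNumberP lam mu (k * τ)))) * b₂ = 0 := by
  have hω : k * τ ≠ 0 := mul_ne_zero hk (by exact_mod_cast hτ.ne')
  have hsq : ∀ α, ∑ i, ((circlePoint α i : ℝ) : ℂ) * ((circlePoint α i : ℝ) : ℂ) = 1 := fun α => by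
    have := (circle_relations (norm_circlePoint α) (norm_circlePoint α) rfl).1
    rw [Fin.sum_univ_two]
    linear_combination this
  have hsum : ∀ α b₂, ∑ i, ((circleNormal (circlePoint α) i : ℝ) : ℂ) *
      lameS circleMeasure lam mu (k * τ) (normalDensity b₂) (circlePoint α) i =
      b₂ * (1 / ((lam + 2 * mu : ℝ) : ℂ) * singleNormalValue (waveNumberP lam mu (k * τ))) :=
    fun α b₂ => by
      simp only [lameS_circle hmu hM hω, circleNormal]
      refine Eq.trans ?_ ((congrArg _ (hsq α)).trans (mul_one _))
      rw [Finset.mul_sum]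
      exact Finset.sum_congr rfl fun i _ => by ring
  constructor
  · rintro ⟨b₁, b₂, -, -, hne, him⟩
    refine ⟨b₁, b₂, fun h => hne ?_, ?_⟩
    · obtain ⟨rfl, rfl⟩ := h
      refine ⟨ae_of_all _ fun x => rfl, ae_of_all _ fun x => ?_⟩
      ext i
      simp [normalDensity]
    -- One generic point suffices: both components of the image are constants times `1` and `ν`, and
    -- principal values are unique.
    · obtain ⟨α, a, b, ha, hb, h1, h2⟩ := exists_circlePoint_of_ae him
      rw [hasPV_unique ha (hasPV_helmholtzKstar hk b₁ α), hsum] at h1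
      rw [hasPV_unique hb (hasPV_lameKstar hmu hM hω b₂ α)] at h2
      simp only [Pi.zero_apply] at h1
      obtain ⟨i, hi⟩ := exists_circlePoint_coord_ne_zero α
      have h2 := h2 i
      rw [helmholtzS_circle hk] at h2
      simp only [Pi.zero_apply, PiLp.zero_apply, normalDensity, circleNormal] at h2
      refine ⟨by linear_combination -h1, mul_right_cancel₀ hi ?_⟩
      linear_combination -h2
  · rintro ⟨b₁, b₂, hne, h1, h2⟩
    refine ⟨b₁, b₂, memLp_const b₁, memLp_normalDensity b₂, fun h => hne ?_, ?_⟩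
    · obtain ⟨α, hα1, hα2⟩ := exists_circlePoint_of_ae (h.1.and h.2)
      refine ⟨hα1, ?_⟩
      obtain ⟨i, hi⟩ := exists_circlePoint_coord_ne_zero α
      have h3 := congrArg (fun v : CVec => v i) hα2
      simp only [Pi.zero_apply, PiLp.zero_apply, normalDensity, circleNormal] at h3
      exact (mul_eq_zero.1 h3).resolve_right hi
    · refine ae_circleMeasure 0 fun θ _ => ?_
      refine ⟨_, _, hasPV_helmholtzKstar hk b₁ _, hasPV_lameKstar hmu hM hω b₂ _, ?_, fun i => ?_⟩
      · rw [hsum, Pi.zero_apply]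
        linear_combination -h1
      · rw [helmholtzS_circle hk]
        simp only [Pi.zero_apply, PiLp.zero_apply, normalDensity, circleNormal]
        linear_combination -(circlePoint (0 + θ) i : ℂ) * h2

/-- The characteristic equation of radial resonances. -/
theorem radialResonanceAt_iff_det {lam mu τ δ : ℝ} (hmu : 0 < mu) (hM : 0 < lam + 2 * mu)
    (hτ : 0 < τ) {k : ℂ} (hk : k ≠ 0) :
    RadialResonanceAt lam mu τ δ k ↔
      1 / k ^ 2 * (-(1 / 2) + npValue k) * (1 / 2 + 1 / ((lam + 2 * mu : ℝ) : ℂ) *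
        (2 * mu * npNormalValue (waveNumberP lam mu (k * τ)) -
          lam * npValue (waveNumberP lam mu (k * τ)))) +
      (δ : ℂ) * (τ : ℂ) ^ 2 * singleValue k * (1 / ((lam + 2 * mu : ℝ) : ℂ) *
        singleNormalValue (waveNumberP lam mu (k * τ))) = 0 := by
  rw [radialResonanceAt_iff hmu hM hτ hk]
  generalize 1 / k ^ 2 * (-(1 / 2) + npValue k) = A
  generalize 1 / ((lam + 2 * mu : ℝ) : ℂ) * singleNormalValue (waveNumberP lam mu (k * τ)) = B
  generalize (δ : ℂ) * (τ : ℂ) ^ 2 * singleValue k = C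
  generalize 1 / 2 + 1 / ((lam + 2 * mu : ℝ) : ℂ) *
    (2 * mu * npNormalValue (waveNumberP lam mu (k * τ)) -
      lam * npValue (waveNumberP lam mu (k * τ))) = D
  constructor
  · rintro ⟨b₁, b₂, hne, h1, h2⟩
    by_contra hdet
    refine hne ⟨?_, ?_⟩
    · refine (mul_eq_zero.1 (?_ : (A * D + C * B) * b₁ = 0)).resolve_left hdet
      linear_combination D * h1 + B * h2
    · refine (mul_eq_zero.1 (?_ : (A * D + C * B) * b₂ = 0)).resolve_left hdet
      linear_combination A * h2 - C * h1
  · intro hdet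
    -- The matrix has rows `(A, -B)` and `(C, D)`. The vector `(B, A)` kills the first row and gives
    -- the determinant in the second. If the first row vanishes, a kernel vector of the second row
    -- is taken.
    by_cases hz : A = 0 ∧ B = 0
    · obtain ⟨rfl, rfl⟩ := hz
      by_cases hz' : C = 0
      · exact ⟨1, 0, by simp, by simp, by simp [hz']⟩
      · exact ⟨-D, C, by simp [hz'], by simp, by ring⟩
    · exact ⟨B, A, fun h => hz ⟨h.2, h.1⟩, by ring, by linear_combination hdet⟩


/-! ## Low frequency expansions of the boundary integrals -/

/-- Moments of a weight on the circle in the squared chord. -/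
def chordMoment (w : ℝ → ℂ) (m : ℕ) : ℂ := ∫ θ, w θ * (chordSq θ : ℂ) ^ m ∂angleMeasure

/-- Coefficients of the factor of the logarithm. -/
def logCoeff (w : ℝ → ℂ) (c : ℕ → ℂ) (m : ℕ) : ℂ :=
  1 / (4 * (Real.pi : ℂ)) * (c m * chordMoment w m)

/-- Coefficients of the part without logarithm. -/
def regCoeff (w : ℝ → ℂ) (c d : ℕ → ℂ) (m : ℕ) : ℂ :=
  1 / (4 * (Real.pi : ℂ)) * (c m * chordMoment (fun θ => (Real.log (chordSq θ) : ℝ) * w θ) m +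
    d m * chordMoment w m)

theorem integrable_log_mul_weight {w : ℝ → ℂ} (hw : Continuous w) :
    Integrable (fun θ => ((Real.log (chordSq θ) : ℝ) : ℂ) * w θ) angleMeasure := by
  obtain ⟨C, hC⟩ := (isCompact_Icc (a := -Real.pi) (b := Real.pi)).exists_bound_of_continuousOn
    hw.continuousOn
  refine integrable_log_chordSq.mul_bdd (c := C) hw.aestronglyMeasurable ?_
  refine (ae_restrict_mem measurableSet_Ioc).mono fun θ hθ => hC θ ⟨hθ.1.le, hθ.2⟩

theorem factorialBound_logCoeff {w : ℝ → ℂ} (hw : Continuous w) {c : ℕ → ℂ}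
    (hc : FactorialBound c) : FactorialBound (logCoeff w c) :=
  (hc.mul_moment (integrable_of_continuous hw) (by norm_num) abs_chordSq_le).const_mul _

theorem factorialBound_regCoeff {w : ℝ → ℂ} (hw : Continuous w) {c d : ℕ → ℂ}
    (hc : FactorialBound c) (hd : FactorialBound d) : FactorialBound (regCoeff w c d) :=
  ((hc.mul_moment (integrable_log_mul_weight hw) (by norm_num) abs_chordSq_le).add
    (hd.mul_moment (integrable_of_continuous hw) (by norm_num) abs_chordSq_le)).const_mul _

/-- Termwise integration of the series. The term `l`, later `γ + 2 log k`, does not depend on the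
angle, so each boundary integral is affine in it, with coefficients entire in `u = k²`. -/
theorem integral_log_profile {w : ℝ → ℂ} (hw : Continuous w) {c d : ℕ → ℂ}
    (hc : FactorialBound c) (hd : FactorialBound d) (l u : ℂ) {f : ℝ → ℂ}
    (hf : ∀ θ, 0 < chordSq θ → f θ = w θ * (1 / (4 * (Real.pi : ℂ)) *
      ((l + (Real.log (chordSq θ) : ℝ)) * entireSum c (u * chordSq θ) +
        entireSum d (u * chordSq θ)))) :
    ∫ θ, f θ ∂angleMeasure =
      l * entireSum (logCoeff w c) u + entireSum (regCoeff w c d) u := by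
  have hwi := integrable_of_continuous hw
  have hli := integrable_log_mul_weight hw
  have hs := continuous_chordSq.measurable
  obtain ⟨i1, e1⟩ := integral_weight_mul_entireSum hc hwi hs abs_chordSq_le u
  obtain ⟨i2, e2⟩ := integral_weight_mul_entireSum hc hli hs abs_chordSq_le u
  obtain ⟨i3, e3⟩ := integral_weight_mul_entireSum hd hwi hs abs_chordSq_le u
  have hae : f =ᵐ[angleMeasure] fun θ => 1 / (4 * (Real.pi : ℂ)) *
      (l * (w θ * entireSum c (u * chordSq θ)) +
        ((Real.log (chordSq θ) : ℝ) * w θ * entireSum c (u * chordSq θ) +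
        w θ * entireSum d (u * chordSq θ))) := by
    filter_upwards [ae_chordSq_pos] with θ hθ
    rw [hf θ hθ]; ring
  have hm2 := hc.mul_moment hli (by norm_num) abs_chordSq_le
  have hm3 := hd.mul_moment hwi (by norm_num) abs_chordSq_le
  have i23 : Integrable (fun θ => (Real.log (chordSq θ) : ℝ) * w θ * entireSum c (u * chordSq θ) +
        w θ * entireSum d (u * chordSq θ)) angleMeasure := i2.add i3
  rw [integral_congr_ae hae, integral_const_mul, integral_add (i1.const_mul l) i23,
    integral_add i2 i3, integral_const_mul, e1, e2, e3, ← entireSum_add hm2 hm3]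
  unfold logCoeff regCoeff chordMoment
  rw [entireSum_const_mul, entireSum_const_mul]
  ring

theorem radialG_eq_entire (k : ℂ) (s : ℝ) :
    radialG k s = 1 / (4 * (Real.pi : ℂ)) * ((logTerm k + (Real.log s : ℝ)) *
      entireSum coeffJ (k ^ 2 * s) + entireSum (fun m => 2 * coeffY m) (k ^ 2 * s)) := by
  rw [radialG, scaledSum, scaledSum, entireSum_const_mul]
  simp

/-- Coefficients of the part of `s F'(s)` without logarithm. -/
def eulerCoeff (m : ℕ) : ℂ := coeffJ m + 2 * ((m : ℂ) * coeffY m)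

theorem factorialBound_eulerCoeff : FactorialBound eulerCoeff :=
  factorialBound_coeffJ.add (factorialBound_coeffY.natCast_mul.const_mul 2)

theorem mul_radialG₁_eq_entire (k : ℂ) {s : ℝ} (hs : s ≠ 0) :
    s * radialG₁ k s = 1 / (4 * (Real.pi : ℂ)) * ((logTerm k + (Real.log s : ℝ)) *
      entireSum (fun m => (m : ℂ) * coeffJ m) (k ^ 2 * s) + entireSum eulerCoeff (k ^ 2 * s)) := by
  have hs' : (s : ℂ) ≠ 0 := by exact_mod_cast hs
  have e : entireSum eulerCoeff (k ^ 2 * s) = entireSum coeffJ (k ^ 2 * s) +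
      2 * entireSum (fun m => (m : ℂ) * coeffY m) (k ^ 2 * s) := by
    rw [← entireSum_const_mul]
    exact entireSum_add factorialBound_coeffJ (factorialBound_coeffY.natCast_mul.const_mul 2) _
  rw [e, ← mul_entireSum_derivCoeff factorialBound_coeffJ,
    ← mul_entireSum_derivCoeff factorialBound_coeffY, radialG₁, scaledSum, scaledSum, scaledSum]
  simp only [Function.iterate_succ, Function.iterate_zero, Function.comp, id]
  field_simp
  ring

/-! ### Lowest coefficients and moments, and the resulting expansions -/

theorem coeffJ_zero : coeffJ 0 = 1 := by simp [coeffJ]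

theorem coeffJ_one : coeffJ 1 = -1 / 4 := by simp [coeffJ]

theorem coeffY_zero : coeffY 0 = 0 := by simp [coeffY]

theorem coeffY_one : coeffY 1 = 1 / 4 := by
  simp [coeffY, coeffJ_one, harmonic]; ring

theorem integrable_chordSq : Integrable (fun θ => (chordSq θ : ℂ)) angleMeasure :=
  integrable_of_continuous (Complex.continuous_ofReal.comp continuous_chordSq)

theorem integral_affine_chordSq (a b : ℂ) :
    ∫ θ, (a + b * (chordSq θ : ℂ)) ∂angleMeasure = a * (2 * Real.pi) + b * (4 * Real.pi) := by
  have h1 : ∫ _, a ∂angleMeasure = a * (2 * Real.pi) := by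
    rw [← integral_one_angle, ← integral_const_mul, mul_one]
  rw [integral_add (integrable_const a) (integrable_chordSq.const_mul b), integral_const_mul,
    integral_chordSq, h1]

theorem integral_log_affine_chordSq (a b : ℂ) :
    ∫ θ, (Real.log (chordSq θ) : ℝ) * (a + b * (chordSq θ : ℂ)) ∂angleMeasure =
      b * (4 * Real.pi) := by
  have h1 : Integrable (fun θ => (chordSq θ : ℂ) * (Real.log (chordSq θ) : ℝ)) angleMeasure := by
    simpa [mul_comm] using integrable_log_mul (v := fun s => (s : ℂ)) (by fun_prop)
  have e : (fun θ => ((Real.log (chordSq θ) : ℝ) : ℂ) * (a + b * (chordSq θ : ℂ))) =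
      fun θ => a * ((Real.log (chordSq θ) : ℝ) : ℂ) +
        b * ((chordSq θ : ℂ) * (Real.log (chordSq θ) : ℝ)) := by funext θ; ring
  rw [e, integral_add (integrable_log_chordSq.const_mul a) (h1.const_mul b), integral_const_mul,
    integral_const_mul, integral_log_chordSq, integral_chordSq_mul_log]
  ring

theorem chordMoment_affine_zero (a b : ℂ) :
    chordMoment (fun θ => a + b * (chordSq θ : ℂ)) 0 = a * (2 * Real.pi) + b * (4 * Real.pi) := by
  simp only [chordMoment, pow_zero, mul_one, integral_affine_chordSq]

theorem chordMoment_log_affine_zero (a b : ℂ) :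
    chordMoment (fun θ => (Real.log (chordSq θ) : ℝ) * (a + b * (chordSq θ : ℂ))) 0 =
      b * (4 * Real.pi) := by
  simp only [chordMoment, pow_zero, mul_one, integral_log_affine_chordSq]

theorem chordMoment_const_one (a : ℂ) :
    chordMoment (fun θ => a + 0 * (chordSq θ : ℂ)) 1 = a * (4 * Real.pi) := by
  have := integral_affine_chordSq 0 a
  simp only [chordMoment, pow_one, zero_mul, add_zero, zero_add] at this ⊢
  exact this

theorem chordMoment_log_const_one (a : ℂ) :
    chordMoment (fun θ => (Real.log (chordSq θ) : ℝ) * (a + 0 * (chordSq θ : ℂ))) 1 =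
      a * (4 * Real.pi) := by
  have := integral_log_affine_chordSq 0 a
  simp only [chordMoment, pow_one, zero_mul, add_zero, zero_add] at this ⊢
  rw [← this]
  congr 1
  funext θ
  ring

theorem continuous_affine_chordSq (a b : ℂ) : Continuous fun θ => a + b * (chordSq θ : ℂ) :=
  continuous_const.add (continuous_const.mul (Complex.continuous_ofReal.comp continuous_chordSq))

/-- Expansion with a logarithm, to first order. -/
theorem exists_expansion {a b : ℕ → ℂ} (ha : FactorialBound a) (hb : FactorialBound b) :
    ∃ f g : ℂ → ℂ, Differentiable ℂ f ∧ Differentiable ℂ g ∧ ∀ l u, l * entireSum a u + entireSum b u =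
      l * (a 0 + u * f u) + (b 0 + u * g u) :=
  ⟨_, _, differentiable_entireSum ha.shift, differentiable_entireSum hb.shift, fun l u => by
    rw [entireSum_eq_add_mul ha, entireSum_eq_add_mul hb]⟩

theorem pi_ne_zero_complex : (Real.pi : ℂ) ≠ 0 := by exact_mod_cast Real.pi_ne_zero

/-- No constant accompanies the logarithm, since the mean of `log s` and `coeffY 0` both vanish.
This makes later quotients by `γ + 2 log k` exact up to order `k²`, not merely up to the inverse
logarithm. -/
theorem singleValue_expansion : ∃ f g : ℂ → ℂ, Differentiable ℂ f ∧ Differentiable ℂ g ∧ ∀ k,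
    singleValue k = logTerm k * (1 / 2 + k ^ 2 * f (k ^ 2)) + k ^ 2 * g (k ^ 2) := by
  have hw := continuous_affine_chordSq 1 0
  have hd := factorialBound_coeffY.const_mul 2
  obtain ⟨f, g, hf, hg, h⟩ := exists_expansion (factorialBound_logCoeff hw factorialBound_coeffJ)
    (factorialBound_regCoeff hw factorialBound_coeffJ hd)
  refine ⟨f, g, hf, hg, fun k => ?_⟩
  rw [singleValue, integral_log_profile hw factorialBound_coeffJ hd (logTerm k) (k ^ 2)
    fun θ _ => by rw [radialG_eq_entire]; ring, h, logCoeff, regCoeff, chordMoment_affine_zero,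
    chordMoment_log_affine_zero, coeffJ_zero, coeffY_zero]
  have := pi_ne_zero_complex
  field_simp
  ring

/-- The weight `1 - s/2 = cos θ` has mean zero, which removes the leading logarithm; the constant
`-1/2` comes from the integral of `s log s`. -/
theorem singleNormalValue_expansion : ∃ f g : ℂ → ℂ, Differentiable ℂ f ∧ Differentiable ℂ g ∧ ∀ k,
    singleNormalValue k = -1 / 2 + logTerm k * (k ^ 2 * f (k ^ 2)) + k ^ 2 * g (k ^ 2) := by
  have hw := continuous_affine_chordSq 1 (-1 / 2)
  have hd := factorialBound_coeffY.const_mul 2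
  obtain ⟨f, g, hf, hg, h⟩ := exists_expansion (factorialBound_logCoeff hw factorialBound_coeffJ)
    (factorialBound_regCoeff hw factorialBound_coeffJ hd)
  refine ⟨f, g, hf, hg, fun k => ?_⟩
  rw [singleNormalValue, integral_log_profile hw factorialBound_coeffJ hd (logTerm k) (k ^ 2)
    fun θ _ => by rw [radialG_eq_entire]; ring, h, logCoeff, regCoeff, chordMoment_affine_zero,
    chordMoment_log_affine_zero, coeffJ_zero, coeffY_zero]
  have := pi_ne_zero_complex
  field_simp
  ring

/-- After `λ = (λ + 2μ) - 2μ` is substituted in the traction entry, the coefficient of `μ` is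
exactly this sum, whose weight is `2 - s/2`. -/
theorem npValue_add_expansion : ∃ f g : ℂ → ℂ, Differentiable ℂ f ∧ Differentiable ℂ g ∧ ∀ k,
    npValue k + npNormalValue k =
      1 / 2 + logTerm k * (k ^ 2 * f (k ^ 2)) + k ^ 2 * g (k ^ 2) := by
  have hw := continuous_affine_chordSq 2 (-1 / 2)
  have hJ := factorialBound_coeffJ.natCast_mul
  have hd := factorialBound_eulerCoeff
  obtain ⟨f, g, hf, hg, h⟩ := exists_expansion (factorialBound_logCoeff hw hJ)
    (factorialBound_regCoeff hw hJ hd)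
  refine ⟨f, g, hf, hg, fun k => ?_⟩
  have hX : Integrable (fun θ => (chordSq θ : ℂ) * radialG₁ k (chordSq θ)) angleMeasure :=
    (logSmooth_mul_radialG₁ k).integrable
  have hY : Integrable (fun θ => (chordSq θ : ℂ) * (1 - (chordSq θ : ℂ) / 2) *
      radialG₁ k (chordSq θ)) angleMeasure :=
    ((logSmooth_mul_radialG₁ k).mul_left contDiff_one_sub_half).congr
      (g := fun s => (s : ℂ) * (1 - (s : ℂ) / 2) * radialG₁ k s) (fun s _ => by ring) |>.integrable
  rw [npValue, npNormalValue, ← integral_add hX hY,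
    integral_log_profile hw hJ hd (logTerm k) (k ^ 2) fun θ hθ => by
      rw [← mul_radialG₁_eq_entire k hθ.ne']; ring, h, logCoeff, regCoeff,
    chordMoment_affine_zero, eulerCoeff, coeffJ_zero, coeffY_zero]
  have := pi_ne_zero_complex
  push_cast
  field_simp
  ring

theorem npValue_expansion : ∃ f g : ℂ → ℂ, Differentiable ℂ f ∧ Differentiable ℂ g ∧ ∀ k,
    -(1 / 2) + npValue k =
      k ^ 2 * (logTerm k * (-1 / 4 + k ^ 2 * f (k ^ 2)) + k ^ 2 * g (k ^ 2)) := by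
  have hw := continuous_affine_chordSq 1 0
  have hJ := factorialBound_coeffJ.natCast_mul
  have hd := factorialBound_eulerCoeff
  have ha := factorialBound_logCoeff hw hJ
  have hb := factorialBound_regCoeff hw hJ hd
  refine ⟨_, _, differentiable_entireSum ha.shift.shift, differentiable_entireSum hb.shift.shift,
    fun k => ?_⟩
  have hp := pi_ne_zero_complex
  have ha1 : logCoeff (fun θ => 1 + 0 * (chordSq θ : ℂ)) (fun m => (m : ℂ) * coeffJ m) 1 =
      -1 / 4 := by
    rw [logCoeff, chordMoment_const_one, coeffJ_one]
    push_cast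
    field_simp
  -- The order `k²` term without logarithm cancels exactly, so the bracket is `-(γ + 2 log k)/4`
  -- with no constant beside it. The constant `1/2` of order zero cancels against `-(1/2)`.
  have hb1 : regCoeff (fun θ => 1 + 0 * (chordSq θ : ℂ)) (fun m => (m : ℂ) * coeffJ m) eulerCoeff 1 =
      0 := by
    rw [regCoeff, chordMoment_const_one, chordMoment_log_const_one, eulerCoeff, coeffJ_one,
      coeffY_one]
    push_cast
    field_simp
    ring
  rw [npValue, integral_log_profile hw hJ hd (logTerm k) (k ^ 2) fun θ hθ => by
      rw [← mul_radialG₁_eq_entire k hθ.ne']; ring, entireSum_eq_add_mul ha,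
    entireSum_eq_add_mul ha.shift, entireSum_eq_add_mul hb, entireSum_eq_add_mul hb.shift]
  simp only [zero_add]
  rw [ha1, hb1]
  rw [logCoeff, regCoeff, chordMoment_affine_zero, eulerCoeff, coeffJ_zero, coeffY_zero]
  push_cast
  field_simp
  ring


/-! ## Roots of perturbations of `z² (γ + 2 log z)` -/

/-- Without a root, `1 / (h - 1)` would be analytic on the disk. On the boundary `|t² - 1| = η |t +
1| ≥ 3η/2`, so its modulus is at most `1/η` there, but at the centre it exceeds `2/η`. This
contradicts the maximum principle. -/
theorem exists_eq_one_of_near_sq {η κ : ℝ} (hη : 0 < η) (hη' : η ≤ 1 / 2) (hκ : κ < η / 2)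
    {h : ℂ → ℂ} (hd : DifferentiableOn ℂ h (Metric.closedBall 1 η))
    (hb : ∀ t ∈ Metric.closedBall (1 : ℂ) η, ‖h t - t ^ 2‖ ≤ κ) :
    ∃ t ∈ Metric.closedBall (1 : ℂ) η, h t = 1 := by
  by_contra! hne
  have hne' : ∀ t ∈ Metric.closedBall (1 : ℂ) η, h t - 1 ≠ 0 := fun t ht => sub_ne_zero.2 (hne t ht)
  have hdc : DiffContOnCl ℂ (fun t => (h t - 1)⁻¹) (Metric.ball 1 η) :=
    ((hd.sub_const 1).inv hne').diffContOnCl_ball subset_rfl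
  have hfr : ∀ t ∈ frontier (Metric.ball (1 : ℂ) η), ‖(h t - 1)⁻¹‖ ≤ (η)⁻¹ := by
    intro t ht
    rw [frontier_ball _ hη.ne'] at ht
    have ht1 : ‖t - 1‖ = η := by simpa [dist_eq_norm] using ht
    have h1 := hb t (Metric.sphere_subset_closedBall ht)
    have h2 : 2 - η ≤ ‖t + 1‖ := by
      have : ‖(2 : ℂ)‖ ≤ ‖t + 1‖ + ‖t - 1‖ := by
        have := norm_sub_le (t + 1) (t - 1)
        rwa [show t + 1 - (t - 1) = 2 by ring] at this
      rw [ht1] at this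
      simp at this
      linarith
    have h3 : ‖t ^ 2 - 1‖ = η * ‖t + 1‖ := by
      rw [← ht1, ← norm_mul]; congr 1; ring
    have h4 : ‖t ^ 2 - 1‖ ≤ ‖h t - 1‖ + ‖h t - t ^ 2‖ := by
      have := norm_sub_le (h t - 1) (h t - t ^ 2)
      rwa [show h t - 1 - (h t - t ^ 2) = t ^ 2 - 1 by ring] at this
    rw [norm_inv]
    apply inv_anti₀ hη
    nlinarith
  have h1mem : (1 : ℂ) ∈ Metric.closedBall (1 : ℂ) η := Metric.mem_closedBall_self hη.le
  have hmax := Complex.norm_le_of_forall_mem_frontier_norm_le Metric.isBounded_ball hdc hfr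
    (by rw [closure_ball _ hη.ne']; exact h1mem)
  rw [norm_inv] at hmax
  have hpos : 0 < ‖h 1 - 1‖ := norm_pos_iff.2 (hne' 1 h1mem)
  have h5 := (inv_le_inv₀ hpos hη).1 hmax
  have h6 := hb 1 h1mem
  rw [one_pow] at h6
  linarith

theorem re_logTerm (z : ℂ) :
    (logTerm z).re = gammaConst.re + 2 * Real.log ‖z‖ := by
  simp [logTerm, Complex.log_re]

theorem im_logTerm (z : ℂ) : (logTerm z).im = 2 * Complex.arg z - Real.pi := by
  have : gammaConst.im = -Real.pi := by
    have h2 : (Complex.log 2).im = 0 := by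
      have := Complex.ofReal_im (Real.log 2)
      rwa [Complex.ofReal_log zero_le_two] at this
    simp [gammaConst, h2]
  simp [logTerm, this, Complex.log_im]
  ring

/-- Both arguments lie within `π/2` of zero, so their sum stays off the branch cut and logarithms
add. -/
theorem mul_mem_slitPlane_of_re_pos {z t : ℂ} (hz : 0 < z.re) (ht : 0 < t.re) :
    z * t ∈ Complex.slitPlane ∧ logTerm (z * t) = logTerm z + 2 * Complex.log t := by
  have hz0 : z ≠ 0 := fun h => by simp [h] at hz
  have ht0 : t ≠ 0 := fun h => by simp [h] at ht
  have h1 := abs_lt.1 (Complex.abs_arg_lt_pi_div_two_iff.2 (Or.inl hz))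
  have h2 := abs_lt.1 (Complex.abs_arg_lt_pi_div_two_iff.2 (Or.inl ht))
  have hmem : Complex.arg z + Complex.arg t ∈ Set.Ioc (-Real.pi) Real.pi :=
    ⟨by linarith [h1.1, h2.1], by linarith [h1.2, h2.2]⟩
  refine ⟨?_, ?_⟩
  · rw [Complex.mem_slitPlane_iff_arg]
    refine ⟨?_, mul_ne_zero hz0 ht0⟩
    rw [(Complex.arg_mul_eq_add_arg_iff hz0 ht0).2 hmem]
    linarith [h1.2, h2.2]
  · rw [logTerm, logTerm, (Complex.log_mul_eq_add_log_iff hz0 ht0).2 hmem]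
    ring

/-- Near an approximate root of `z² (γ + 2 log z) = T` in the right half plane, every small
analytic perturbation of the equation has a root. -/
theorem exists_root_near {η : ℝ} (hη : 0 < η) (hη' : η ≤ 1 / 2) :
    ∃ κ B : ℝ, 0 < κ ∧ 0 < B ∧ ∀ (Φ : ℂ → ℂ) (z₁ T : ℂ), 0 < z₁.re → B ≤ ‖logTerm z₁‖ → T ≠ 0 →
      ‖z₁ ^ 2 * logTerm z₁ / T - 1‖ ≤ κ →
      DifferentiableOn ℂ Φ (Complex.slitPlane ∩ Metric.ball 0 (2 * ‖z₁‖)) →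
      (∀ z ∈ Complex.slitPlane ∩ Metric.ball 0 (2 * ‖z₁‖),
        ‖Φ z / (z ^ 2 * logTerm z) - 1‖ ≤ κ) →
      ∃ z ∈ Complex.slitPlane, ‖z - z₁‖ ≤ η * ‖z₁‖ ∧ Φ z = T := by
  -- With all three relative errors at most `η/40` and `|t|² ≤ 9/4`, the total deviation from `t²`
  -- is at most `9η/40 < η/2`. The lower bound `80/η` on the logarithm makes its variation over the
  -- disk at most `η/40`.
  refine ⟨η / 40, 80 / η, by positivity, by positivity, ?_⟩
  intro Φ z₁ T hre hB hT hc hd ha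
  have hκ1 : η / 40 ≤ 1 / 80 := by linarith
  have hz1 : z₁ ≠ 0 := fun h => by simp [h] at hre
  have hn : 0 < ‖z₁‖ := norm_pos_iff.2 hz1
  have hL : 0 < ‖logTerm z₁‖ := lt_of_lt_of_le (by positivity) hB
  have hL0 : logTerm z₁ ≠ 0 := norm_pos_iff.1 hL
  have hball : ∀ t ∈ Metric.closedBall (1 : ℂ) η, ‖t - 1‖ ≤ η := fun t ht => by
    simpa [dist_eq_norm] using ht
  have htn : ∀ t ∈ Metric.closedBall (1 : ℂ) η, ‖t‖ ≤ 3 / 2 := fun t ht => by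
    have := norm_add_le (t - 1) 1
    rw [sub_add_cancel, norm_one] at this
    linarith [hball t ht]
  have htre : ∀ t ∈ Metric.closedBall (1 : ℂ) η, 0 < t.re := fun t ht => by
    have h1 := (abs_le.1 ((Complex.abs_re_le_norm (t - 1)).trans (hball t ht))).1
    simp at h1
    linarith
  have hmem : ∀ t ∈ Metric.closedBall (1 : ℂ) η,
      z₁ * t ∈ Complex.slitPlane ∩ Metric.ball 0 (2 * ‖z₁‖) := fun t ht => by
    refine ⟨(mul_mem_slitPlane_of_re_pos hre (htre t ht)).1, ?_⟩
    rw [mem_ball_zero_iff, norm_mul]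
    nlinarith [htn t ht]
  have hdh : DifferentiableOn ℂ (fun t => Φ (z₁ * t) / T) (Metric.closedBall 1 η) :=
    DifferentiableOn.div_const (hd.comp (by fun_prop) hmem) T
  have hbh : ∀ t ∈ Metric.closedBall (1 : ℂ) η, ‖Φ (z₁ * t) / T - t ^ 2‖ ≤ η * 9 / 40 := by
    intro t ht
    -- After rescaling, `Φ(z₁ t) / T = t² (1 + a)(1 + b)(1 + c)`: `a` is the perturbation of the
    -- equation, `b` the relative variation of the logarithm from `z₁` to `z₁ t`, and `c` the defect
    -- of `z₁` as a root.
    have ha' := ha _ (hmem t ht)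
    obtain ⟨a, hadef⟩ : ∃ a, a = Φ (z₁ * t) / ((z₁ * t) ^ 2 * logTerm (z₁ * t)) - 1 := ⟨_, rfl⟩
    obtain ⟨c, hcdef⟩ : ∃ c, c = z₁ ^ 2 * logTerm z₁ / T - 1 := ⟨_, rfl⟩
    obtain ⟨b, hbdef⟩ : ∃ b, b = 2 * Complex.log t / logTerm z₁ := ⟨_, rfl⟩
    rw [← hadef] at ha'
    rw [← hcdef] at hc
    have ht0 : t ≠ 0 := fun h => by simpa [h] using htre t ht
    have hlog : logTerm (z₁ * t) = logTerm z₁ * (1 + b) := by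
      rw [(mul_mem_slitPlane_of_re_pos hre (htre t ht)).2, hbdef]
      field_simp
    have hbn : ‖b‖ ≤ η / 40 := by
      have h1 : ‖Complex.log t‖ ≤ 3 / 2 * ‖t - 1‖ := by
        have := Complex.norm_log_one_add_half_le_self (z := t - 1) ((hball t ht).trans hη')
        rwa [show 1 + (t - 1) = t by ring] at this
      rw [hbdef, norm_div, norm_mul, Complex.norm_ofNat, div_le_iff₀ hL]
      have h2 : η / 40 * (80 / η) ≤ η / 40 * ‖logTerm z₁‖ := by gcongr
      have h3 : η / 40 * (80 / η) = 2 := by field_simp; norm_num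
      linarith [hball t ht]
    have hb1 : 1 + b ≠ 0 := fun h => by
      have : b = -1 := by linear_combination h
      rw [this, norm_neg, norm_one] at hbn
      linarith
    have hΦ : Φ (z₁ * t) / T = t ^ 2 * ((1 + a) * (1 + b) * (1 + c)) := by
      rw [hadef, hcdef, hlog]
      field_simp
      ring
    rw [hΦ, show t ^ 2 * ((1 + a) * (1 + b) * (1 + c)) - t ^ 2 =
      t ^ 2 * (a + b + c + a * b + b * c + a * c + a * b * c) by ring, norm_mul, norm_pow]
    have hs : ‖a + b + c + a * b + b * c + a * c + a * b * c‖ ≤ 4 * (η / 40) := by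
      have n1 := norm_add_le (a + b + c + a * b + b * c + a * c) (a * b * c)
      have n2 := norm_add_le (a + b + c + a * b + b * c) (a * c)
      have n3 := norm_add_le (a + b + c + a * b) (b * c)
      have n4 := norm_add_le (a + b + c) (a * b)
      have n5 := norm_add_le (a + b) c
      have n6 := norm_add_le a b
      rw [norm_mul, norm_mul] at n1
      rw [norm_mul] at n2 n3 n4
      have m1 : ‖a‖ * ‖b‖ ≤ η / 40 * (1 / 80) :=
        mul_le_mul ha' (hbn.trans hκ1) (norm_nonneg _) (by positivity)
      have m2 : ‖b‖ * ‖c‖ ≤ η / 40 * (1 / 80) :=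
        mul_le_mul hbn (hc.trans hκ1) (norm_nonneg _) (by positivity)
      have m3 : ‖a‖ * ‖c‖ ≤ η / 40 * (1 / 80) :=
        mul_le_mul ha' (hc.trans hκ1) (norm_nonneg _) (by positivity)
      have m4 : ‖a‖ * ‖b‖ * ‖c‖ ≤ η / 40 * (1 / 80) * (1 / 80) :=
        mul_le_mul m1 (hc.trans hκ1) (norm_nonneg _) (by positivity)
      linarith
    have hsq : ‖t‖ ^ 2 ≤ 9 / 4 := by nlinarith [htn t ht, norm_nonneg t]
    calc ‖t‖ ^ 2 * ‖a + b + c + a * b + b * c + a * c + a * b * c‖ ≤ 9 / 4 * (4 * (η / 40)) :=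
          mul_le_mul hsq hs (norm_nonneg _) (by norm_num)
      _ = η * 9 / 40 := by ring
  obtain ⟨t, ht, hroot⟩ := exists_eq_one_of_near_sq (κ := η * 9 / 40) hη hη' (by linarith) hdh hbh
  refine ⟨z₁ * t, (hmem t ht).1, ?_, ?_⟩
  · rw [show z₁ * t - z₁ = (t - 1) * z₁ by ring, norm_mul]
    exact mul_le_mul_of_nonneg_right (hball t ht) hn.le
  · rwa [div_eq_one_iff_eq hT] at hroot

/-- The point `w` lies within distance `1` of the negative number `-p`. If `c > 0`, then `|Im w| ≥ s
+ c ≥ 1`, which is too large. If `c ≤ 0`, then `Re w ≥ 0`, so `|w + p| ≥ |w| ≥ 2`. An absolute bound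
on `e w` is essential; for this the error must be small against the inverse logarithm. -/
theorem phase_contradiction {w e : ℂ} {p Λ β c s : ℝ} (hp : 0 < p) (h : w * (1 + e) = -p)
    (he : ‖e‖ * ‖w‖ < 1) (hw : 2 ≤ ‖w‖) (hcs : c ^ 2 + s ^ 2 = 1) (hs : 0 ≤ s) (hΛ : 2 ≤ Λ)
    (hβ : 0 ≤ β) (hβc : 0 < c → 1 ≤ β) (hre : w.re = -Λ * c + β * s)
    (him : |w.im| = |Λ * s + β * c|) : False := by
  have hwe : w + p = -(w * e) := by linear_combination h
  have hwen : ‖w + p‖ < 1 := by rw [hwe, norm_neg, norm_mul, mul_comm]; exact he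
  by_cases hc : 0 < c
  · have h1 : |w.im| < 1 := by
      have := (Complex.abs_im_le_norm (w + p)).trans_lt hwen
      simpa using this
    rw [him, abs_of_nonneg (by have := hβc hc; positivity)] at h1
    have h2 : s ≤ Λ * s := by nlinarith
    have h3 : c ≤ β * c := by nlinarith [hβc hc]
    have : (c + s) ^ 2 < 1 := by
      have : 0 ≤ c + s := by positivity
      nlinarith
    nlinarith [mul_nonneg hc.le hs]
  · push Not at hc
    have hre0 : 0 ≤ w.re := by rw [hre]; nlinarith [mul_nonneg hβ hs]
    have h4 : ‖w‖ ^ 2 ≤ ‖w + p‖ ^ 2 := by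
      rw [← Complex.normSq_eq_norm_sq, ← Complex.normSq_eq_norm_sq, Complex.normSq_apply,
        Complex.normSq_apply]
      simp only [Complex.add_re, Complex.add_im, Complex.ofReal_re, Complex.ofReal_im, add_zero]
      nlinarith [mul_nonneg hre0 hp.le]
    nlinarith [norm_nonneg (w + p)]

/-- Small approximate roots of `z² (γ + 2 log z) = -σ` lie in the right half plane. -/
theorem re_pos_of_root {z e : ℂ} (hz : z ∈ Complex.slitPlane) {σ : ℝ} (hσ : 0 < σ)
    (h : z ^ 2 * logTerm z * (1 + e) = -σ) (he : ‖e‖ * ‖logTerm z‖ < 1)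
    (hL : (logTerm z).re ≤ -2) : 0 < z.re := by
  by_contra! hre
  have hz0 := Complex.slitPlane_ne_zero hz
  have hn : 0 < ‖z‖ := norm_pos_iff.2 hz0
  have hπ := Real.pi_gt_three
  obtain ⟨φ, hφ⟩ : ∃ φ, φ = Complex.arg z := ⟨_, rfl⟩
  have harg : Real.pi / 2 ≤ |φ| := by
    rw [hφ]
    by_contra! hlt
    rcases Complex.abs_arg_lt_pi_div_two_iff.1 hlt with h' | h'
    · linarith
    · exact hz0 h'
  have hφ1 : φ < Real.pi := by
    rw [hφ]
    exact lt_of_le_of_ne (Complex.arg_le_pi z) (Complex.mem_slitPlane_iff_arg.1 hz).1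
  have hφ2 : -Real.pi < φ := hφ ▸ Complex.neg_pi_lt_arg z
  obtain ⟨w, hwdef⟩ : ∃ w, w = Complex.exp ((2 * φ : ℝ) * Complex.I) * logTerm z := ⟨_, rfl⟩
  have hz2 : z ^ 2 = (‖z‖ : ℂ) ^ 2 * Complex.exp ((2 * φ : ℝ) * Complex.I) := by
    conv_lhs => rw [← Complex.norm_mul_exp_arg_mul_I z]
    rw [mul_pow, ← Complex.exp_nat_mul, hφ]
    congr 2
    push_cast; ring
  have hwn : ‖w‖ = ‖logTerm z‖ := by
    rw [hwdef, norm_mul, Complex.norm_exp_ofReal_mul_I, one_mul]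
  have hw2 : 2 ≤ ‖w‖ := by
    rw [hwn]
    have := Complex.abs_re_le_norm (logTerm z)
    rw [abs_of_nonpos (by linarith)] at this
    linarith
  have hnC : (‖z‖ : ℂ) ≠ 0 := by exact_mod_cast hn.ne'
  have hweq : w * (1 + e) = -((σ / ‖z‖ ^ 2 : ℝ) : ℂ) := by
    rw [hwdef]
    push_cast
    field_simp
    rw [← h, hz2]
    push_cast
    ring
  have hre' : w.re = Real.cos (2 * φ) * (logTerm z).re - Real.sin (2 * φ) * (2 * φ - Real.pi) := by
    rw [hwdef, Complex.mul_re, Complex.exp_ofReal_mul_I_re, Complex.exp_ofReal_mul_I_im,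
      im_logTerm, hφ]
  have him' : w.im = Real.cos (2 * φ) * (2 * φ - Real.pi) + Real.sin (2 * φ) * (logTerm z).re := by
    rw [hwdef, Complex.mul_im, Complex.exp_ofReal_mul_I_re, Complex.exp_ofReal_mul_I_im,
      im_logTerm, hφ]
  -- For `φ ≥ π/2` the imaginary part `β = 2φ - π` lies in `[0, π)` and `cos 2φ = -cos β`, so a
  -- positive cosine forces `β > π/2`. For `φ ≤ -π/2` the value `π - 2φ` is at least `2π`.
  rcases le_abs.1 harg with hp | hp
  · refine phase_contradiction (p := σ / ‖z‖ ^ 2) (Λ := -(logTerm z).re) (β := 2 * φ - Real.pi)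
      (c := Real.cos (2 * φ)) (s := -Real.sin (2 * φ)) (by positivity) hweq (by rwa [hwn]) hw2
      (by rw [neg_sq, Real.cos_sq_add_sin_sq]) ?_ (by linarith) (by linarith) ?_
      (by rw [hre']; ring) (by rw [him']; congr 1; ring)
    · have := Real.sin_nonneg_of_nonneg_of_le_pi (x := 2 * φ - Real.pi) (by linarith) (by linarith)
      rwa [Real.sin_sub_pi] at this
    · intro hc
      by_contra! hβ
      have := Real.cos_nonneg_of_mem_Icc (x := 2 * φ - Real.pi) ⟨by linarith, by linarith⟩
      rw [Real.cos_sub_pi] at this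
      linarith
  · refine phase_contradiction (p := σ / ‖z‖ ^ 2) (Λ := -(logTerm z).re) (β := Real.pi - 2 * φ)
      (c := Real.cos (2 * φ)) (s := Real.sin (2 * φ)) (by positivity) hweq (by rwa [hwn]) hw2
      (Real.cos_sq_add_sin_sq _) ?_ (by linarith) (by linarith) (fun _ => by linarith)
      (by rw [hre']; ring) (by rw [him', ← abs_neg]; congr 1; ring)
    have := Real.sin_nonneg_of_nonneg_of_le_pi (x := 2 * φ + 2 * Real.pi) (by linarith) (by linarith)
    rwa [Real.sin_add_two_pi] at this


/-! ## The characteristic equation in normal form -/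

theorem tendsto_mul_logTerm : Tendsto (fun z : ℂ => z * logTerm z) (𝓝[≠] 0) (𝓝 0) := by
  have h1 : Tendsto (fun z : ℂ => ‖z‖) (𝓝[≠] 0) (𝓝 0) := by
    have : Tendsto (fun z : ℂ => ‖z‖) (𝓝 0) (𝓝 ‖(0 : ℂ)‖) := continuous_norm.tendsto 0
    rw [norm_zero] at this
    exact this.mono_left nhdsWithin_le_nhds
  have h2 : Tendsto (fun z : ℂ => ‖z‖ * Real.log ‖z‖) (𝓝[≠] 0) (𝓝 0) := by
    have := (Real.continuous_mul_log.tendsto 0).comp h1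
    simpa [Function.comp_def] using this
  have h3 : Tendsto (fun z : ℂ => ‖gammaConst‖ * ‖z‖ + 2 * (|‖z‖ * Real.log ‖z‖| + Real.pi * ‖z‖))
      (𝓝[≠] 0) (𝓝 0) := by
    have := (h1.const_mul ‖gammaConst‖).add ((h2.abs.add (h1.const_mul Real.pi)).const_mul 2)
    simpa using this
  refine squeeze_zero_norm (fun z => ?_) h3
  have h4 : ‖Complex.log z‖ ≤ |Real.log ‖z‖| + Real.pi := by
    rw [Complex.log]
    refine (norm_add_le _ _).trans ?_
    rw [norm_mul, Complex.norm_I, mul_one, Complex.norm_real, Complex.norm_real]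
    gcongr
    · rfl
    · exact Complex.abs_arg_le_pi z
  have h5 : ‖logTerm z‖ ≤ ‖gammaConst‖ + 2 * (|Real.log ‖z‖| + Real.pi) := by
    rw [logTerm]
    refine (norm_add_le _ _).trans ?_
    rw [norm_mul, Complex.norm_ofNat]
    gcongr
  rw [norm_mul, abs_mul, abs_norm]
  nlinarith [norm_nonneg z, mul_le_mul_of_nonneg_left h5 (norm_nonneg z)]

theorem tendsto_re_logTerm : Tendsto (fun z : ℂ => (logTerm z).re) (𝓝[≠] 0) atBot := by
  simp only [re_logTerm]
  refine tendsto_atBot_add_const_left _ _ (Tendsto.const_mul_atBot two_pos ?_)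
  refine Real.tendsto_log_nhdsNE_zero.comp ?_
  have : Tendsto (fun z : ℂ => ‖z‖) (𝓝[≠] 0) (𝓝[>] 0) := tendsto_norm_nhdsNE_zero
  exact this.mono_right (nhdsWithin_mono _ fun x hx => ne_of_gt hx)

theorem tendsto_inv_logTerm : Tendsto (fun z : ℂ => (logTerm z)⁻¹) (𝓝[≠] 0) (𝓝 0) := by
  refine tendsto_inv₀_cobounded.comp (tendsto_norm_atTop_iff_cobounded.1 ?_)
  refine tendsto_atTop_mono (fun z => ?_) (tendsto_neg_atBot_atTop.comp tendsto_re_logTerm)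
  exact (neg_le_abs _).trans (Complex.abs_re_le_norm _)

theorem differentiableOn_logTerm : DifferentiableOn ℂ logTerm Complex.slitPlane := fun _ hz =>
  (((Complex.differentiableAt_log hz).const_mul 2).const_add gammaConst).differentiableWithinAt

theorem ofReal_mul_mem_slitPlane {c : ℝ} (hc : 0 < c) {z : ℂ} (hz : z ∈ Complex.slitPlane) :
    (c : ℂ) * z ∈ Complex.slitPlane := by
  rw [Complex.mem_slitPlane_iff] at hz ⊢
  rw [Complex.re_ofReal_mul, Complex.im_ofReal_mul]
  exact hz.imp (fun h => mul_pos hc h) fun h => mul_ne_zero hc.ne' h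

theorem differentiableOn_expansion {f g : ℂ → ℂ} (hf : Differentiable ℂ f)
    (hg : Differentiable ℂ g) (a b : ℂ) :
    DifferentiableOn ℂ (fun k => b + logTerm k * (a + k ^ 2 * f (k ^ 2)) + k ^ 2 * g (k ^ 2))
      Complex.slitPlane := by
  have := differentiableOn_logTerm
  have h1 : Differentiable ℂ fun k : ℂ => f (k ^ 2) := hf.comp (differentiable_pow 2)
  have h2 : Differentiable ℂ fun k : ℂ => g (k ^ 2) := hg.comp (differentiable_pow 2)
  exact ((differentiableOn_const b).add (this.mul ((differentiable_const a).add
    ((differentiable_pow 2).mul h1)).differentiableOn)).add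
    ((differentiable_pow 2).mul h2).differentiableOn

/-- The characteristic equation of radial resonances, as a perturbation of
`z² (γ + 2 log z) = -σ` that is uniform in the parameters. -/
theorem exists_normal_form {c₀ c₁ : ℝ} (hc₀ : 0 < c₀) :
    ∃ ρ : ℝ, 0 < ρ ∧ ∃ E : ℝ → ℝ → ℂ → ℂ,
      (∀ c ∈ Set.Icc c₀ c₁, ∀ t ∈ Set.Icc (0 : ℝ) 1,
        DifferentiableOn ℂ (E c t) (Complex.slitPlane ∩ Metric.ball 0 ρ)) ∧
      (∀ κ : ℝ, 0 < κ → ∃ ρ' : ℝ, 0 < ρ' ∧ ∀ c ∈ Set.Icc c₀ c₁, ∀ t ∈ Set.Icc (0 : ℝ) 1,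
        ∀ z : ℂ, z ≠ 0 → ‖z‖ < ρ' → ‖E c t z‖ * ‖logTerm z‖ ≤ κ) ∧
      (∀ c ∈ Set.Icc c₀ c₁, ∀ t ∈ Set.Icc (0 : ℝ) 1, ∀ z : ℂ, z ≠ 0 → ‖z‖ < ρ →
        logTerm (c * z) ≠ 0 ∧ (logTerm z).re ≤ -2 ∧ ∀ m M : ℝ, 0 < m → 0 < M →
        (1 / ((c : ℂ) * z) ^ 2 * (-(1 / 2) + npValue (c * z)) * (1 / 2 + 1 / (M : ℂ) *
          (2 * ((t * m : ℝ) : ℂ) * npNormalValue z -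
            ((M - 2 * (t * m) : ℝ) : ℂ) * npValue z)) +
          (((1 - t) * m : ℝ) : ℂ) * singleValue (c * z) * (1 / (M : ℂ) * singleNormalValue z) = 0 ↔
        z ^ 2 * logTerm z * (1 + E c t z) = -((4 * m / M : ℝ) : ℂ))) := by
  obtain ⟨fS, gS, hfS, hgS, hS⟩ := singleValue_expansion
  obtain ⟨fP, gP, hfP, hgP, hP⟩ := singleNormalValue_expansion
  obtain ⟨fA, gA, hfA, hgA, hA⟩ := npValue_expansion
  obtain ⟨fW, gW, hfW, hgW, hW⟩ := npValue_add_expansion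
  -- For `k ≠ 0`, `α k` is the upper left entry `k⁻² (-1/2 + npValue k)`. It behaves like `-(γ + 2
  -- log k)/4`, which is the origin of the first factor of `(*)`.
  obtain ⟨α, hα⟩ : ∃ α : ℂ → ℂ, ∀ k, α k = logTerm k * (-1 / 4 + k ^ 2 * fA (k ^ 2)) +
    k ^ 2 * gA (k ^ 2) := ⟨_, fun _ => rfl⟩
  obtain ⟨Q, hQ⟩ : ∃ Q : ℝ → ℂ → ℂ, ∀ c z, Q c z =
    singleValue (c * z) * singleNormalValue z / α (c * z) := ⟨_, fun _ _ => rfl⟩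
  obtain ⟨N, hN⟩ : ∃ N : ℝ → ℝ → ℂ → ℂ, ∀ c t z, N c t z =
    t * (2 * (npValue z + npNormalValue z)) + (1 - t) * Q c z := ⟨_, fun _ _ _ => rfl⟩
  -- Convergence along this filter is convergence as `z → 0`, uniformly for `c` in the compact
  -- interval.
  set l : Filter (ℂ × ℝ) := 𝓝[≠] 0 ×ˢ 𝓟 (Set.Icc c₀ c₁) with hl
  -- limits at the origin, uniformly in `c`
  have hfst : Tendsto (fun p : ℂ × ℝ => p.1) l (𝓝[≠] 0) := tendsto_fst
  have hz : Tendsto (fun p : ℂ × ℝ => p.1) l (𝓝 0) := hfst.mono_right nhdsWithin_le_nhds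
  have hcmem : ∀ᶠ p : ℂ × ℝ in l, p.2 ∈ Set.Icc c₀ c₁ :=
    tendsto_snd (f := 𝓝[≠] (0 : ℂ)) (g := 𝓟 (Set.Icc c₀ c₁)) (mem_principal_self _)
  have hz0 : ∀ᶠ p : ℂ × ℝ in l, p.1 ≠ 0 := hfst self_mem_nhdsWithin
  have hk : Tendsto (fun p : ℂ × ℝ => (p.2 : ℂ) * p.1) l (𝓝 0) := by
    have h1 : Tendsto (fun p : ℂ × ℝ => c₁ * ‖p.1‖) l (𝓝 0) := by
      simpa using hz.norm.const_mul c₁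
    refine squeeze_zero_norm' ?_ h1
    filter_upwards [hcmem] with p hp
    rw [norm_mul, Complex.norm_real, Real.norm_of_nonneg (hc₀.le.trans hp.1)]
    exact mul_le_mul_of_nonneg_right hp.2 (norm_nonneg _)
  have hk' : Tendsto (fun p : ℂ × ℝ => (p.2 : ℂ) * p.1) l (𝓝[≠] 0) := by
    refine tendsto_nhdsWithin_iff.2 ⟨hk, ?_⟩
    filter_upwards [hcmem, hz0] with p hp hp0
    exact mul_ne_zero (by exact_mod_cast (hc₀.trans_le hp.1).ne') hp0
  have hzL : Tendsto (fun p : ℂ × ℝ => p.1 * logTerm p.1) l (𝓝 0) := tendsto_mul_logTerm.comp hfst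
  have hLinv : Tendsto (fun p : ℂ × ℝ => (logTerm p.1)⁻¹) l (𝓝 0) := tendsto_inv_logTerm.comp hfst
  have hLkinv : Tendsto (fun p : ℂ × ℝ => (logTerm ((p.2 : ℂ) * p.1))⁻¹) l (𝓝 0) :=
    tendsto_inv_logTerm.comp hk'
  have hkL : Tendsto (fun p : ℂ × ℝ => ((p.2 : ℂ) * p.1) ^ 2 * logTerm p.1) l (𝓝 0) := by
    have h1 : Tendsto (fun p : ℂ × ℝ => c₁ ^ 2 * (‖p.1‖ * ‖p.1 * logTerm p.1‖)) l (𝓝 0) := by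
      simpa using (hz.norm.mul hzL.norm).const_mul (c₁ ^ 2)
    refine squeeze_zero_norm' ?_ h1
    filter_upwards [hcmem] with p hp
    have h0 := hc₀.le.trans hp.1
    rw [norm_mul, norm_pow, norm_mul, norm_mul, Complex.norm_real, Real.norm_of_nonneg h0, mul_pow]
    have : p.2 ^ 2 ≤ c₁ ^ 2 := pow_le_pow_left₀ h0 hp.2 2
    calc p.2 ^ 2 * ‖p.1‖ ^ 2 * ‖logTerm p.1‖ ≤ c₁ ^ 2 * ‖p.1‖ ^ 2 * ‖logTerm p.1‖ := by gcongr
      _ = _ := by ring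
  have hL0 : ∀ᶠ p : ℂ × ℝ in l, (logTerm p.1).re ≤ -2 :=
    (tendsto_re_logTerm.comp hfst).eventually (eventually_le_atBot (-2))
  have hLk0 : ∀ᶠ p : ℂ × ℝ in l, (logTerm ((p.2 : ℂ) * p.1)).re ≤ -2 :=
    (tendsto_re_logTerm.comp hk').eventually (eventually_le_atBot (-2))
  have hne : ∀ w : ℂ, (logTerm w).re ≤ -2 → logTerm w ≠ 0 := fun w hw h => by
    rw [h, Complex.zero_re] at hw; linarith
  have hcz : ∀ {f : ℂ → ℂ}, Differentiable ℂ f →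
      Tendsto (fun p : ℂ × ℝ => f (p.1 ^ 2)) l (𝓝 (f 0)) := fun {f} hf => by
    have h1 : Tendsto (fun p : ℂ × ℝ => p.1 ^ 2) l (𝓝 0) := by simpa using hz.pow 2
    exact (hf.continuous.tendsto 0).comp h1
  have hck : ∀ {f : ℂ → ℂ}, Differentiable ℂ f →
      Tendsto (fun p : ℂ × ℝ => f (((p.2 : ℂ) * p.1) ^ 2)) l (𝓝 (f 0)) := fun {f} hf => by
    have h1 : Tendsto (fun p : ℂ × ℝ => ((p.2 : ℂ) * p.1) ^ 2) l (𝓝 0) := by simpa using hk.pow 2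
    exact (hf.continuous.tendsto 0).comp h1
  have u1 : Tendsto (fun p : ℂ × ℝ => (-4 * α p.1 / logTerm p.1 - 1) * logTerm p.1) l (𝓝 0) := by
    have h1 : Tendsto (fun p : ℂ × ℝ => -4 * (p.1 * (p.1 * logTerm p.1) * fA (p.1 ^ 2) +
        p.1 ^ 2 * gA (p.1 ^ 2))) l (𝓝 0) := by
      simpa using (((hz.mul hzL).mul (hcz hfA)).add ((hz.pow 2).mul (hcz hgA))).const_mul (-4)
    refine h1.congr' ?_
    filter_upwards [hL0] with p hp
    have := hne _ hp
    rw [hα]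
    field_simp
    ring
  have u2 : Tendsto (fun p : ℂ × ℝ => (2 * (npValue p.1 + npNormalValue p.1) - 1) * logTerm p.1) l
      (𝓝 0) := by
    have h1 : Tendsto (fun p : ℂ × ℝ => 2 * ((p.1 * logTerm p.1) ^ 2 * fW (p.1 ^ 2) +
        p.1 * (p.1 * logTerm p.1) * gW (p.1 ^ 2))) l (𝓝 0) := by
      simpa using (((hzL.pow 2).mul (hcz hfW)).add ((hz.mul hzL).mul (hcz hgW))).const_mul 2
    refine h1.congr' (Eventually.of_forall fun p => ?_)
    beta_reduce
    rw [hW]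
    ring
  have uP : Tendsto (fun p : ℂ × ℝ => (singleNormalValue p.1 + 1 / 2) * logTerm p.1) l (𝓝 0) := by
    have h1 : Tendsto (fun p : ℂ × ℝ => (p.1 * logTerm p.1) ^ 2 * fP (p.1 ^ 2) +
        p.1 * (p.1 * logTerm p.1) * gP (p.1 ^ 2)) l (𝓝 0) := by
      simpa using ((hzL.pow 2).mul (hcz hfP)).add ((hz.mul hzL).mul (hcz hgP))
    refine h1.congr' (Eventually.of_forall fun p => ?_)
    beta_reduce
    rw [hP]
    ring
  have lP : Tendsto (fun p : ℂ × ℝ => singleNormalValue p.1) l (𝓝 (-1 / 2)) := by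
    have h1 : Tendsto (fun p : ℂ × ℝ => -1 / 2 + (singleNormalValue p.1 + 1 / 2) * logTerm p.1 *
        (logTerm p.1)⁻¹) l (𝓝 (-1 / 2)) := by
      simpa using (uP.mul hLinv).const_add (-1 / 2)
    refine h1.congr' ?_
    filter_upwards [hL0] with p hp
    have := hne _ hp
    field_simp
    ring
  have lα : Tendsto (fun p : ℂ × ℝ => α (p.2 * p.1) / logTerm (p.2 * p.1)) l (𝓝 (-1 / 4)) := by
    have h1 : Tendsto (fun p : ℂ × ℝ => -1 / 4 + ((p.2 : ℂ) * p.1) ^ 2 * fA (((p.2 : ℂ) * p.1) ^ 2) +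
        ((p.2 : ℂ) * p.1) ^ 2 * gA (((p.2 : ℂ) * p.1) ^ 2) * (logTerm ((p.2 : ℂ) * p.1))⁻¹) l
        (𝓝 (-1 / 4)) := by
      simpa using (((hk.pow 2).mul (hck hfA)).const_add (-1 / 4)).add
        (((hk.pow 2).mul (hck hgA)).mul hLkinv)
    refine h1.congr' ?_
    filter_upwards [hLk0] with p hp
    have := hne _ hp
    rw [hα]
    field_simp
  have hα0 : ∀ᶠ p : ℂ × ℝ in l, α (p.2 * p.1) ≠ 0 := by
    filter_upwards [lα.eventually_ne (show (-1 / 4 : ℂ) ≠ 0 by norm_num)] with p hp h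
    rw [h, zero_div] at hp
    exact hp rfl
  -- In `singleValue + 2 α` the terms `logTerm / 2` and `-logTerm / 2` cancel, leaving order `k²` up
  -- to logarithms. Hence the limit `-2` of the quotient is attained fast enough to survive
  -- multiplication by `logTerm`.
  have uR : Tendsto (fun p : ℂ × ℝ =>
      (singleValue (p.2 * p.1) / α (p.2 * p.1) + 2) * logTerm p.1) l (𝓝 0) := by
    have h1 : Tendsto (fun p : ℂ × ℝ => (((p.2 : ℂ) * p.1) ^ 2 * logTerm p.1 *
        (fS (((p.2 : ℂ) * p.1) ^ 2) + 2 * fA (((p.2 : ℂ) * p.1) ^ 2)) +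
        ((p.2 : ℂ) * p.1) ^ 2 * logTerm p.1 * (gS (((p.2 : ℂ) * p.1) ^ 2) +
          2 * gA (((p.2 : ℂ) * p.1) ^ 2)) * (logTerm ((p.2 : ℂ) * p.1))⁻¹) /
          (α (p.2 * p.1) / logTerm (p.2 * p.1))) l (𝓝 0) := by
      simp only [div_eq_mul_inv _ (α _ / _)]
      simpa using ((hkL.mul ((hck hfS).add ((hck hfA).const_mul 2))).add
        ((hkL.mul ((hck hgS).add ((hck hgA).const_mul 2))).mul hLkinv)).mul
        (lα.inv₀ (by norm_num))
    refine h1.congr' ?_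
    filter_upwards [hLk0, hα0] with p hp hp'
    have := hne _ hp
    rw [div_add' _ _ _ hp', hS]
    field_simp
    rw [hα]
    ring_nf
  have u3 : Tendsto (fun p : ℂ × ℝ => (Q p.2 p.1 - 1) * logTerm p.1) l (𝓝 0) := by
    have h1 : Tendsto (fun p : ℂ × ℝ =>
        (singleValue (p.2 * p.1) / α (p.2 * p.1) + 2) * logTerm p.1 * singleNormalValue p.1 -
        2 * ((singleNormalValue p.1 + 1 / 2) * logTerm p.1)) l (𝓝 0) := by
      simpa using (uR.mul lP).sub (uP.const_mul 2)
    refine h1.congr' (Eventually.of_forall fun p => ?_)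
    beta_reduce
    rw [hQ]
    ring
  have small : ∀ κ : ℝ, 0 < κ → ∃ ρ' : ℝ, 0 < ρ' ∧ ∀ c ∈ Set.Icc c₀ c₁, ∀ z : ℂ, z ≠ 0 →
      ‖z‖ < ρ' → ‖-4 * α z / logTerm z - 1‖ * ‖logTerm z‖ ≤ κ ∧
        ‖2 * (npValue z + npNormalValue z) - 1‖ * ‖logTerm z‖ ≤ κ ∧
        ‖Q c z - 1‖ * ‖logTerm z‖ ≤ κ ∧ (logTerm z).re ≤ -2 ∧
        (logTerm (c * z)).re ≤ -2 ∧ α (c * z) ≠ 0 := by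
    intro κ hκ
    have hle : ∀ {f : ℂ × ℝ → ℂ}, Tendsto f l (𝓝 0) → ∀ᶠ p in l, ‖f p‖ ≤ κ := fun hf => by
      have := hf.norm
      rw [norm_zero] at this
      exact this.eventually (ge_mem_nhds hκ)
    have hev := (((((hle u1).and (hle u2)).and (hle u3)).and hL0).and hLk0).and hα0
    rw [hl, eventually_prod_principal_iff, eventually_nhdsWithin_iff,
      Metric.eventually_nhds_iff] at hev
    obtain ⟨ρ', hρ', h⟩ := hev
    refine ⟨ρ', hρ', fun c hc z hz hzρ => ?_⟩
    obtain ⟨⟨⟨⟨⟨h1, h2⟩, h3⟩, h4⟩, h5⟩, h6⟩ := h (by simpa using hzρ) hz c hc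
    rw [norm_mul] at h1 h2 h3
    exact ⟨h1, h2, h3, h4, h5, h6⟩
  have estim : ∀ κ : ℝ, κ ≤ 1 / 2 → ∀ c t : ℝ, t ∈ Set.Icc (0 : ℝ) 1 → ∀ z : ℂ,
      ‖-4 * α z / logTerm z - 1‖ * ‖logTerm z‖ ≤ κ →
      ‖2 * (npValue z + npNormalValue z) - 1‖ * ‖logTerm z‖ ≤ κ →
      ‖Q c z - 1‖ * ‖logTerm z‖ ≤ κ → (logTerm z).re ≤ -2 →
      ‖N c t z - 1‖ * ‖logTerm z‖ ≤ κ ∧ 1 / 2 ≤ ‖N c t z‖ := by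
    intro κ hκ c t ht z h1 h2 h3 h4
    have hL2 : 2 ≤ ‖logTerm z‖ := by
      have := (neg_le_abs _).trans (Complex.abs_re_le_norm (logTerm z))
      linarith
    -- `N - 1` is a convex combination of two small errors, hence small uniformly in `t`.
    have e1 : N c t z - 1 = (t : ℂ) * (2 * (npValue z + npNormalValue z) - 1) +
        ((1 - t : ℝ) : ℂ) * (Q c z - 1) := by
      rw [hN]; push_cast; ring
    have h5 : ‖N c t z - 1‖ ≤ t * ‖2 * (npValue z + npNormalValue z) - 1‖ +
        (1 - t) * ‖Q c z - 1‖ := by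
      rw [e1]
      refine (norm_add_le _ _).trans ?_
      rw [norm_mul, norm_mul, Complex.norm_real, Complex.norm_real, Real.norm_of_nonneg ht.1,
        Real.norm_of_nonneg (by linarith [ht.2])]
    have h6 : ‖N c t z - 1‖ * ‖logTerm z‖ ≤ κ := by
      have := mul_le_mul_of_nonneg_right h5 (norm_nonneg (logTerm z))
      nlinarith [mul_le_mul_of_nonneg_left h2 ht.1,
        mul_le_mul_of_nonneg_left h3 (sub_nonneg.2 ht.2)]
    refine ⟨h6, ?_⟩
    have h7 : ‖N c t z - 1‖ ≤ 1 / 4 := by nlinarith [norm_nonneg (N c t z - 1)]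
    have h8 := norm_sub_le (N c t z) (N c t z - 1)
    rw [sub_sub_cancel, norm_one] at h8
    linarith
  obtain ⟨ρ, hρ, hsm⟩ := small (1 / 2) (by norm_num)
  refine ⟨ρ, hρ, fun c t z => -4 * α z / (logTerm z * N c t z) - 1, ?_, ?_, ?_⟩
  · intro c hc t ht
    have hcpos : 0 < c := hc₀.trans_le hc.1
    have hmaps : Set.MapsTo (fun z : ℂ => (c : ℂ) * z) Complex.slitPlane Complex.slitPlane :=
      fun z hz => ofReal_mul_mem_slitPlane hcpos hz
    have hcd : DifferentiableOn ℂ (fun z : ℂ => (c : ℂ) * z) Complex.slitPlane := by fun_prop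
    have dα : DifferentiableOn ℂ α Complex.slitPlane :=
      (differentiableOn_expansion hfA hgA (-1 / 4) 0).congr fun k _ => by rw [hα]; ring
    have dS : DifferentiableOn ℂ singleValue Complex.slitPlane :=
      (differentiableOn_expansion hfS hgS (1 / 2) 0).congr fun k _ => by rw [hS]; ring
    have dP : DifferentiableOn ℂ singleNormalValue Complex.slitPlane :=
      (differentiableOn_expansion hfP hgP 0 (-1 / 2)).congr fun k _ => by rw [hP]; ring
    have dW : DifferentiableOn ℂ (fun k => npValue k + npNormalValue k) Complex.slitPlane :=
      (differentiableOn_expansion hfW hgW 0 (1 / 2)).congr fun k _ => by rw [hW]; ring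
    have sub : Complex.slitPlane ∩ Metric.ball 0 ρ ⊆ Complex.slitPlane := Set.inter_subset_left
    have hfacts : ∀ z ∈ Complex.slitPlane ∩ Metric.ball 0 ρ,
        logTerm z ≠ 0 ∧ α (c * z) ≠ 0 ∧ N c t z ≠ 0 := fun z hz => by
      obtain ⟨h1, h2, h3, h4, h5, h6⟩ := hsm c hc z (Complex.slitPlane_ne_zero hz.1)
        (by simpa using hz.2)
      refine ⟨hne _ h4, h6, fun h => ?_⟩
      have := (estim (1 / 2) le_rfl c t ht z h1 h2 h3 h4).2
      rw [h, norm_zero] at this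
      linarith
    have dQ : DifferentiableOn ℂ (fun z => Q c z) (Complex.slitPlane ∩ Metric.ball 0 ρ) :=
      ((((dS.comp hcd hmaps).mul dP).mono sub).div ((dα.comp hcd hmaps).mono sub)
        fun z hz => (hfacts z hz).2.1).congr fun z _ => by rw [hQ]; rfl
    have dN : DifferentiableOn ℂ (fun z => N c t z) (Complex.slitPlane ∩ Metric.ball 0 ρ) :=
      ((((dW.mono sub).const_mul 2).const_mul (t : ℂ)).add (dQ.const_mul (1 - (t : ℂ)))).congr
        fun z _ => hN c t z
    exact (((dα.mono sub).const_mul (-4)).div ((differentiableOn_logTerm.mono sub).mul dN)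
      fun z hz => mul_ne_zero (hfacts z hz).1 (hfacts z hz).2.2).sub_const 1
  · intro κ hκ
    -- The error is a difference of two quantities of size `κ/4` divided by `N`, whose modulus is at
    -- least `1/2`.
    obtain ⟨ρ', hρ', h⟩ := small (min (κ / 4) (1 / 2)) (lt_min (by positivity) (by norm_num))
    refine ⟨ρ', hρ', fun c hc t ht z hz hzρ => ?_⟩
    obtain ⟨h1, h2, h3, h4, h5, h6⟩ := h c hc z hz hzρ
    obtain ⟨h7, h8⟩ := estim _ (min_le_right _ _) c t ht z h1 h2 h3 h4
    have hN0 : N c t z ≠ 0 := fun h => by rw [h, norm_zero] at h8; linarith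
    have hL := hne _ h4
    have e : -4 * α z / (logTerm z * N c t z) - 1 =
        ((-4 * α z / logTerm z - 1) - (N c t z - 1)) / N c t z := by
      field_simp
      ring
    beta_reduce
    rw [e, norm_div, div_mul_eq_mul_div, div_le_iff₀ (by linarith)]
    have h9 := norm_sub_le (-4 * α z / logTerm z - 1) (N c t z - 1)
    have h10 := mul_le_mul_of_nonneg_right h9 (norm_nonneg (logTerm z))
    have h11 := min_le_left (κ / 4) (1 / 2)
    nlinarith
  · intro c hc t ht z hz hzρ
    obtain ⟨h1, h2, h3, h4, h5, h6⟩ := hsm c hc z hz hzρ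
    have h8 := (estim _ le_rfl c t ht z h1 h2 h3 h4).2
    have hN0 : N c t z ≠ 0 := fun h => by rw [h, norm_zero] at h8; linarith
    have hL := hne _ h4
    refine ⟨hne _ h5, h4, fun m M hm hM => ?_⟩
    have hM' : (M : ℂ) ≠ 0 := by exact_mod_cast hM.ne'
    have hm' : (m : ℂ) ≠ 0 := by exact_mod_cast hm.ne'
    have hcz' : (c : ℂ) * z ≠ 0 :=
      mul_ne_zero (by exact_mod_cast (hc₀.trans_le hc.1).ne') hz
    have hleft : 1 / ((c : ℂ) * z) ^ 2 * (-(1 / 2) + npValue (c * z)) = α (c * z) := by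
      rw [hA, ← hα, ← mul_assoc, one_div, inv_mul_cancel₀ (pow_ne_zero 2 hcz'), one_mul]
    -- Writing `λ = M - 2μ` with `μ = t m` makes the constant `1/2` cancel against `npValue`,
    -- leaving `-z² α z` and a multiple of `npValue + npNormalValue`.
    have hD : 1 / 2 + 1 / (M : ℂ) * (2 * ((t * m : ℝ) : ℂ) * npNormalValue z -
        ((M - 2 * (t * m) : ℝ) : ℂ) * npValue z) =
        -(z ^ 2 * α z) + 2 * t * m / M * (npValue z + npNormalValue z) := by
      have := hA z
      rw [← hα] at this
      rw [← this]
      push_cast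
      field_simp
      ring
    have hSP : singleValue (c * z) * singleNormalValue z = α (c * z) * Q c z := by
      rw [hQ]; field_simp
    -- The determinant factors: `α (c z)` has no zeros near the origin, so only the bracket can
    -- vanish.
    have key : 1 / ((c : ℂ) * z) ^ 2 * (-(1 / 2) + npValue (c * z)) * (1 / 2 + 1 / (M : ℂ) *
          (2 * ((t * m : ℝ) : ℂ) * npNormalValue z -
            ((M - 2 * (t * m) : ℝ) : ℂ) * npValue z)) +
          (((1 - t) * m : ℝ) : ℂ) * singleValue (c * z) * (1 / (M : ℂ) * singleNormalValue z) =
        α (c * z) * (-(z ^ 2 * α z) + m / M * N c t z) := by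
      rw [hleft, hD, hN]
      push_cast
      linear_combination ((1 - t) * m / M : ℂ) * hSP
    rw [key, mul_eq_zero, or_iff_right h6]
    have hE : z ^ 2 * logTerm z * (1 + (-4 * α z / (logTerm z * N c t z) - 1)) =
        -4 * (z ^ 2 * α z) / N c t z := by
      field_simp
      ring
    rw [hE, div_eq_iff hN0]
    push_cast
    constructor
    · intro h
      linear_combination 4 * h
    · intro h
      linear_combination (1 / 4) * h


/-! ## Matching of roots -/

theorem exists_re_logTerm_le (A : ℝ) :
    ∃ b : ℝ, 0 < b ∧ ∀ z : ℂ, z ≠ 0 → ‖z‖ < b → (logTerm z).re ≤ A := by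
  have h := tendsto_re_logTerm.eventually (eventually_le_atBot A)
  rw [eventually_nhdsWithin_iff, Metric.eventually_nhds_iff] at h
  obtain ⟨b, hb, h⟩ := h
  exact ⟨b, hb, fun z hz hzb => h (by simpa using hzb) hz⟩

theorem le_norm_of_re_le_neg {z : ℂ} {A : ℝ} (h : z.re ≤ -A) : A ≤ ‖z‖ := by
  have := (neg_le_abs _).trans (Complex.abs_re_le_norm z)
  linarith

/-- A root of one small perturbation of `z² (γ + 2 log z) = -σ` lies close to a root of any
other one. -/
theorem exists_root_near_root {η : ℝ} (hη : 0 < η) :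
    ∃ κ b : ℝ, 0 < κ ∧ 0 < b ∧ ∀ (z₁ e : ℂ) (σ σ' : ℝ) (F : ℂ → ℂ), 0 < z₁.re → ‖z₁‖ < b →
      0 < σ → 0 < σ' → |σ' / σ - 1| ≤ κ → z₁ ^ 2 * logTerm z₁ * (1 + e) = -(σ : ℂ) → ‖e‖ ≤ κ →
      DifferentiableOn ℂ F (Complex.slitPlane ∩ Metric.ball 0 (2 * ‖z₁‖)) →
      (∀ z ∈ Complex.slitPlane ∩ Metric.ball 0 (2 * ‖z₁‖), ‖F z‖ ≤ κ) →
      ∃ z ∈ Complex.slitPlane, ‖z‖ ≤ 2 * ‖z₁‖ ∧ ‖z - z₁‖ ≤ η * ‖z₁‖ ∧ ‖z - z₁‖ ≤ η * ‖z‖ ∧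
        z ^ 2 * logTerm z * (1 + F z) = -(σ' : ℂ) := by
  obtain ⟨κ, B, hκ, hB, hroot⟩ := exists_root_near (η := min (η / 2) (1 / 2))
    (lt_min (by positivity) (by norm_num)) (min_le_right _ _)
  obtain ⟨b, hb, hLb⟩ := exists_re_logTerm_le (-B)
  -- The defect is `(u + e + u e) / ((1 + u)(1 + e))`, with numerator at most `5κ/24` and
  -- denominator at least `1/4`, hence below `κ`. The radius is halved because the equation is used
  -- on the ball of radius `2 ‖z₁‖`. Working with `min (η/2) (1/2)` gives closeness relative to both
  -- `z₁` and `z`.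
  refine ⟨min (κ / 12) (1 / 2), b / 2, lt_min (by positivity) (by norm_num), by positivity, ?_⟩
  intro z₁ e σ σ' F hre hz₁ hσ hσ' hσσ heq he hFd hF
  have hz₁0 : z₁ ≠ 0 := fun h => by simp [h] at hre
  have hσc : (σ : ℂ) ≠ 0 := by exact_mod_cast hσ.ne'
  have hσc' : (σ' : ℂ) ≠ 0 := by exact_mod_cast hσ'.ne'
  have hratio : ‖z₁ ^ 2 * logTerm z₁ / (-(σ' : ℂ)) - 1‖ ≤ κ := by
    have hu : ‖((σ' / σ - 1 : ℝ) : ℂ)‖ ≤ min (κ / 12) (1 / 2) := by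
      rwa [Complex.norm_real]
    obtain ⟨u, hu'⟩ : ∃ u : ℂ, u = ((σ' / σ - 1 : ℝ) : ℂ) := ⟨_, rfl⟩
    rw [← hu'] at hu
    have hs : (σ' : ℂ) = σ * (1 + u) := by
      rw [hu']; push_cast; field_simp; ring
    have hhalf : ∀ w : ℂ, ‖w‖ ≤ min (κ / 12) (1 / 2) → 1 / 2 ≤ ‖1 + w‖ := fun w hw => by
      have h1 := norm_sub_le (1 + w) w
      rw [add_sub_cancel_right, norm_one] at h1
      linarith [hw.trans (min_le_right _ _)]
    have h1 := hhalf u hu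
    have h2 := hhalf e he
    have h10 : 1 + u ≠ 0 := fun h => by rw [h, norm_zero] at h1; linarith
    have h20 : 1 + e ≠ 0 := fun h => by rw [h, norm_zero] at h2; linarith
    have hval : z₁ ^ 2 * logTerm z₁ / (-(σ' : ℂ)) - 1 =
        -(u + e + u * e) / ((1 + u) * (1 + e)) := by
      have h3 : z₁ ^ 2 * logTerm z₁ = -(σ : ℂ) / (1 + e) := by
        rw [eq_div_iff h20, heq]
      rw [h3, hs]
      field_simp
      ring
    rw [hval, norm_div, norm_neg, norm_mul, div_le_iff₀ (by positivity)]
    have h3 : ‖u + e + u * e‖ ≤ ‖u‖ + ‖e‖ + ‖u‖ * ‖e‖ := by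
      refine (norm_add_le _ _).trans ?_
      rw [norm_mul]
      gcongr
      exact norm_add_le _ _
    have h4 := hu.trans (min_le_left _ _)
    have h5 := he.trans (min_le_left _ _)
    have h6 := he.trans (min_le_right _ _)
    have h7 : 1 / 4 ≤ ‖1 + u‖ * ‖1 + e‖ := by nlinarith
    nlinarith [norm_nonneg u, norm_nonneg e]
  have hLne : ∀ z ∈ Complex.slitPlane ∩ Metric.ball 0 (2 * ‖z₁‖), logTerm z ≠ 0 := by
    intro z hz h
    have h1 := hLb z (Complex.slitPlane_ne_zero hz.1) (by
      have : ‖z‖ < 2 * ‖z₁‖ := by simpa using hz.2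
      linarith)
    rw [h, Complex.zero_re] at h1
    linarith
  obtain ⟨z, hz, hnear, hval⟩ := hroot (fun z => z ^ 2 * logTerm z * (1 + F z)) z₁ (-(σ' : ℂ)) hre
    (le_norm_of_re_le_neg (hLb z₁ hz₁0 (by linarith))) (neg_ne_zero.2 hσc') hratio
    (((differentiable_pow 2).differentiableOn.mul
      (differentiableOn_logTerm.mono Set.inter_subset_left)).mul (hFd.const_add 1))
    (fun z hz => by
      have h1 := hLne z hz
      have h2 := Complex.slitPlane_ne_zero hz.1
      rw [mul_div_cancel_left₀ _ (mul_ne_zero (pow_ne_zero 2 h2) h1), add_sub_cancel_left]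
      exact (hF z hz).trans ((min_le_left _ _).trans (by linarith)))
  have hn := norm_nonneg z₁
  have h1 : ‖z - z₁‖ ≤ η / 2 * ‖z₁‖ :=
    hnear.trans (mul_le_mul_of_nonneg_right (min_le_left _ _) hn)
  have h2 : ‖z - z₁‖ ≤ 1 / 2 * ‖z₁‖ :=
    hnear.trans (mul_le_mul_of_nonneg_right (min_le_right _ _) hn)
  have h3 : ‖z₁‖ ≤ ‖z‖ + ‖z - z₁‖ := by
    have := norm_sub_le z (z - z₁)
    rwa [sub_sub_cancel] at this
  have h4 : ‖z‖ ≤ ‖z₁‖ + ‖z - z₁‖ := by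
    have := norm_add_le z₁ (z - z₁)
    rwa [add_sub_cancel] at this
  exact ⟨z, hz, by linarith, by nlinarith, by nlinarith, hval⟩

/-- The factor `|logTerm z| |1 + e|` is at least `2 · 3/4`. The bound forces any root below a fixed
radius to shrink with `σ`. -/
theorem norm_sq_le_of_root {z e : ℂ} {σ : ℝ} (hσ : 0 < σ)
    (h : z ^ 2 * logTerm z * (1 + e) = -(σ : ℂ)) (he : ‖e‖ * ‖logTerm z‖ ≤ 1 / 2)
    (hL : (logTerm z).re ≤ -2) : ‖z‖ ^ 2 ≤ σ := by
  have h1 := le_norm_of_re_le_neg hL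
  have h2 : ‖e‖ ≤ 1 / 4 := by nlinarith [norm_nonneg e]
  have h3 : 3 / 4 ≤ ‖1 + e‖ := by
    have h1 := norm_sub_le (1 + e) e
    rw [add_sub_cancel_right, norm_one] at h1
    linarith
  have h4 : ‖z‖ ^ 2 * (‖logTerm z‖ * ‖1 + e‖) = σ := by
    have := congrArg norm h
    rwa [norm_mul, norm_mul, norm_pow, norm_neg, Complex.norm_real, Real.norm_of_nonneg hσ.le,
      mul_assoc] at this
  have h5 : 1 ≤ ‖logTerm z‖ * ‖1 + e‖ := by nlinarith
  nlinarith [sq_nonneg ‖z‖]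

/-- An approximate root on the positive real axis. -/
theorem exists_real_approx_root {κ b : ℝ} (hκ : 0 < κ) (hb : 0 < b) :
    ∃ s : ℝ, 0 < s ∧ ∀ σ : ℝ, 0 < σ → σ < s → ∃ (x : ℝ) (e : ℂ), 0 < x ∧ x < b ∧ ‖e‖ ≤ κ ∧
      (x : ℂ) ^ 2 * logTerm x * (1 + e) = -(σ : ℂ) := by
  obtain ⟨b', hb', hL⟩ := exists_re_logTerm_le (-(Real.pi / κ))
  have hpi := Real.pi_pos
  have hA : 0 < Real.pi / κ := by positivity
  obtain ⟨a, ha, hab, hab'⟩ : ∃ a : ℝ, 0 < a ∧ a < b ∧ a < b' :=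
    ⟨min b b' / 2, by positivity, by linarith [min_le_left b b', lt_min hb hb'],
      by linarith [min_le_right b b', lt_min hb hb']⟩
  have hre : ∀ x : ℝ, 0 < x → (logTerm x).re = gammaConst.re + 2 * Real.log x := fun x hx => by
    rw [re_logTerm, Complex.norm_real, Real.norm_of_nonneg hx.le]
  have hneg : ∀ x : ℝ, 0 < x → x ≤ a → (logTerm x).re ≤ -(Real.pi / κ) := fun x hx hxa =>
    hL x (by exact_mod_cast hx.ne')
      (by rw [Complex.norm_real, Real.norm_of_nonneg hx.le]; linarith)
  -- `f x = -x² Re (logTerm x)`, written with `x log x` so that continuity extends to `x = 0`, where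
  -- `f` vanishes.
  obtain ⟨f, hf⟩ : ∃ f : ℝ → ℝ, ∀ x, f x = -(x * (gammaConst.re * x + 2 * (x * Real.log x))) :=
    ⟨_, fun _ => rfl⟩
  have hfc : Continuous f := by
    have := Real.continuous_mul_log
    rw [funext hf]
    fun_prop
  have hfv : ∀ x : ℝ, 0 < x → f x = x ^ 2 * -(logTerm x).re := fun x hx => by
    rw [hf, hre x hx]; ring
  refine ⟨f a, ?_, fun σ hσ hσs => ?_⟩
  · rw [hfv a ha]
    have := hneg a ha le_rfl
    have : 0 < -(logTerm a).re := by linarith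
    positivity
  have hf0 : f 0 = 0 := by rw [hf]; ring
  obtain ⟨x, hx, hxσ⟩ := intermediate_value_Ioo ha.le hfc.continuousOn
    (show σ ∈ Set.Ioo (f 0) (f a) by rw [hf0]; exact ⟨hσ, hσs⟩)
  have hx0 : (x : ℂ) ≠ 0 := by exact_mod_cast hx.1.ne'
  have hLx := hneg x hx.1 hx.2.le
  have hL0 : logTerm x ≠ 0 := fun h => by rw [h, Complex.zero_re] at hLx; linarith
  have him : (logTerm x).im = -Real.pi := by
    rw [im_logTerm, Complex.arg_ofReal_of_nonneg hx.1.le]; ring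
  have hdec : logTerm x = ((logTerm x).re : ℂ) - Real.pi * Complex.I := by
    conv_lhs => rw [← Complex.re_add_im (logTerm x), him]
    push_cast; ring
  -- On the positive axis `logTerm x` has imaginary part `-π`. This choice of `e` removes it, so the
  -- real equation solved by the intermediate value theorem is enough; its size is at most `π /
  -- |logTerm x| ≤ κ`.
  refine ⟨x, Real.pi * Complex.I / logTerm x, hx.1, hx.2.trans hab, ?_, ?_⟩
  · rw [norm_div, norm_mul, Complex.norm_I, mul_one, Complex.norm_real,
      Real.norm_of_nonneg hpi.le, div_le_iff₀ (norm_pos_iff.2 hL0)]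
    have := le_norm_of_re_le_neg hLx
    rwa [div_le_iff₀' hκ] at this
  · rw [mul_assoc, mul_add, mul_one, mul_div_cancel₀ _ hL0, ← hxσ, hfv x hx.1]
    conv_lhs => rw [hdec]
    push_cast
    ring

/-! ## The normalized frequency -/

/-- In the variable `z = k / c` the second logarithm of `(*)` is `log z`, and `c² τ² = λ + 2μ` turns
the bracket into a nonzero multiple of `z² logTerm z + 4 (μ + δτ²) / λ`. -/
theorem leadingOrderEq_iff {lam mu τ δ c : ℝ} (hlam : 0 < lam) (hM : 0 < lam + 2 * mu)
    (hcτ : c * τ = Real.sqrt (lam + 2 * mu)) (z : ℂ) :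
    LeadingOrderEq lam mu τ δ (c * z) ↔ logTerm (c * z) = 0 ∨
      z ^ 2 * logTerm z = -((4 * (mu + δ * τ ^ 2) / lam : ℝ) : ℂ) := by
  have hs : Real.sqrt (lam + 2 * mu) ≠ 0 := (Real.sqrt_pos.2 hM).ne'
  have hsc : ((Real.sqrt (lam + 2 * mu) : ℝ) : ℂ) ≠ 0 := by exact_mod_cast hs
  have hz : (c : ℂ) * z * τ / ((Real.sqrt (lam + 2 * mu) : ℝ) : ℂ) = z := by
    rw [div_eq_iff hsc, ← hcτ]; push_cast; ring
  have hcτ2 : (c : ℂ) ^ 2 * (τ : ℂ) ^ 2 = ((lam + 2 * mu : ℝ) : ℂ) := by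
    rw [← Complex.ofReal_pow, ← Complex.ofReal_pow, ← Complex.ofReal_mul, ← mul_pow, hcτ,
      Real.sq_sqrt hM.le]
  obtain ⟨M, hMdef⟩ : ∃ M : ℂ, M = ((lam + 2 * mu : ℝ) : ℂ) := ⟨_, rfl⟩
  have hM0 : M ≠ 0 := by rw [hMdef]; exact_mod_cast hM.ne'
  have hl0 : (lam : ℂ) ≠ 0 := by exact_mod_cast hlam.ne'
  rw [LeadingOrderEq, hz, ← logTerm, ← logTerm, mul_eq_zero, ← hMdef]
  refine or_congr Iff.rfl ?_
  rw [← hMdef] at hcτ2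
  have e : ((mu + δ * τ ^ 2 : ℝ) : ℂ) / (4 * M) +
      ((c : ℂ) * z) ^ 2 * (τ : ℂ) ^ 2 * (lam : ℂ) * logTerm z / (16 * M ^ 2) =
      lam / (16 * M) * (z ^ 2 * logTerm z + ((4 * (mu + δ * τ ^ 2) / lam : ℝ) : ℂ)) := by
    rw [mul_pow, mul_right_comm ((c : ℂ) ^ 2), hcτ2]
    push_cast
    field_simp
    ring
  rw [e, mul_eq_zero, or_iff_right (div_ne_zero hl0 (mul_ne_zero (by norm_num) hM0)),
    add_eq_zero_iff_eq_neg]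


/-- The two right-hand sides differ by the factor `(λ + 2μ)/λ = 1 + 2μ/λ`, which tends to `1` with
`μ`; both tend to zero with the contrasts. -/
theorem contrast_bounds {lam₀ τ₁ lam mu τ δ ε κ s : ℝ} (hlam₀ : 0 < lam₀) (hlam : lam₀ ≤ lam)
    (hτ : 0 < τ) (hτ₁ : τ ≤ τ₁) (hmu : mu ∈ Set.Ioo 0 ε) (hδ : δ ∈ Set.Ioo 0 ε) (hκ : 0 < κ)
    (hs : 0 < s) (hεκ : 2 * ε ≤ κ * lam₀) (hεs : 4 * (1 + τ₁ ^ 2) * ε ≤ s * lam₀) :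
    4 * (mu + δ * τ ^ 2) / (lam + 2 * mu) ≤ 4 * (mu + δ * τ ^ 2) / lam ∧
      4 * (mu + δ * τ ^ 2) / lam < s ∧
      |4 * (mu + δ * τ ^ 2) / lam / (4 * (mu + δ * τ ^ 2) / (lam + 2 * mu)) - 1| ≤ κ ∧
      |4 * (mu + δ * τ ^ 2) / (lam + 2 * mu) / (4 * (mu + δ * τ ^ 2) / lam) - 1| ≤ κ := by
  have hl0 : 0 < lam := hlam₀.trans_le hlam
  have hmu0 := hmu.1
  have hδ0 := hδ.1
  have hM : 0 < lam + 2 * mu := by positivity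
  have hm : 0 < mu + δ * τ ^ 2 := by positivity
  have hmuκ : 2 * mu ≤ κ * lam := by
    linarith [hmu.2, mul_le_mul_of_nonneg_left hlam hκ.le]
  refine ⟨?_, ?_, ?_, ?_⟩
  · gcongr
    linarith
  · rw [div_lt_iff₀ hl0]
    have h1 : δ * τ ^ 2 ≤ ε * τ₁ ^ 2 :=
      mul_le_mul hδ.2.le (pow_le_pow_left₀ hτ.le hτ₁ 2) (by positivity) (hδ0.trans hδ.2).le
    have h2 : s * lam₀ ≤ s * lam := mul_le_mul_of_nonneg_left hlam hs.le
    linarith [hmu.2]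
  · have h1 : 4 * (mu + δ * τ ^ 2) / lam / (4 * (mu + δ * τ ^ 2) / (lam + 2 * mu)) - 1 =
        2 * mu / lam := by
      field_simp; ring
    rw [h1, abs_of_nonneg (by positivity), div_le_iff₀ hl0]
    exact hmuκ
  · have h1 : 4 * (mu + δ * τ ^ 2) / (lam + 2 * mu) / (4 * (mu + δ * τ ^ 2) / lam) - 1 =
        -(2 * mu / (lam + 2 * mu)) := by
      field_simp; ring
    rw [h1, abs_neg, abs_of_nonneg (by positivity), div_le_iff₀ hM]
    linarith [mul_pos hκ hmu0]

/-- A radius below which all smallness requirements hold. -/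
theorem exists_small_radius {b ρ₁ ρ₂ η r c : ℝ} (hb : 0 < b) (hρ₁ : 0 < ρ₁) (hρ₂ : 0 < ρ₂)
    (hη : 0 < η) (hr : 0 < r) :
    ∃ a : ℝ, 0 < a ∧ a ≤ b ∧ 2 * a ≤ ρ₁ ∧ 2 * a ≤ ρ₂ ∧ 2 * c * a ≤ η ∧ 2 * c * a ≤ r := by
  have hev : ∀ u v : ℝ, 0 < v → ∀ᶠ a in 𝓝[>] (0 : ℝ), u * a ≤ v := fun u v hv => by
    have h1 : Tendsto (fun a : ℝ => u * a) (𝓝 0) (𝓝 (u * 0)) :=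
      (continuous_const_mul u).tendsto 0
    rw [mul_zero] at h1
    exact (h1.mono_left nhdsWithin_le_nhds).eventually (ge_mem_nhds hv)
  obtain ⟨a, ⟨⟨⟨⟨h1, h2⟩, h3⟩, h4⟩, h5⟩, h6⟩ := (((((hev 1 b hb).and (hev 2 ρ₁ hρ₁)).and
    (hev 2 ρ₂ hρ₂)).and (hev (2 * c) η hη)).and (hev (2 * c) r hr)).and
      (self_mem_nhdsWithin (s := Set.Ioi (0 : ℝ)) (a := 0)) |>.exists
  exact ⟨a, h6, by linarith, h2, h3, h4, h5⟩

/-- The characteristic equation in terms of the pressure wave number `z = k / c`. -/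
theorem radialResonanceAt_iff_normalForm {lam mu τ δ c : ℝ} (hlam : 0 < lam) (hmu : 0 < mu)
    (hτ : 0 < τ) (hδ : 0 < δ) (hc : 0 < c) (hcτ : c * τ = Real.sqrt (lam + 2 * mu)) {z : ℂ}
    (hz : z ≠ 0) {e : ℂ}
    (hnf : ∀ m M : ℝ, 0 < m → 0 < M →
      (1 / ((c : ℂ) * z) ^ 2 * (-(1 / 2) + npValue (c * z)) * (1 / 2 + 1 / (M : ℂ) *
          (2 * ((mu / (mu + δ * τ ^ 2) * m : ℝ) : ℂ) * npNormalValue z -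
            ((M - 2 * (mu / (mu + δ * τ ^ 2) * m) : ℝ) : ℂ) * npValue z)) +
          (((1 - mu / (mu + δ * τ ^ 2)) * m : ℝ) : ℂ) * singleValue (c * z) *
            (1 / (M : ℂ) * singleNormalValue z) = 0 ↔
        z ^ 2 * logTerm z * (1 + e) = -((4 * m / M : ℝ) : ℂ))) :
    RadialResonanceAt lam mu τ δ (c * z) ↔
      z ^ 2 * logTerm z * (1 + e) =
        -((4 * (mu + δ * τ ^ 2) / (lam + 2 * mu) : ℝ) : ℂ) := by
  have hM : 0 < lam + 2 * mu := by positivity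
  have hm : 0 < mu + δ * τ ^ 2 := by positivity
  have hsc : ((Real.sqrt (lam + 2 * mu) : ℝ) : ℂ) ≠ 0 := by
    exact_mod_cast (Real.sqrt_pos.2 hM).ne'
  have hw : waveNumberP lam mu ((c : ℂ) * z * τ) = z := by
    rw [waveNumberP, div_eq_iff hsc, ← hcτ]; push_cast; ring
  have h1 : mu / (mu + δ * τ ^ 2) * (mu + δ * τ ^ 2) = mu := div_mul_cancel₀ _ hm.ne'
  have h2 : (1 - mu / (mu + δ * τ ^ 2)) * (mu + δ * τ ^ 2) = δ * τ ^ 2 := by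
    rw [sub_mul, h1]; ring
  rw [← hnf _ _ hm hM, h1, h2, add_sub_cancel_right, radialResonanceAt_iff_det hmu hM hτ
    (mul_ne_zero (by exact_mod_cast hc.ne') hz), hw]
  push_cast
  rfl

end

end Minnaert

/-! ### Choice of the constants and proof of the three claims -/

theorem theorem5p1 (lam₀ lam₁ τ₀ τ₁ : ℝ) (hlam₀ : 0 < lam₀) (hlam : lam₀ ≤ lam₁)
    (hτ₀ : 0 < τ₀) (hτ : τ₀ ≤ τ₁) :
    ∃ r : ℝ, 0 < r ∧ ∀ η : ℝ, 0 < η → ∃ ε : ℝ, 0 < ε ∧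
      ∀ lam mu τ δ : ℝ, lam ∈ Set.Icc lam₀ lam₁ → τ ∈ Set.Icc τ₀ τ₁ →
        mu ∈ Set.Ioo 0 ε → δ ∈ Set.Ioo 0 ε →
        -- strong resonance occurs, at a low frequency, with a density of the form `(b₁, b₂ ν)`
        (∃ k : ℂ, k ∈ Complex.slitPlane ∧ ‖k‖ < η ∧ ‖k‖ < r ∧
          Minnaert.StrongResonanceAt Minnaert.circleMeasure Minnaert.circleNormal lam mu τ δ k ∧
          Minnaert.RadialResonanceAt lam mu τ δ k) ∧
        -- every such low resonant frequency is a root of the equation to leading order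
        (∀ k : ℂ, k ∈ Complex.slitPlane → ‖k‖ < r → Minnaert.RadialResonanceAt lam mu τ δ k →
          ∃ k₀ : ℂ, k₀ ∈ Complex.slitPlane ∧ Minnaert.LeadingOrderEq lam mu τ δ k₀ ∧
            ‖k - k₀‖ ≤ η * ‖k₀‖) ∧
        -- and every low root is the leading-order term of such a resonant frequency
        (∀ k₀ : ℂ, k₀ ∈ Complex.slitPlane → ‖k₀‖ < r → Minnaert.LeadingOrderEq lam mu τ δ k₀ →
          ∃ k : ℂ, k ∈ Complex.slitPlane ∧ Minnaert.RadialResonanceAt lam mu τ δ k ∧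
            ‖k - k₀‖ ≤ η * ‖k₀‖) := by
  have hτ₁ : 0 < τ₁ := hτ₀.trans_le hτ
  have hlam₁ : 0 < lam₁ := hlam₀.trans_le hlam
  obtain ⟨c₀, hc₀⟩ : ∃ c₀ : ℝ, c₀ = Real.sqrt lam₀ / τ₁ := ⟨_, rfl⟩
  obtain ⟨c₁, hc₁⟩ : ∃ c₁ : ℝ, c₁ = Real.sqrt (lam₁ + 2) / τ₀ := ⟨_, rfl⟩
  have hc₀pos : 0 < c₀ := by rw [hc₀]; positivity
  have hc₁pos : 0 < c₁ := by rw [hc₁]; positivity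
  obtain ⟨ρ, hρ, E, hEd, hEs, hEnf⟩ := Minnaert.exists_normal_form (c₁ := c₁) hc₀pos
  obtain ⟨ρh, hρh, hEh⟩ := hEs (1 / 2) (by norm_num)
  obtain ⟨ρ₁, hρ₁, hρ₁ρ, hρ₁h⟩ : ∃ ρ₁ : ℝ, 0 < ρ₁ ∧ ρ₁ ≤ ρ ∧ ρ₁ ≤ ρh :=
    ⟨min ρ ρh, lt_min hρ hρh, min_le_left _ _, min_le_right _ _⟩
  -- The radius is fixed before `η`: it only has to ensure the normal form and `|E| |logTerm| ≤
  -- 1/2`. Since `c ≥ c₀`, `|k| < c₀ ρ₁` implies `|z| < ρ₁`.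
  refine ⟨c₀ * ρ₁, by positivity, fun η hη => ?_⟩
  obtain ⟨κ, b, hκ, hb, hmatch⟩ := Minnaert.exists_root_near_root hη
  obtain ⟨ρκ, hρκ, hEκ⟩ := hEs κ hκ
  obtain ⟨a, ha, hab, haκ, haρ, haη, har⟩ : ∃ a : ℝ, 0 < a ∧ a ≤ b ∧ 2 * a ≤ ρκ ∧ 2 * a ≤ ρ₁ ∧
      2 * c₁ * a ≤ η ∧ 2 * c₁ * a ≤ c₀ * ρ₁ :=
    Minnaert.exists_small_radius hb hρκ hρ₁ hη (by positivity)
  obtain ⟨s, hs, happrox⟩ := Minnaert.exists_real_approx_root hκ ha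
  -- `s' ≤ a²` confines every root below the fixed radius to `|z| < a`, where the matching with
  -- precision `η` applies; `s' ≤ s` provides the approximate real root.
  obtain ⟨s', hs', hss, hsa⟩ : ∃ s' : ℝ, 0 < s' ∧ s' ≤ s ∧ s' ≤ a ^ 2 :=
    ⟨min s (a ^ 2), by positivity, min_le_left _ _, min_le_right _ _⟩
  obtain ⟨ε, hε, hε1, hεκ, hεs⟩ : ∃ ε : ℝ, 0 < ε ∧ ε ≤ 1 ∧ 2 * ε ≤ κ * lam₀ ∧
      4 * (1 + τ₁ ^ 2) * ε ≤ s' * lam₀ := by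
    refine ⟨min 1 (min (κ * lam₀ / 2) (s' * lam₀ / (4 * (1 + τ₁ ^ 2)))), by positivity,
      min_le_left _ _, ?_, ?_⟩
    · exact (le_div_iff₀' two_pos).1 ((min_le_right _ _).trans (min_le_left _ _))
    · exact (le_div_iff₀' (by positivity)).1 ((min_le_right _ _).trans (min_le_right _ _))
  refine ⟨ε, hε, fun lam mu τ δ hl ht hmu hδ => ?_⟩
  have hl0 : 0 < lam := hlam₀.trans_le hl.1
  have ht0 : 0 < τ := hτ₀.trans_le ht.1
  have hmu0 := hmu.1
  have hδ0 := hδ.1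
  have hM : 0 < lam + 2 * mu := by positivity
  have hm : 0 < mu + δ * τ ^ 2 := by positivity
  obtain ⟨c, hc⟩ : ∃ c : ℝ, c = Real.sqrt (lam + 2 * mu) / τ := ⟨_, rfl⟩
  have hcτ : c * τ = Real.sqrt (lam + 2 * mu) := by rw [hc, div_mul_cancel₀ _ ht0.ne']
  have hcmem : c ∈ Set.Icc c₀ c₁ := by
    rw [hc, hc₀, hc₁]
    have h1 : lam + 2 * mu ≤ lam₁ + 2 := by linarith [hl.2, hmu.2]
    have h2 : lam₀ ≤ lam + 2 * mu := by linarith [hl.1]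
    have h3 := ht.1
    have h4 := ht.2
    constructor <;> gcongr
  have hcpos : 0 < c := hc₀pos.trans_le hcmem.1
  have hcc : (c : ℂ) ≠ 0 := by exact_mod_cast hcpos.ne'
  have hcinv : ((c⁻¹ : ℝ) : ℂ) = (c : ℂ)⁻¹ := Complex.ofReal_inv c
  -- `t` is the share of `μ` in `μ + δτ²`. The contrasts `μ` and `δ` may tend to zero at unrelated
  -- rates, and `t` in `[0, 1]` keeps the estimates uniform.
  obtain ⟨t, htdef⟩ : ∃ t : ℝ, t = mu / (mu + δ * τ ^ 2) := ⟨_, rfl⟩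
  have htmem : t ∈ Set.Icc (0 : ℝ) 1 := by
    rw [htdef]
    refine ⟨by positivity, (div_le_one hm).2 ?_⟩
    have : 0 ≤ δ * τ ^ 2 := by positivity
    linarith
  obtain ⟨σ, hσ⟩ : ∃ σ : ℝ, σ = 4 * (mu + δ * τ ^ 2) / (lam + 2 * mu) := ⟨_, rfl⟩
  obtain ⟨σ₀, hσ₀⟩ : ∃ σ₀ : ℝ, σ₀ = 4 * (mu + δ * τ ^ 2) / lam := ⟨_, rfl⟩
  have hσpos : 0 < σ := by rw [hσ]; positivity
  have hσ₀pos : 0 < σ₀ := by rw [hσ₀]; positivity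
  obtain ⟨hσσ₀, hσ₀s, hq1, hq2⟩ : σ ≤ σ₀ ∧ σ₀ < s' ∧ |σ₀ / σ - 1| ≤ κ ∧ |σ / σ₀ - 1| ≤ κ := by
    rw [hσ, hσ₀]
    exact Minnaert.contrast_bounds hlam₀ hl.1 ht0 ht.2 hmu hδ hκ hs' hεκ hεs
  have hq3 : |σ / σ - 1| ≤ κ := by
    rw [div_self hσpos.ne', sub_self, abs_zero]; exact hκ.le
  have hres : ∀ z : ℂ, z ≠ 0 → ‖z‖ < ρ → (Minnaert.RadialResonanceAt lam mu τ δ (c * z) ↔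
      z ^ 2 * Minnaert.logTerm z * (1 + E c t z) = -(σ : ℂ)) := fun z hz hzρ => by
    rw [hσ]
    refine Minnaert.radialResonanceAt_iff_normalForm hl0 hmu0 ht0 hδ0 hcpos hcτ hz ?_
    rw [← htdef]
    exact (hEnf c hcmem t htmem z hz hzρ).2.2
  have hlead := Minnaert.leadingOrderEq_iff (δ := δ) hl0 hM hcτ
  rw [← hσ₀] at hlead
  have hnorm : ∀ z : ℂ, ‖(c : ℂ) * z‖ = c * ‖z‖ := fun z => by
    rw [norm_mul, Complex.norm_real, Real.norm_of_nonneg hcpos.le]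
  have hscale : ∀ k : ℂ, k ∈ Complex.slitPlane → ‖k‖ < c₀ * ρ₁ →
      ∃ z ∈ Complex.slitPlane, k = c * z ∧ ‖z‖ < ρ₁ := fun k hk hkr => by
    have h1 : k = c * (((c⁻¹ : ℝ) : ℂ) * k) := by
      rw [hcinv, mul_inv_cancel_left₀ hcc]
    refine ⟨_, Minnaert.ofReal_mul_mem_slitPlane (inv_pos.2 hcpos) hk, h1, ?_⟩
    rw [h1, hnorm] at hkr
    have h2 : c₀ * ρ₁ ≤ c * ρ₁ := mul_le_mul_of_nonneg_right hcmem.1 hρ₁.le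
    exact lt_of_mul_lt_mul_left (hkr.trans_le h2) hcpos.le
  have hdist : ∀ z w : ℂ, ‖z - w‖ ≤ η * ‖w‖ → ‖(c : ℂ) * z - c * w‖ ≤ η * ‖(c : ℂ) * w‖ :=
    fun z w h => by
      rw [← mul_sub, hnorm, hnorm, mul_left_comm]
      exact mul_le_mul_of_nonneg_left h hcpos.le
  have hEκ' : ∀ z : ℂ, z ≠ 0 → ‖z‖ < 2 * a → ‖E c t z‖ ≤ κ := fun z hz hza => by
    have h1 := hEκ c hcmem t htmem z hz (hza.trans_le haκ)
    have h2 := Minnaert.le_norm_of_re_le_neg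
      (hEnf c hcmem t htmem z hz (by linarith)).2.1
    nlinarith [norm_nonneg (E c t z)]
  -- roots of the leading-order equation are continued to resonances
  have hcont : ∀ (z₁ e : ℂ) (σ₁ : ℝ), 0 < z₁.re → ‖z₁‖ < a → 0 < σ₁ → |σ / σ₁ - 1| ≤ κ →
      z₁ ^ 2 * Minnaert.logTerm z₁ * (1 + e) = -(σ₁ : ℂ) → ‖e‖ ≤ κ →
      ∃ z ∈ Complex.slitPlane, ‖z‖ ≤ 2 * ‖z₁‖ ∧ ‖z - z₁‖ ≤ η * ‖z₁‖ ∧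
        Minnaert.RadialResonanceAt lam mu τ δ (c * z) := by
    intro z₁ e σ₁ hre hz₁ hσ₁ hq heq he
    obtain ⟨z, hz, h1, h2, -, h3⟩ := hmatch z₁ e σ₁ σ (E c t) hre (hz₁.trans_le hab) hσ₁ hσpos hq
      heq he
      ((hEd c hcmem t htmem).mono
        (Set.inter_subset_inter_right _ (Metric.ball_subset_ball (by linarith))))
      (fun z hz => hEκ' z (Complex.slitPlane_ne_zero hz.1) (by
        have : ‖z‖ < 2 * ‖z₁‖ := by simpa using hz.2
        linarith))
    exact ⟨z, hz, h1, h2, (hres z (Complex.slitPlane_ne_zero hz) (by linarith)).2 h3⟩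
  refine ⟨?_, ?_, ?_⟩
  -- The approximate root is taken for `σ` itself, so the continuation changes only the error term.
  · obtain ⟨x, e, hx, hxa, he, hxe⟩ := happrox σ hσpos (by linarith)
    have hxn : ‖(x : ℂ)‖ = x := by rw [Complex.norm_real, Real.norm_of_nonneg hx.le]
    obtain ⟨z, hz, hz1, -, hz2⟩ := hcont x e σ (by simpa using hx) (by rwa [hxn]) hσpos hq3 hxe he
    rw [hxn] at hz1
    have hk : ‖(c : ℂ) * z‖ < 2 * c₁ * a := by
      rw [hnorm]
      have h1 : c * ‖z‖ ≤ c₁ * ‖z‖ := mul_le_mul_of_nonneg_right hcmem.2 (norm_nonneg z)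
      have h2 : c₁ * ‖z‖ < c₁ * (2 * a) := mul_lt_mul_of_pos_left (by linarith) hc₁pos
      linarith
    refine ⟨c * z, Minnaert.ofReal_mul_mem_slitPlane hcpos hz, hk.trans_le haη, hk.trans_le har,
      ?_, hz2⟩
    obtain ⟨b₁, b₂, h⟩ := hz2
    exact ⟨_, _, h⟩
  · intro k hk hkr hkres
    obtain ⟨z, hz, rfl, hzρ⟩ := hscale k hk hkr
    have hz0 := Complex.slitPlane_ne_zero hz
    have heq := (hres z hz0 (by linarith)).1 hkres
    have hEL := hEh c hcmem t htmem z hz0 (by linarith)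
    have hL := (hEnf c hcmem t htmem z hz0 (by linarith)).2.1
    have hza : ‖z‖ < a :=
      lt_of_pow_lt_pow_left₀ 2 ha.le
        ((Minnaert.norm_sq_le_of_root hσpos heq hEL hL).trans_lt (by linarith))
    have hre := Minnaert.re_pos_of_root hz hσpos heq (by linarith) hL
    -- The target equation has zero error and right-hand side `-σ₀`, hence is exactly the second
    -- factor of `(*)`. Closeness relative to `z₀` is the estimate used.
    obtain ⟨z₀, hz₀, -, -, h1, h2⟩ := hmatch z (E c t z) σ σ₀ (fun _ => 0) hre (hza.trans_le hab)
      hσpos hσ₀pos hq1 heq (hEκ' z hz0 (by linarith)) (differentiableOn_const 0)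
      (fun _ _ => by rw [norm_zero]; exact hκ.le)
    rw [add_zero, mul_one] at h2
    refine ⟨c * z₀, Minnaert.ofReal_mul_mem_slitPlane hcpos hz₀, (hlead z₀).2 (Or.inr h2),
      hdist _ _ ?_⟩
    rwa [norm_sub_rev]
  · intro k₀ hk₀ hkr hkeq
    obtain ⟨z₀, hz₀, rfl, hzρ⟩ := hscale k₀ hk₀ hkr
    have hz0 := Complex.slitPlane_ne_zero hz₀
    -- The first factor of `(*)` does not vanish at this radius, so the root belongs to the second.
    obtain ⟨hL0, hL, -⟩ := hEnf c hcmem t htmem z₀ hz0 (by linarith)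
    have heq := ((hlead z₀).1 hkeq).resolve_left hL0
    rw [← mul_one (z₀ ^ 2 * Minnaert.logTerm z₀), ← add_zero (1 : ℂ)] at heq
    have h0 : ‖(0 : ℂ)‖ * ‖Minnaert.logTerm z₀‖ ≤ 1 / 2 := by
      rw [norm_zero, zero_mul]; norm_num
    have hza : ‖z₀‖ < a :=
      lt_of_pow_lt_pow_left₀ 2 ha.le
        ((Minnaert.norm_sq_le_of_root hσ₀pos heq h0 hL).trans_lt (by linarith))
    have hre := Minnaert.re_pos_of_root hz₀ hσ₀pos heq (by linarith) hL
    obtain ⟨z, hz, -, h1, h2⟩ := hcont z₀ 0 σ₀ hre hza hσ₀pos hq2 heq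
      (by rw [norm_zero]; exact hκ.le)
    exact ⟨c * z, Minnaert.ofReal_mul_mem_slitPlane hcpos hz, h2, hdist _ _ h1⟩
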